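/- Let $\{\zeta_j\}_{j\in\mathbb Z}$ be i.i.d. real random variables with $E\zeta_0=0$, $E\zeta_0^2=1$, $E\zeta_0^4<\infty$, and let $X_j=\sum_{k=0}^\infty a_k\zeta_{j-k}$, $j\in\mathbb Z$ (convergence in mean square), where $a_k$ are real and $\sum_k a_k^2<\infty$. Assume that the process $\{X_j\}$ has a spectral density $f_X$ on $\Pi=[-\pi,\pi]$, that is, $\operatorname{Cov}(X_{j+k},X_j)=\int_{-\pi}^{\pi}e^{ikv}f_X(v)\,dv$ for all $j,k\in\mathbb Z$, of the form $$f_X(u)=|u|^{-2d}g(u),\qquad 0<|u|\le\pi,$$ for some $|d|<1/2$, where $g$ is continuous on $\Pi$ and $0<C_1\le g(u)\le C_2<\infty$ for $u\in\Pi$. For $n\ge1$ put $u_j=2\pi j/n$, $\nu=[n/2]-1$, $f_{X,j}=f_X(u_j)$ and $I_X(u)=(2\pi n)^{-1}\bigl|\sum_{t=1}^n e^{itu}X_t\bigr|^2$. For a triangular array of real weights $b_{n,j}$ put $$Q_{n,X}=\sum_{j=1}^{\nu}b_{n,j}I_X(u_j),\qquad B_{f,n}^2=\sum_{j=1}^{\nu}(b_{n,j}f_{X,j})^2,\qquad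 b_{f,n}=\max_{1\le j\le\nu}|b_{n,j}|f_{X,j}$$ (sums and the maximum are zero if $\nu\le 0$). (i) $Q_{n,X}$ has a finite second moment, and there is a constant $C$, not depending on $n$ or on the weights, such that $$E(Q_{n,X}-EQ_{n,X})^2\le C\,B_{f,n}^2 .$$ (ii) There is a constant $C$, not depending on $n$ or on the weights, such that $$E\Bigl(Q_{n,X}-\sum_{j=1}^{\nu}b_{n,j}f_{X,j}\Bigr)^2\le C\,B_{f,n}^2$$ in each of the following three cases, where $\Lambda_\beta(\Pi)$ is the class of functions $g$ on $\Pi$ with $|g(u)-g(v)|\le L|u-v|^\beta$ for some constant $L$ and all $u,v\in\Pi$: (c1) $d=0$ and $g\in\Lambda_\beta(\Pi)$ for some $1/2<\beta\le1$; (c2) $d\neq0$ and $g\in\Lambda_\beta(\Pi)$ for some $1/2<\beta\le1$; (c3) $f_X$ is differentiable on $(0,\pi]$ (from the left at $\pi$), and for some constant $K$, $|\dot f_X(u)|\le K u^{-1-2d}$ for $0<u\le\pi$. Moreover, in case (c1), for all weights, $$EQ_{n,X}-\sum_{j=1}^{\nu}b_{n,j}f_{X,j}=o(B_{f,n})\qquad(n\to\infty),$$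 and the same holds in cases (c2) and (c3) for all weights with $b_{f,n}/B_{f,n}\to0$ as $n\to\infty$. -/

import Mathlib

open MeasureTheory ProbabilityTheory Filter Topology Asymptotics
open scoped NNReal

noncomputable section

/-- The real random variables `ζ j`, `j ∈ ℤ`, are i.i.d. and standardized
(mean zero, variance one), with a finite fourth moment. -/
structure IsStandardizedNoise {Ω : Type*} [MeasurableSpace Ω] (P : Measure Ω)
    (ζ : ℤ → Ω → ℝ) : Prop where
  indep : iIndepFun ζ P
  identDistrib : ∀ j, IdentDistrib (ζ j) (ζ 0) P P
  fourthMoment : MemLp (ζ 0) 4 P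
  mean_zero : ∫ ω, ζ 0 ω ∂P = 0
  variance_one : ∫ ω, ζ 0 ω ^ 2 ∂P = 1

/-- `X j = ∑_{k ≥ 0} a k * ζ (j - k)` for every `j ∈ ℤ`, the series converging in mean square,
where `∑ (a k)² < ∞`. -/
structure IsLinearProcess {Ω : Type*} [MeasurableSpace Ω] (P : Measure Ω)
    (a : ℕ → ℝ) (ζ X : ℤ → Ω → ℝ) : Prop where
  summable_sq : Summable fun k => a k ^ 2
  memLp : ∀ j, MemLp (X j) 2 P
  tendsto_series : ∀ j, Tendsto
    (fun N : ℕ => eLpNorm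
      (fun ω => X j ω - ∑ k ∈ Finset.range N, a k * ζ (j - (k : ℤ)) ω) 2 P)
    atTop (𝓝 0)

/-- `f` (read on `[-π, π]`) is a spectral density of `X`: it is nonnegative and integrable, and
`Cov(X_{j+k}, X_j) = ∫_{-π}^{π} e^{ikv} f(v) dv` for all `j, k ∈ ℤ`. -/
structure IsSpectralDensity {Ω : Type*} [MeasurableSpace Ω] (P : Measure Ω)
    (X : ℤ → Ω → ℝ) (f : ℝ → ℝ) : Prop where
  nonneg : ∀ u ∈ Set.Icc (-Real.pi) Real.pi, 0 ≤ f u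
  integrable : IntervalIntegrable f volume (-Real.pi) Real.pi
  cov_eq : ∀ j k : ℤ, ((covariance (X (j + k)) (X j) P : ℝ) : ℂ) =
    ∫ v in (-Real.pi)..Real.pi, Complex.exp (Complex.I * (k : ℂ) * (v : ℂ)) * (f v : ℂ)

/-- `f(u) = |u|^{-2d} g(u)` on `[-π, π]` (away from the possible singularity `u = 0`), with
`|d| < 1/2` and `g` continuous and bounded away from `0` and `∞` on `[-π, π]`. -/
structure HasMemoryForm (f : ℝ → ℝ) (d : ℝ) (g : ℝ → ℝ) : Prop where
  abs_d_lt : |d| < 1 / 2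
  continuousOn : ContinuousOn g (Set.Icc (-Real.pi) Real.pi)
  bounds : ∃ C₁ C₂ : ℝ, 0 < C₁ ∧ ∀ u ∈ Set.Icc (-Real.pi) Real.pi, C₁ ≤ g u ∧ g u ≤ C₂
  eq : ∀ u ∈ Set.Icc (-Real.pi) Real.pi, u ≠ 0 → f u = |u| ^ (-2 * d) * g u

/-- The Fourier frequency `u_j = 2πj/n`. -/
def fourierFreq (n j : ℕ) : ℝ := 2 * Real.pi * j / n

/-- The number `ν = [n/2] - 1` of frequencies that are used (no frequencies if `n ≤ 3`). -/
def numFreq (n : ℕ) : ℕ := n / 2 - 1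

/-- The periodogram `I(u) = (2πn)⁻¹ |∑_{t=1}^n e^{itu} x_t|²`. -/
def periodogram (n : ℕ) (x : ℤ → ℝ) (u : ℝ) : ℝ :=
  (2 * Real.pi * n)⁻¹ *
    ‖∑ t ∈ Finset.Icc 1 n,
      Complex.exp (Complex.I * (t : ℂ) * (u : ℂ)) * (x (t : ℤ) : ℂ)‖ ^ 2

/-- The weighted sum of periodograms `Q_{n,X} = ∑_{j=1}^ν b_{n,j} I_X(u_j)`, a random variable. -/
def weightedPeriodogramSum {Ω : Type*} (b : ℕ → ℕ → ℝ) (X : ℤ → Ω → ℝ) (n : ℕ) (ω : Ω) : ℝ :=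
  ∑ j ∈ Finset.Icc 1 (numFreq n), b n j * periodogram n (fun t => X t ω) (fourierFreq n j)

/-- The target `∑_{j=1}^ν b_{n,j} f(u_j)`. -/
def weightedSpectralSum (b : ℕ → ℕ → ℝ) (f : ℝ → ℝ) (n : ℕ) : ℝ :=
  ∑ j ∈ Finset.Icc 1 (numFreq n), b n j * f (fourierFreq n j)

/-- `B_{f,n} = (∑_{j=1}^ν (b_{n,j} f(u_j))²)^{1/2}`. -/
def weightNorm (b : ℕ → ℕ → ℝ) (f : ℝ → ℝ) (n : ℕ) : ℝ :=
  Real.sqrt (∑ j ∈ Finset.Icc 1 (numFreq n), (b n j * f (fourierFreq n j)) ^ 2)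

/-- `b_{f,n} = max_{1 ≤ j ≤ ν} |b_{n,j} f(u_j)|` (zero if `ν = 0`). -/
def weightMax (b : ℕ → ℕ → ℝ) (f : ℝ → ℝ) (n : ℕ) : ℝ :=
  (((Finset.Icc 1 (numFreq n)).sup fun j => ‖b n j * f (fourierFreq n j)‖₊ : ℝ≥0) : ℝ)

/-- Uniform negligibility of the weights: `b_{f,n} / B_{f,n} → 0`. -/
def WeightsNegligible (b : ℕ → ℕ → ℝ) (f : ℝ → ℝ) : Prop :=
  Tendsto (fun n => weightMax b f n / weightNorm b f n) atTop (𝓝 0)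

/-- `g ∈ Λ_β[-π, π]` for some `1/2 < β ≤ 1`. -/
def IsLipschitzAboveHalf (g : ℝ → ℝ) : Prop :=
  ∃ β : ℝ≥0, 1 / 2 < β ∧ β ≤ 1 ∧ ∃ L : ℝ≥0, HolderOnWith L β g (Set.Icc (-Real.pi) Real.pi)

/-- Case (c1): `d = 0` and `g` Lipschitz with parameter `β > 1/2`. -/
def CaseC1 (d : ℝ) (g : ℝ → ℝ) : Prop := d = 0 ∧ IsLipschitzAboveHalf g

/-- Case (c2): `d ≠ 0` and `g` Lipschitz with parameter `β > 1/2`. -/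
def CaseC2 (d : ℝ) (g : ℝ → ℝ) : Prop := d ≠ 0 ∧ IsLipschitzAboveHalf g

/-- Case (c3): `f` is differentiable on `(0, π]` (one-sidedly at `π`) and
`|f'(u)| ≤ K u^{-1-2d}` there. -/
def CaseC3 (f : ℝ → ℝ) (d : ℝ) : Prop :=
  ∃ K : ℝ, ∀ u ∈ Set.Ioc 0 Real.pi,
    ∃ D : ℝ, HasDerivWithinAt f D (Set.Ioc 0 Real.pi) u ∧ |D| ≤ K * u ^ (-1 - 2 * d)

end

/-! Variance. The cosine and sine transforms `Y_r` of the sample at the Fourier frequencies are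
mean-square limits of linear forms in the noise, and `Q = ∑ β_r Y_r²`. For a symmetric matrix `A`, a
quadratic form in the noise has variance at most `(2 + E ζ₀⁴)` times the squared Frobenius norm of
`A`. For `A = ∑ β_r l_r l_rᵀ` that norm is `∑ β_r β_s (E Y_r Y_s)²`, so only the covariances of the
transforms matter. These are Toeplitz forms with symbol `f`.

No smoothness of `g` is needed here, because `f` can be replaced by an explicit density. The
Frobenius norm is monotone on positive semidefinite matrices, and `f ≤ h` orders the Gram matrices
(`sum_mul_toeplitzForm_sq_le`). The form of `f` gives `f ≤ M (2 sin(u/2))^{-2d}`, the spectral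
density of fractional noise up to a constant. Its Fourier coefficients obey a two-term recursion, so
they decay like `h^{2d-1}` and are monotone in modulus. Telescoping the double exponential sum along
diagonals, at two roots of unity, reduces the covariance of the transforms at `u_j ≠ u_k` to
truncated conjugate series `∑ c(h) sin(hv) = O(v^{-2d})`. The covariance is therefore `O(n
(u_j^{-2d} + u_k^{-2d}) / |j-k|)`. Since `u_j / u_k ≤ 2|j-k|`, its square is at most a constant
times `n² u_j^{-2d} u_k^{-2d} |j-k|^{|2d|-2}`. That kernel is summable because `|2d| < 1`, and
Schur's test gives the bound `C B²` (`exists_sum_mul_toeplitzForm_fracDensity_sq_le`).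

Bias. `E I(u_j)` is the average of `f` against a folded Fejér kernel, which is at most `8n / (1 +
n|u - u_j|)²`. In each of the three cases `f` is Hölder of some order `γ ∈ (1/2, 1)` relative to its
own size, on the scale of the distance to the origin, so the relative error at `u_j` is `O(j^{-γ})`.
As `j^{-γ}` is square summable, Cauchy–Schwarz gives a bias `O(B)`, hence the mean-square error
bound. If `d = 0` the Hölder bound is uniform, the relative error is `O(n^{-γ})`, and summing over
at most `n` frequencies gives `O(n^{1/2-γ} B) = o(B)`. Otherwise finitely many low frequencies are
controlled by `b_{f,n} = o(B)` and the remaining ones by the tail of the series. -/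

/-! ### Variance of quadratic forms in the noise -/

section QuadraticForms

variable {Ω : Type*} [MeasurableSpace Ω] {P : Measure Ω}

/-- Adding to a centred variable `D` the increment `a (Z² - 1) + 2 Z L`, where `Z` is standardized
and independent of `(D, L)`, adds the second moments. -/
theorem integral_sq_add_increment [IsProbabilityMeasure P] {D L Z : Ω → ℝ} (hD : MemLp D 2 P) (hL : MemLp L 4 P)
    (hZ : MemLp Z 4 P) (hind : IndepFun (fun ω => (D ω, L ω)) Z P)
    (hL0 : ∫ ω, L ω ∂P = 0) (hD0 : ∫ ω, D ω ∂P = 0)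
    (hZ0 : ∫ ω, Z ω ∂P = 0) (hZ1 : ∫ ω, Z ω ^ 2 ∂P = 1) (a : ℝ) :
    ∫ ω, (D ω + a * (Z ω ^ 2 - 1) + 2 * Z ω * L ω) ^ 2 ∂P =
      ∫ ω, D ω ^ 2 ∂P + a ^ 2 * (∫ ω, Z ω ^ 4 ∂P - 1) + 4 * ∫ ω, L ω ^ 2 ∂P := by
  have hL2 : MemLp L 2 P := hL.mono_exponent (by norm_num)
  have hZ2 : MemLp Z 2 P := hZ.mono_exponent (by norm_num)
  have h442 : ENNReal.HolderTriple 4 4 2 := ⟨by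
    rw [← two_mul, show (4 : ENNReal) = 2 * 2 by norm_num,
      ENNReal.mul_inv (by simp) (by simp), ← mul_assoc,
      ENNReal.mul_inv_cancel (by simp) (by simp), one_mul]⟩
  have hZZ : MemLp (fun ω => Z ω ^ 2 - 1) 2 P := by
    have := (hZ.mul (r := 2) hZ).sub (memLp_const (1 : ℝ))
    refine this.congr_norm ?_ ?_
    · exact (hZ.1.pow 2).sub aestronglyMeasurable_const
    · filter_upwards with ω
      simp [pow_two]
  have iD : Integrable D P := hD.integrable one_le_two
  have iL : Integrable L P := hL2.integrable one_le_two
  have iZ : Integrable Z P := hZ2.integrable one_le_two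
  have iZ2 : Integrable (fun ω => Z ω ^ 2) P := hZ2.integrable_sq
  have iZZ : Integrable (fun ω => Z ω ^ 2 - 1) P := hZZ.integrable one_le_two
  have iD2 : Integrable (fun ω => D ω ^ 2) P := hD.integrable_sq
  have iL2 : Integrable (fun ω => L ω ^ 2) P := hL2.integrable_sq
  have iZZ2 : Integrable (fun ω => (Z ω ^ 2 - 1) ^ 2) P := hZZ.integrable_sq
  have iDL : Integrable (fun ω => D ω * L ω) P := hD.integrable_mul hL2
  have iZ3 : Integrable (fun ω => (Z ω ^ 2 - 1) * Z ω) P := hZZ.integrable_mul hZ2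
  have ind (φ : ℝ × ℝ → ℝ) (ψ : ℝ → ℝ) (hφ : Measurable φ) (hψ : Measurable ψ) :
      IndepFun (fun ω => φ (D ω, L ω)) (fun ω => ψ (Z ω)) P := hind.comp hφ hψ
  have e1 : IndepFun (fun ω => L ω ^ 2) (fun ω => Z ω ^ 2) P :=
    ind (fun x => x.2 ^ 2) (fun z => z ^ 2) (by fun_prop) (by fun_prop)
  have e2 : IndepFun (fun ω => D ω) (fun ω => Z ω ^ 2 - 1) P :=
    ind (fun x => x.1) (fun z => z ^ 2 - 1) (by fun_prop) (by fun_prop)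
  have e3 : IndepFun (fun ω => D ω * L ω) (fun ω => Z ω) P :=
    ind (fun x => x.1 * x.2) (fun z => z) (by fun_prop) (by fun_prop)
  have e4 : IndepFun (fun ω => L ω) (fun ω => (Z ω ^ 2 - 1) * Z ω) P :=
    ind (fun x => x.2) (fun z => (z ^ 2 - 1) * z) (by fun_prop) (by fun_prop)
  have j1 : Integrable (fun ω => L ω ^ 2 * Z ω ^ 2) P := e1.integrable_mul iL2 iZ2
  have j2 : Integrable (fun ω => D ω * (Z ω ^ 2 - 1)) P := e2.integrable_mul iD iZZ
  have j3 : Integrable (fun ω => D ω * L ω * Z ω) P := e3.integrable_mul iDL iZ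
  have j4 : Integrable (fun ω => L ω * ((Z ω ^ 2 - 1) * Z ω)) P := e4.integrable_mul iL iZ3
  have k1 := e1.integral_fun_mul_eq_mul_integral iL2.1 iZ2.1
  have k2 := e2.integral_fun_mul_eq_mul_integral iD.1 iZZ.1
  have k3 := e3.integral_fun_mul_eq_mul_integral iDL.1 iZ.1
  have k4 := e4.integral_fun_mul_eq_mul_integral iL.1 iZ3.1
  -- Each mixed product has an independent factor of mean zero. The third moment of `Z` occurs only
  -- multiplied by the mean of `L`, so it need not vanish.
  rw [hZ1, mul_one] at k1
  rw [hD0, zero_mul] at k2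
  rw [hZ0, mul_zero] at k3
  rw [hL0, zero_mul] at k4
  have k5 : ∫ ω, (Z ω ^ 2 - 1) ^ 2 ∂P = ∫ ω, Z ω ^ 4 ∂P - 1 := by
    have hZ4 : Integrable (fun ω => Z ω ^ 4) P := by
      have := (iZZ2.add (iZ2.const_mul 2)).sub (integrable_const (1 : ℝ))
      refine this.congr ?_
      filter_upwards with ω
      simp; ring
    have : ∀ ω, (Z ω ^ 2 - 1) ^ 2 = Z ω ^ 4 - 2 * Z ω ^ 2 + 1 := fun ω => by ring
    simp_rw [this]
    have s0 : Integrable (fun ω => Z ω ^ 4 - 2 * Z ω ^ 2) P := hZ4.sub (iZ2.const_mul 2)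
    rw [integral_add s0 (integrable_const _),
      integral_sub hZ4 (iZ2.const_mul 2), integral_const_mul, hZ1]
    simp; ring
  have expand : ∀ ω, (D ω + a * (Z ω ^ 2 - 1) + 2 * Z ω * L ω) ^ 2 =
      D ω ^ 2 + a ^ 2 * (Z ω ^ 2 - 1) ^ 2 + 4 * (L ω ^ 2 * Z ω ^ 2)
      + (2 * a) * (D ω * (Z ω ^ 2 - 1)) + 4 * (D ω * L ω * Z ω)
      + (4 * a) * (L ω * ((Z ω ^ 2 - 1) * Z ω)) := fun ω => by ring
  simp_rw [expand]
  have s1 : Integrable (fun ω => D ω ^ 2 + a ^ 2 * (Z ω ^ 2 - 1) ^ 2) P :=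
    iD2.add (iZZ2.const_mul (a ^ 2))
  have s2 : Integrable (fun ω => D ω ^ 2 + a ^ 2 * (Z ω ^ 2 - 1) ^ 2
      + 4 * (L ω ^ 2 * Z ω ^ 2)) P := s1.add (j1.const_mul 4)
  have s3 : Integrable (fun ω => D ω ^ 2 + a ^ 2 * (Z ω ^ 2 - 1) ^ 2 + 4 * (L ω ^ 2 * Z ω ^ 2)
      + (2 * a) * (D ω * (Z ω ^ 2 - 1))) P := s2.add (j2.const_mul (2 * a))
  have s4 : Integrable (fun ω => D ω ^ 2 + a ^ 2 * (Z ω ^ 2 - 1) ^ 2 + 4 * (L ω ^ 2 * Z ω ^ 2)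
      + (2 * a) * (D ω * (Z ω ^ 2 - 1)) + 4 * (D ω * L ω * Z ω)) P := s3.add (j3.const_mul 4)
  rw [integral_add s4 (j4.const_mul (4 * a)), integral_add s3 (j3.const_mul 4),
    integral_add s2 (j2.const_mul (2 * a)), integral_add s1 (j1.const_mul 4),
    integral_add iD2 (iZZ2.const_mul (a ^ 2))]
  simp only [integral_const_mul, k1, k2, k3, k4, k5]
  ring

namespace IsStandardizedNoise

variable {ζ : ℤ → Ω → ℝ}

theorem memLp_four (j : ℤ) (hζ : IsStandardizedNoise P ζ) : MemLp (ζ j) 4 P :=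
  (hζ.identDistrib j).memLp_iff.2 hζ.fourthMoment

theorem memLp_two [IsProbabilityMeasure P] (j : ℤ) (hζ : IsStandardizedNoise P ζ) : MemLp (ζ j) 2 P :=
  (hζ.memLp_four j).mono_exponent (by norm_num)

theorem integral_eq_zero (j : ℤ) (hζ : IsStandardizedNoise P ζ) : ∫ ω, ζ j ω ∂P = 0 :=
  (hζ.identDistrib j).integral_eq.trans hζ.mean_zero

theorem integral_pow_eq (j : ℤ) (k : ℕ) (hζ : IsStandardizedNoise P ζ) :
    ∫ ω, ζ j ω ^ k ∂P = ∫ ω, ζ 0 ω ^ k ∂P :=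
  ((hζ.identDistrib j).comp (u := fun x : ℝ => x ^ k) (by fun_prop)).integral_eq

theorem integral_mul_eq [IsProbabilityMeasure P] (i j : ℤ) (hζ : IsStandardizedNoise P ζ) :
    ∫ ω, ζ i ω * ζ j ω ∂P = if i = j then 1 else 0 := by
  split_ifs with h
  · subst h
    simpa only [pow_two] using (hζ.integral_pow_eq i 2).trans hζ.variance_one
  · rw [(hζ.indep.indepFun h).integral_fun_mul_eq_mul_integral (hζ.memLp_two i).1
      (hζ.memLp_two j).1, hζ.integral_eq_zero, zero_mul]

theorem integrable_mul [IsProbabilityMeasure P] (i j : ℤ) (hζ : IsStandardizedNoise P ζ) :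
    Integrable (fun ω => ζ i ω * ζ j ω) P :=
  (hζ.memLp_two i).integrable_mul (hζ.memLp_two j)

theorem memLp_mul [IsProbabilityMeasure P] (i j : ℤ) (hζ : IsStandardizedNoise P ζ) :
    MemLp (fun ω => ζ i ω * ζ j ω) 2 P := by
  have h442 : ENNReal.HolderTriple 4 4 2 := ⟨by
    rw [← two_mul, show (4 : ENNReal) = 2 * 2 by norm_num,
      ENNReal.mul_inv (by simp) (by simp), ← mul_assoc,
      ENNReal.mul_inv_cancel (by simp) (by simp), one_mul]⟩
  exact (hζ.memLp_four j).mul (r := 2) (hζ.memLp_four i)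

theorem integral_linear_mul [IsProbabilityMeasure P] (s : Finset ℤ) (x y : ℤ → ℝ) (hζ : IsStandardizedNoise P ζ) :
    ∫ ω, (∑ p ∈ s, x p * ζ p ω) * (∑ q ∈ s, y q * ζ q ω) ∂P = ∑ p ∈ s, x p * y p := by
  have : ∀ ω, (∑ p ∈ s, x p * ζ p ω) * (∑ q ∈ s, y q * ζ q ω)
      = ∑ p ∈ s, ∑ q ∈ s, x p * y q * (ζ p ω * ζ q ω) := fun ω => by
    rw [Finset.sum_mul_sum]
    exact Finset.sum_congr rfl fun p _ => Finset.sum_congr rfl fun q _ => by ring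
  simp_rw [this]
  rw [integral_finsetSum _ fun p _ => integrable_finsetSum _ fun q _ =>
    (hζ.integrable_mul p q).const_mul _]
  refine Finset.sum_congr rfl fun p hp => ?_
  rw [integral_finsetSum _ fun q _ => (hζ.integrable_mul p q).const_mul _]
  simp [integral_const_mul, hζ.integral_mul_eq, hp]

theorem integral_quadratic [IsProbabilityMeasure P] (s : Finset ℤ) (A : ℤ → ℤ → ℝ) (hζ : IsStandardizedNoise P ζ) :
    ∫ ω, ∑ p ∈ s, ∑ q ∈ s, A p q * (ζ p ω * ζ q ω) ∂P = ∑ p ∈ s, A p p := by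
  rw [integral_finsetSum _ fun p _ => integrable_finsetSum _ fun q _ =>
    (hζ.integrable_mul p q).const_mul _]
  refine Finset.sum_congr rfl fun p hp => ?_
  rw [integral_finsetSum _ fun q _ => (hζ.integrable_mul p q).const_mul _]
  simp [integral_const_mul, hζ.integral_mul_eq, hp]

theorem memLp_quadratic [IsProbabilityMeasure P] (s : Finset ℤ) (A : ℤ → ℤ → ℝ) (hζ : IsStandardizedNoise P ζ) :
    MemLp (fun ω => ∑ p ∈ s, ∑ q ∈ s, A p q * (ζ p ω * ζ q ω)) 2 P :=
  memLp_finsetSum _ fun p _ => memLp_finsetSum _ fun q _ => (hζ.memLp_mul p q).const_mul _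

/-- Variance bound for quadratic forms in standardized independent variables. -/
theorem integral_quadratic_sub_sq_le [IsProbabilityMeasure P] (s : Finset ℤ) (A : ℤ → ℤ → ℝ) (hA : ∀ p q, A p q = A q p)
    (hζ : IsStandardizedNoise P ζ) :
    ∫ ω, (∑ p ∈ s, ∑ q ∈ s, A p q * (ζ p ω * ζ q ω) - ∑ p ∈ s, A p p) ^ 2 ∂P
      ≤ (2 + ∫ ω, ζ 0 ω ^ 4 ∂P) * ∑ p ∈ s, ∑ q ∈ s, A p q ^ 2 := by
  classical
  have hμ : 0 ≤ ∫ ω, ζ 0 ω ^ 4 ∂P := integral_nonneg fun ω => by positivity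
  induction s using Finset.induction_on with
  | empty => simp
  | insert m s hm ih =>
    set D : Ω → ℝ := fun ω => ∑ p ∈ s, ∑ q ∈ s, A p q * (ζ p ω * ζ q ω) - ∑ p ∈ s, A p p
    set L : Ω → ℝ := fun ω => ∑ p ∈ s, A m p * ζ p ω
    have hD : MemLp D 2 P := (hζ.memLp_quadratic s A).sub (memLp_const _)
    have hL : MemLp L 4 P := memLp_finsetSum _ fun p _ => (hζ.memLp_four p).const_mul _
    have hD0 : ∫ ω, D ω ∂P = 0 := by
      rw [integral_sub ((hζ.memLp_quadratic s A).integrable one_le_two) (integrable_const _),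
        hζ.integral_quadratic]
      simp
    have hL0 : ∫ ω, L ω ∂P = 0 := by
      rw [integral_finsetSum _ fun p _ =>
        ((hζ.memLp_two p).integrable one_le_two).const_mul _]
      simp [integral_const_mul, hζ.integral_eq_zero]
    have hind : IndepFun (fun ω => (D ω, L ω)) (ζ m) P := by
      have h := hζ.indep.indepFun_finset₀ s {m} (by simpa using hm)
        (fun i => (hζ.memLp_two i).1.aemeasurable)
      refine h.comp (φ := fun x : s → ℝ =>
        (∑ p : s, ∑ q : s, A p q * (x p * x q) - ∑ p ∈ s, A p p, ∑ p : s, A m p * x p))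
        (ψ := fun y : ({m} : Finset ℤ) → ℝ => y ⟨m, by simp⟩) (by fun_prop) (by fun_prop)
        |>.congr ?_ ?_
      · filter_upwards with ω
        simp only [Function.comp, D, L]
        congr 1
        · congr 1
          rw [← Finset.sum_coe_sort s]
          refine Finset.sum_congr rfl fun p _ => ?_
          rw [← Finset.sum_coe_sort s]
        · rw [← Finset.sum_coe_sort s]
      · rfl
    have key := integral_sq_add_increment hD hL (hζ.memLp_four m) hind hL0 hD0
      (hζ.integral_eq_zero m) ((hζ.integral_pow_eq m 2).trans hζ.variance_one) (A m m)
    have hsplit : ∀ ω, ∑ p ∈ insert m s, ∑ q ∈ insert m s, A p q * (ζ p ω * ζ q ω)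
        - ∑ p ∈ insert m s, A p p = D ω + A m m * (ζ m ω ^ 2 - 1) + 2 * ζ m ω * L ω := fun ω => by
      have h1 : ∑ p ∈ s, A p m * (ζ p ω * ζ m ω) = ζ m ω * L ω := by
        simp only [L, Finset.mul_sum]
        exact Finset.sum_congr rfl fun p _ => by rw [hA p m]; ring
      have h2 : ∑ p ∈ s, A m p * (ζ m ω * ζ p ω) = ζ m ω * L ω := by
        simp only [L, Finset.mul_sum]
        exact Finset.sum_congr rfl fun p _ => by ring
      simp only [Finset.sum_insert hm, Finset.sum_add_distrib, h1, h2, D]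
      ring
    have hL2 : ∫ ω, L ω ^ 2 ∂P = ∑ p ∈ s, A m p ^ 2 := by
      simpa [pow_two, L] using hζ.integral_linear_mul s (A m) (A m)
    have hA2 : ∑ p ∈ insert m s, ∑ q ∈ insert m s, A p q ^ 2
        = ∑ p ∈ s, ∑ q ∈ s, A p q ^ 2 + A m m ^ 2 + 2 * ∑ p ∈ s, A m p ^ 2 := by
      simp only [Finset.sum_insert hm, Finset.sum_add_distrib, fun p => hA p m]
      ring
    simp_rw [hsplit]
    rw [key, hA2, hL2, hζ.integral_pow_eq m 4]
    have h3 : 0 ≤ ∑ p ∈ s, A m p ^ 2 := Finset.sum_nonneg fun _ _ => sq_nonneg _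
    -- With `μ = E ζ₀⁴`, the new index adds `(μ - 1) A_mm² + 4 ∑ A_mp²` to the variance and `A_mm² +
    -- 2 ∑ A_mp²` to the squared Frobenius norm. The factor `2 + μ` covers both, since `μ - 1 ≤ 2 +
    -- μ` and `4 ≤ 2 (2 + μ)`.
    nlinarith [sq_nonneg (A m m), mul_nonneg hμ h3]

/-- A common finite index set lets a weighted sum of squares be read as one quadratic form. -/
theorem exists_finset_of_mem_span {Ω : Type*} {ζ : ℤ → Ω → ℝ} {R : Type*} [Fintype R] {Y : R → Ω → ℝ}
    (hY : ∀ r, Y r ∈ Submodule.span ℝ (Set.range ζ)) :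
    ∃ (s : Finset ℤ) (l : R → ℤ → ℝ), ∀ r, Y r = fun ω => ∑ p ∈ s, l r p * ζ p ω := by
  classical
  have := fun r => (Finsupp.mem_span_range_iff_exists_finsupp).1 (hY r)
  choose c hc using this
  refine ⟨Finset.univ.biUnion fun r => (c r).support, fun r p => c r p, fun r => ?_⟩
  rw [← hc r]
  ext ω
  rw [Finsupp.sum, Finset.sum_apply]
  refine Finset.sum_subset (Finset.subset_biUnion_of_mem (fun r => (c r).support)
    (Finset.mem_univ r)) fun p _ hp => ?_
  simp [Finsupp.notMem_support_iff.1 hp]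

/-- Variance bound for a weighted sum of squares of finite linear forms in the noise. -/
theorem integral_sum_sq_sub_sq_le_of_mem_span [IsProbabilityMeasure P] {R : Type*} [Fintype R] (β : R → ℝ) {Y : R → Ω → ℝ}
    (hY : ∀ r, Y r ∈ Submodule.span ℝ (Set.range ζ)) (hζ : IsStandardizedNoise P ζ) :
    MemLp (fun ω => ∑ r, β r * Y r ω ^ 2) 2 P ∧
    ∫ ω, (∑ r, β r * Y r ω ^ 2 - ∫ ω', ∑ r, β r * Y r ω' ^ 2 ∂P) ^ 2 ∂P
      ≤ (2 + ∫ ω, ζ 0 ω ^ 4 ∂P) * ∑ r, ∑ s, β r * β s * (∫ ω, Y r ω * Y s ω ∂P) ^ 2 := by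
  obtain ⟨s, l, hl⟩ := exists_finset_of_mem_span hY
  set A : ℤ → ℤ → ℝ := fun p q => ∑ r, β r * (l r p * l r q) with hAdef
  have hQ : (fun ω => ∑ r, β r * Y r ω ^ 2) =
      fun ω => ∑ p ∈ s, ∑ q ∈ s, A p q * (ζ p ω * ζ q ω) := by
    ext ω
    have : ∀ r, β r * Y r ω ^ 2 =
        ∑ p ∈ s, ∑ q ∈ s, β r * (l r p * l r q) * (ζ p ω * ζ q ω) := fun r => by
      rw [hl r, pow_two, Finset.sum_mul_sum, Finset.mul_sum]
      refine Finset.sum_congr rfl fun p _ => ?_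
      rw [Finset.mul_sum]
      exact Finset.sum_congr rfl fun q _ => by ring
    simp_rw [this, hAdef, Finset.sum_mul]
    rw [Finset.sum_comm]
    refine Finset.sum_congr rfl fun p _ => Finset.sum_comm
  -- The matrix is `∑ β_r l_r l_rᵀ`, so its squared Frobenius norm is `∑ β_r β_s ⟨l_r, l_s⟩²`, and
  -- `⟨l_r, l_s⟩` is the covariance of `Y_r` and `Y_s`. The coefficients `l` disappear from the
  -- bound, which can therefore pass to the limit.
  have hA2 : ∑ p ∈ s, ∑ q ∈ s, A p q ^ 2 =
      ∑ r, ∑ s, β r * β s * (∫ ω, Y r ω * Y s ω ∂P) ^ 2 := by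
    have h1 : ∀ r r', ∫ ω, Y r ω * Y r' ω ∂P = ∑ p ∈ s, l r p * l r' p := fun r r' => by
      rw [hl r, hl r']; exact hζ.integral_linear_mul s _ _
    simp_rw [h1, hAdef, pow_two, Finset.sum_mul_sum, Finset.mul_sum]
    rw [Finset.sum_congr rfl fun p _ => Finset.sum_comm, Finset.sum_comm]
    refine Finset.sum_congr rfl fun r _ => ?_
    rw [Finset.sum_congr rfl fun p _ => Finset.sum_comm, Finset.sum_comm]
    refine Finset.sum_congr rfl fun r' _ => Finset.sum_congr rfl fun p _ =>
      Finset.sum_congr rfl fun q _ => by ring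
  constructor
  · rw [hQ]; exact hζ.memLp_quadratic s A
  · have hQ' : ∀ ω, ∑ r, β r * Y r ω ^ 2 = ∑ p ∈ s, ∑ q ∈ s, A p q * (ζ p ω * ζ q ω) :=
      fun ω => congrFun hQ ω
    simp_rw [hQ', hζ.integral_quadratic, ← hA2]
    exact hζ.integral_quadratic_sub_sq_le s A fun p q => by simp [hAdef, mul_comm (l _ p)]

end IsStandardizedNoise

end QuadraticForms

/-! ### Passage from finite linear forms to mean-square limits -/

section MeanSquareLimits

variable {Ω : Type*} [MeasurableSpace Ω] {P : Measure Ω}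

/-- Fatou's lemma for second moments. -/
theorem memLp_two_and_integral_sq_le_of_tendsto_ae {G : Ω → ℝ} {F : ℕ → Ω → ℝ} {V : ℕ → ℝ} {v : ℝ}
    (hF : ∀ n, MemLp (F n) 2 P) (hV : ∀ n, ∫ ω, F n ω ^ 2 ∂P ≤ V n)
    (hFG : ∀ᵐ ω ∂P, Tendsto (fun n => F n ω) atTop (𝓝 (G ω))) (hv : Tendsto V atTop (𝓝 v)) :
    MemLp G 2 P ∧ ∫ ω, G ω ^ 2 ∂P ≤ v := by
  have hG : AEStronglyMeasurable G P :=
    aestronglyMeasurable_of_tendsto_ae atTop (fun n => (hF n).1) hFG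
  have hv0 : 0 ≤ v := ge_of_tendsto' hv fun n =>
    (integral_nonneg fun ω => sq_nonneg (F n ω)).trans (hV n)
  have h1 : ∫⁻ ω, ENNReal.ofReal (G ω ^ 2) ∂P ≤ ENNReal.ofReal v := by
    calc ∫⁻ ω, ENNReal.ofReal (G ω ^ 2) ∂P
        = ∫⁻ ω, liminf (fun n => ENNReal.ofReal (F n ω ^ 2)) atTop ∂P := by
          refine lintegral_congr_ae ?_
          filter_upwards [hFG] with ω hω
          exact ((ENNReal.continuous_ofReal.tendsto _).comp (hω.pow 2)).liminf_eq.symm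
      _ ≤ liminf (fun n => ∫⁻ ω, ENNReal.ofReal (F n ω ^ 2) ∂P) atTop :=
          lintegral_liminf_le' fun n => ((hF n).1.pow 2).aemeasurable.ennreal_ofReal
      _ ≤ liminf (fun n => ENNReal.ofReal (V n)) atTop := by
          refine liminf_le_liminf (Eventually.of_forall fun n => ?_)
          rw [← ofReal_integral_eq_lintegral_ofReal (hF n).integrable_sq
            (Eventually.of_forall fun ω => sq_nonneg _)]
          exact ENNReal.ofReal_le_ofReal (hV n)
      _ = ENNReal.ofReal v := ((ENNReal.continuous_ofReal.tendsto _).comp hv).liminf_eq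
  constructor
  · rw [memLp_two_iff_integrable_sq hG, ← lintegral_ofReal_ne_top_iff_integrable
      (f := fun ω => G ω ^ 2) (hG.pow 2)
      (Eventually.of_forall fun ω => sq_nonneg _)]
    exact (h1.trans_lt ENNReal.ofReal_lt_top).ne
  · rw [integral_eq_lintegral_of_nonneg_ae (Eventually.of_forall fun ω => sq_nonneg _) (hG.pow 2)]
    exact ENNReal.toReal_le_of_le_ofReal hv0 h1

/-- Continuity of the inner product of `L²`. -/
theorem tendsto_integral_mul_of_tendsto_eLpNorm {f g : Ω → ℝ} {F G : ℕ → Ω → ℝ}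
    (hf : MemLp f 2 P) (hg : MemLp g 2 P) (hF : ∀ n, MemLp (F n) 2 P) (hG : ∀ n, MemLp (G n) 2 P)
    (hFf : Tendsto (fun n => eLpNorm (F n - f) 2 P) atTop (𝓝 0))
    (hGg : Tendsto (fun n => eLpNorm (G n - g) 2 P) atTop (𝓝 0)) :
    Tendsto (fun n => ∫ ω, F n ω * G n ω ∂P) atTop (𝓝 (∫ ω, f ω * g ω ∂P)) := by
  have h1 := (Lp.tendsto_Lp_iff_tendsto_eLpNorm'' F hF f hf).2 hFf
  have h2 := (Lp.tendsto_Lp_iff_tendsto_eLpNorm'' G hG g hg).2 hGg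
  have hin : ∀ {a b : Ω → ℝ} (ha : MemLp a 2 P) (hb : MemLp b 2 P),
      inner ℝ (hb.toLp b) (ha.toLp a) = ∫ ω, a ω * b ω ∂P := fun {a b} ha hb => by
    rw [L2.inner_def]
    refine integral_congr_ae ?_
    filter_upwards [ha.coeFn_toLp, hb.coeFn_toLp] with ω h h'
    rw [h, h']
    simp
  have := h2.inner (𝕜 := ℝ) h1
  simpa only [hin] using this

/-- Fatou's lemma needs one subsequence along which all the forms converge almost everywhere; it is
refined once for each index. -/
theorem exists_subseq_tendsto_ae_of_finset {R : Type*} (S : Finset R) {Y : R → Ω → ℝ}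
    {W : ℕ → R → Ω → ℝ} (hY : ∀ r, MemLp (Y r) 2 P) (hW : ∀ N r, MemLp (W N r) 2 P)
    (hWY : ∀ r, Tendsto (fun N => eLpNorm (W N r - Y r) 2 P) atTop (𝓝 0)) :
    ∃ ns : ℕ → ℕ, StrictMono ns ∧
      ∀ r ∈ S, ∀ᵐ ω ∂P, Tendsto (fun i => W (ns i) r ω) atTop (𝓝 (Y r ω)) := by
  classical
  induction S using Finset.induction_on with
  | empty => exact ⟨id, strictMono_id, by simp⟩
  | insert r S _ ih =>
    obtain ⟨ns, hns, h⟩ := ih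
    have h0 : TendstoInMeasure P (fun N => W N r) atTop (Y r) :=
      tendstoInMeasure_of_tendsto_eLpNorm (p := 2) (by norm_num) (fun N => (hW N r).1) (hY r).1
        (hWY r)
    have h1 : TendstoInMeasure P (fun i => W (ns i) r) atTop (Y r) :=
      fun ε hε => (h0 ε hε).comp hns.tendsto_atTop
    obtain ⟨ms, hms, h2⟩ := h1.exists_seq_tendsto_ae
    refine ⟨ns ∘ ms, hns.comp hms, fun r' hr' => ?_⟩
    rcases Finset.mem_insert.1 hr' with rfl | hr'
    · exact h2
    · filter_upwards [h r' hr'] with ω hω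
      exact hω.comp hms.tendsto_atTop

/-- Variance bound for a weighted sum of squares of mean-square limits of finite linear forms
in the noise. -/
theorem IsStandardizedNoise.integral_sum_sq_sub_sq_le [IsProbabilityMeasure P] {ζ : ℤ → Ω → ℝ}
    (hζ : IsStandardizedNoise P ζ) {R : Type*} [Fintype R] (β : R → ℝ) {Y : R → Ω → ℝ}
    {W : ℕ → R → Ω → ℝ} (hY : ∀ r, MemLp (Y r) 2 P)
    (hW : ∀ N r, W N r ∈ Submodule.span ℝ (Set.range ζ))
    (hWY : ∀ r, Tendsto (fun N => eLpNorm (W N r - Y r) 2 P) atTop (𝓝 0)) :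
    MemLp (fun ω => ∑ r, β r * Y r ω ^ 2) 2 P ∧
    ∫ ω, (∑ r, β r * Y r ω ^ 2 - ∫ ω', ∑ r, β r * Y r ω' ^ 2 ∂P) ^ 2 ∂P
      ≤ (2 + ∫ ω, ζ 0 ω ^ 4 ∂P) * ∑ r, ∑ s, β r * β s * (∫ ω, Y r ω * Y s ω ∂P) ^ 2 := by
  have hWm : ∀ N r, MemLp (W N r) 2 P := fun N r => by
    obtain ⟨s, l, hl⟩ := IsStandardizedNoise.exists_finset_of_mem_span (hW N)
    rw [hl r]
    exact memLp_finsetSum _ fun p _ => (hζ.memLp_two p).const_mul _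
  obtain ⟨ns, hns, hae⟩ := exists_subseq_tendsto_ae_of_finset Finset.univ hY hWm hWY
  have hprod : ∀ r s, Tendsto (fun i => ∫ ω, W (ns i) r ω * W (ns i) s ω ∂P) atTop
      (𝓝 (∫ ω, Y r ω * Y s ω ∂P)) := fun r s =>
    tendsto_integral_mul_of_tendsto_eLpNorm (hY r) (hY s) (fun _ => hWm _ r) (fun _ => hWm _ s)
      ((hWY r).comp hns.tendsto_atTop) ((hWY s).comp hns.tendsto_atTop)
  have hint : ∀ {Z : R → Ω → ℝ}, (∀ r, MemLp (Z r) 2 P) →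
      ∫ ω, ∑ r, β r * Z r ω ^ 2 ∂P = ∑ r, β r * ∫ ω, Z r ω * Z r ω ∂P := fun {Z} hZ => by
    rw [integral_finsetSum _ fun r _ => (hZ r).integrable_sq.const_mul _]
    simp [integral_const_mul, pow_two]
  have hmean : Tendsto (fun i => ∫ ω, ∑ r, β r * W (ns i) r ω ^ 2 ∂P) atTop
      (𝓝 (∫ ω, ∑ r, β r * Y r ω ^ 2 ∂P)) := by
    rw [hint hY]
    simp_rw [fun i => hint (hWm (ns i))]
    exact tendsto_finsetSum _ fun r _ => (hprod r r).const_mul _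
  have key := fun i => hζ.integral_sum_sq_sub_sq_le_of_mem_span β (hW (ns i))
  -- Mean-square convergence of the forms does not by itself give mean-square convergence of their
  -- squares. Fatou suffices, because the variance bounds and the centring constants involve only
  -- inner products, which converge.
  obtain ⟨h1, h2⟩ := memLp_two_and_integral_sq_le_of_tendsto_ae
    (G := fun ω => ∑ r, β r * Y r ω ^ 2 - ∫ ω', ∑ r, β r * Y r ω' ^ 2 ∂P)
    (fun i => (key i).1.sub (memLp_const _)) (fun i => (key i).2)
    (by
      have : ∀ᵐ ω ∂P, ∀ r, Tendsto (fun i => W (ns i) r ω) atTop (𝓝 (Y r ω)) :=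
        ae_all_iff.2 fun r => hae r (Finset.mem_univ r)
      filter_upwards [this] with ω hω
      exact (tendsto_finsetSum _ fun r _ => ((hω r).pow 2).const_mul _).sub hmean)
    ((tendsto_finsetSum _ fun r _ => tendsto_finsetSum _ fun s _ =>
      ((hprod r s).pow 2).const_mul _).const_mul _)
  refine ⟨?_, h2⟩
  have := h1.add (memLp_const (∫ ω', ∑ r, β r * Y r ω' ^ 2 ∂P))
  simpa [Pi.add_def] using this

end MeanSquareLimits

/-! ### Elementary inequalities for powers and sines -/

section PowerComparison

/-- The upper bound on `x` serves `p ≥ 0` and the upper bound on `y` serves `p ≤ 0`, so that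
exponents of unknown sign need no case distinction later. -/
theorem Real.rpow_le_rpow_abs_mul {x y c : ℝ} (hx : 0 < x) (hy : 0 < y) (hxy : x ≤ c * y)
    (hyx : y ≤ c * x) (p : ℝ) : x ^ p ≤ c ^ |p| * y ^ p := by
  have hc : 0 < c := pos_of_mul_pos_left (hx.trans_le hxy) hy.le
  rcases le_total 0 p with hp | hp
  · rw [abs_of_nonneg hp, ← Real.mul_rpow hc.le hy.le]
    exact Real.rpow_le_rpow hx.le hxy hp
  · rw [abs_of_nonpos hp, Real.rpow_neg hc.le, ← Real.inv_rpow hc.le,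
      ← Real.mul_rpow (inv_nonneg.2 hc.le) hy.le]
    refine Real.rpow_le_rpow_of_nonpos (by positivity) ?_ hp
    rwa [inv_mul_le_iff₀ hc]

theorem Real.two_mul_sin_half_le {v : ℝ} (hv : 0 ≤ v) : 2 * Real.sin (v / 2) ≤ v := by
  have := Real.sin_le (x := v / 2) (by positivity)
  linarith

theorem Real.le_two_mul_sin_half {v : ℝ} (hv : 0 ≤ v) (hv' : v ≤ Real.pi) :
    2 / Real.pi * v ≤ 2 * Real.sin (v / 2) := by
  have := Real.mul_le_sin (x := v / 2) (by positivity) (by linarith)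
  linarith

/-- Induction with Bernoulli's inequality: for `a = min (p+1) 1`, `(1 - 1/M)^{p+1} ≤ (1 - 1/M)^a ≤ 1
- a/M`, which makes the increment of `M^{p+1}` at least `a M^p`. -/
theorem sum_Icc_rpow_le {p : ℝ} (hp : -1 < p) (m : ℕ) :
    ∑ h ∈ Finset.Icc 1 m, (h : ℝ) ^ p ≤ (min (p + 1) 1)⁻¹ * (m : ℝ) ^ (p + 1) := by
  set a := min (p + 1) 1 with ha
  have ha0 : 0 < a := lt_min (by linarith) one_pos
  induction m with
  | zero =>
    simp only [zero_lt_one, Finset.Icc_eq_empty_of_lt, Finset.sum_empty]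
    positivity
  | succ m ih =>
    rw [Finset.sum_Icc_succ_top (by omega)]
    have hm : (0 : ℝ) < (m + 1 : ℕ) := by positivity
    set M : ℝ := ((m + 1 : ℕ) : ℝ) with hM
    have hmM : (m : ℝ) = M * (1 + -M⁻¹) := by
      rw [mul_add, mul_neg, mul_inv_cancel₀ hm.ne', hM]; push_cast; ring
    have hMi : M⁻¹ ≤ 1 := inv_le_one_of_one_le₀ (by rw [hM]; push_cast; linarith [m.cast_nonneg (α := ℝ)])
    have hb : (1 + -M⁻¹) ^ (p + 1) ≤ 1 + a * (-M⁻¹) := by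
      refine (Real.rpow_le_rpow_of_exponent_ge' (by linarith)
        (by linarith [inv_pos.2 hm]) ha0.le (min_le_left _ _)).trans ?_
      exact rpow_one_add_le_one_add_mul_self (by linarith) ha0.le (min_le_right _ _)
    have h1 : (m : ℝ) ^ (p + 1) ≤ M ^ (p + 1) - a * M ^ p := by
      rw [hmM, Real.mul_rpow hm.le (by linarith)]
      calc M ^ (p + 1) * (1 + -M⁻¹) ^ (p + 1) ≤ M ^ (p + 1) * (1 + a * (-M⁻¹)) := by gcongr
        _ = M ^ (p + 1) - a * M ^ p := by
          rw [Real.rpow_add_one hm.ne']; field_simp; ring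
    calc _ ≤ a⁻¹ * (m : ℝ) ^ (p + 1) + M ^ p := by gcongr
      _ ≤ a⁻¹ * (M ^ (p + 1) - a * M ^ p) + M ^ p := by gcongr
      _ = a⁻¹ * M ^ (p + 1) := by field_simp; ring

end PowerComparison

/-! ### Abel summation and sums of sines -/

section AbelSummation

/-- Abel summation. The hypothesis on `a` says that `a (i + 1)` lies between `0` and `a i`, so the
total variation telescopes. This form allows sequences of either constant sign; for fractional noise
the sign depends on that of `d`. -/
theorem abs_sum_mul_le_of_abs_sub_le {a z : ℕ → ℝ} {m N : ℕ} {B : ℝ} (hmN : m ≤ N)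
    (ha : ∀ i, m ≤ i → |a i - a (i + 1)| ≤ |a i| - |a (i + 1)|)
    (hz : ∀ k, |∑ i ∈ Finset.Ico m k, z i| ≤ B) :
    |∑ i ∈ Finset.Ico m N, a i * z i| ≤ B * |a m| := by
  have key : ∀ N, m ≤ N → |∑ i ∈ Finset.Ico m N, a i * z i - a N * ∑ i ∈ Finset.Ico m N, z i|
      ≤ B * (|a m| - |a N|) := by
    intro N hN
    induction N, hN using Nat.le_induction with
    | base => simp
    | succ N hN ih =>
      have hB : 0 ≤ B := (abs_nonneg _).trans (hz 0)
      rw [Finset.sum_Ico_succ_top hN, Finset.sum_Ico_succ_top hN]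
      have e : ∑ i ∈ Finset.Ico m N, a i * z i + a N * z N
          - a (N + 1) * (∑ i ∈ Finset.Ico m N, z i + z N) =
          (∑ i ∈ Finset.Ico m N, a i * z i - a N * ∑ i ∈ Finset.Ico m N, z i)
          + (a N - a (N + 1)) * ∑ i ∈ Finset.Ico m (N + 1), z i := by
        rw [Finset.sum_Ico_succ_top hN]; ring
      rw [e]
      refine (abs_add_le _ _).trans ?_
      rw [abs_mul]
      have := mul_le_mul (ha N hN) (hz (N + 1)) (abs_nonneg _)
        ((abs_nonneg _).trans (ha N hN))
      linarith
  have h1 := key N hmN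
  have h2 : |a N * ∑ i ∈ Finset.Ico m N, z i| ≤ |a N| * B := by
    rw [abs_mul]; exact mul_le_mul_of_nonneg_left (hz N) (abs_nonneg _)
  have h3 := abs_add_le (∑ i ∈ Finset.Ico m N, a i * z i - a N * ∑ i ∈ Finset.Ico m N, z i)
    (a N * ∑ i ∈ Finset.Ico m N, z i)
  rw [sub_add_cancel] at h3
  linarith

/-- Multiplication by `2 sin(v/2) ≥ 2v/π` telescopes the sum to a difference of two cosines. -/
theorem abs_sum_Ico_sin_le {v : ℝ} (hv : 0 < v) (hv' : v ≤ Real.pi) (m k : ℕ) :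
    |∑ i ∈ Finset.Ico m k, Real.sin (i * v)| ≤ Real.pi / v := by
  rcases le_or_gt m k with hmk | hmk
  · have hs : 0 < 2 * Real.sin (v / 2) :=
      lt_of_lt_of_le (by have := Real.pi_pos; positivity) (Real.le_two_mul_sin_half hv.le hv')
    have h1 : 2 * Real.sin (v / 2) * ∑ i ∈ Finset.Ico m k, Real.sin (i * v) =
        Real.cos ((m - 1 / 2) * v) - Real.cos ((k - 1 / 2) * v) := by
      rw [Finset.mul_sum]
      induction k, hmk using Nat.le_induction with
      | base => simp
      | succ k hk ih =>
        rw [Finset.sum_Ico_succ_top hk, ih, Nat.cast_succ,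
          show ((k : ℝ) + 1 - 1 / 2) * v = k * v + v / 2 by ring,
          show ((k : ℝ) - 1 / 2) * v = k * v - v / 2 by ring, Real.cos_add, Real.cos_sub]
        ring
    have h2 : |2 * Real.sin (v / 2) * ∑ i ∈ Finset.Ico m k, Real.sin (i * v)| ≤ 2 := by
      rw [h1, abs_le]
      constructor <;>
      linarith [Real.cos_le_one ((m - 1 / 2) * v), Real.neg_one_le_cos ((m - 1 / 2) * v),
        Real.cos_le_one ((k - 1 / 2) * v), Real.neg_one_le_cos ((k - 1 / 2) * v)]
    rw [abs_mul, abs_of_pos hs] at h2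
    have h3 : 2 / Real.pi * v * |∑ i ∈ Finset.Ico m k, Real.sin (i * v)| ≤ 2 :=
      (mul_le_mul_of_nonneg_right (Real.le_two_mul_sin_half hv.le hv') (abs_nonneg _)).trans h2
    rw [le_div_iff₀ hv]
    have hpi := Real.pi_pos
    rw [div_mul_eq_mul_div, div_mul_eq_mul_div, div_le_iff₀ hpi] at h3
    linarith
  · rw [Finset.Ico_eq_empty_of_le hmk.le]
    simp only [Finset.sum_empty, abs_zero]
    have := Real.pi_pos
    positivity

end AbelSummation

/-! ### Fourier coefficients and conjugate series of fractional noise -/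

noncomputable section FractionalNoise

/-- The Fourier cosine coefficients `2 ∫_0^π cos(kv) f(v) dv`. -/
def cosCoeff (f : ℝ → ℝ) (k : ℤ) : ℝ := 2 * ∫ v in (0 : ℝ)..Real.pi, Real.cos (k * v) * f v

theorem cosCoeff_neg (f : ℝ → ℝ) (k : ℤ) : cosCoeff f (-k) = cosCoeff f k := by
  simp [cosCoeff]

/-- The spectral density `(2 sin(v/2))^{-2d}` of fractionally integrated noise, on `[0, π]`. -/
def fracDensity (d v : ℝ) : ℝ := (2 * Real.sin (v / 2)) ^ (-2 * d)

variable {d : ℝ}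

theorem two_mul_sin_half_pos {v : ℝ} (hv : v ∈ Set.Ioc 0 Real.pi) : 0 < 2 * Real.sin (v / 2) :=
  lt_of_lt_of_le (by have := Real.pi_pos; have := hv.1; positivity)
    (Real.le_two_mul_sin_half hv.1.le hv.2)

theorem fracDensity_le {v : ℝ} (hv : v ∈ Set.Ioc 0 Real.pi) :
    fracDensity d v ≤ (Real.pi / 2) ^ |-2 * d| * v ^ (-2 * d) := by
  have h1 := Real.le_two_mul_sin_half hv.1.le hv.2
  have h2 := Real.two_mul_sin_half_le hv.1.le
  have h3 := Real.pi_gt_three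
  refine Real.rpow_le_rpow_abs_mul (two_mul_sin_half_pos hv) hv.1 ?_ ?_ _
  · nlinarith [hv.1]
  · have := mul_le_mul_of_nonneg_left h1 (show 0 ≤ Real.pi / 2 by positivity)
    field_simp at this ⊢
    linarith

theorem rpow_le_fracDensity {v : ℝ} (hv : v ∈ Set.Ioc 0 Real.pi) :
    v ^ (-2 * d) ≤ (Real.pi / 2) ^ |-2 * d| * fracDensity d v := by
  have h1 := Real.le_two_mul_sin_half hv.1.le hv.2
  have h2 := Real.two_mul_sin_half_le hv.1.le
  have h3 := Real.pi_gt_three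
  refine Real.rpow_le_rpow_abs_mul hv.1 (two_mul_sin_half_pos hv) ?_ ?_ _
  · have := mul_le_mul_of_nonneg_left h1 (show 0 ≤ Real.pi / 2 by positivity)
    field_simp at this ⊢
    linarith
  · nlinarith [hv.1]

theorem fracDensity_nonneg {v : ℝ} (hv : v ∈ Set.Ioc 0 Real.pi) : 0 ≤ fracDensity d v :=
  Real.rpow_nonneg (two_mul_sin_half_pos hv).le _

theorem measurable_fracDensity : Measurable (fracDensity d) := by
  unfold fracDensity; fun_prop

theorem intervalIntegrable_of_abs_le_rpow {F : ℝ → ℝ} {p C a : ℝ} (hp : -1 < p) (ha : 0 ≤ a)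
    (hF : AEStronglyMeasurable F (volume.restrict (Set.Ioc 0 a)))
    (h : ∀ v ∈ Set.Ioc 0 a, |F v| ≤ C * v ^ p) : IntervalIntegrable F volume 0 a := by
  have h1 : IntervalIntegrable (fun v : ℝ => C * v ^ p) volume 0 a :=
    (intervalIntegral.intervalIntegrable_rpow' hp).const_mul C
  refine h1.mono_fun (by rwa [Set.uIoc_of_le ha]) ?_
  rw [Set.uIoc_of_le ha]
  filter_upwards [ae_restrict_mem measurableSet_Ioc] with v hv
  exact (h v hv).trans (le_abs_self _)

theorem intervalIntegrable_fracDensity (hd : |d| < 1 / 2) :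
    IntervalIntegrable (fracDensity d) volume 0 Real.pi := by
  refine intervalIntegrable_of_abs_le_rpow (p := -2 * d) (C := (Real.pi / 2) ^ |-2 * d|) (by linarith [(abs_lt.1 hd).2])
    Real.pi_pos.le measurable_fracDensity.aestronglyMeasurable fun v hv => ?_
  rw [abs_of_nonneg (fracDensity_nonneg hv)]
  exact fracDensity_le hv

theorem IntervalIntegrable.cos_mul {F : ℝ → ℝ} {a b : ℝ} (hF : IntervalIntegrable F volume a b)
    (k : ℝ) : IntervalIntegrable (fun v => Real.cos (k * v) * F v) volume a b :=
  hF.continuousOn_mul (by fun_prop)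

/-- The function `(2 sin(u/2))^{1-2d} cos((h + 1/2)u)` vanishes at `0`, because `1 - 2d > 0`, and at
`π`, because of the cosine. The integral of its derivative is thus zero, and by the addition
formulas that derivative is a combination of the two integrands. -/
theorem cosCoeff_fracDensity_succ (hd : |d| < 1 / 2) (h : ℕ) :
    (h + 1 - d) * cosCoeff (fracDensity d) (h + 1 : ℕ) =
      (h + d) * cosCoeff (fracDensity d) (h : ℕ) := by
  have hd' := abs_lt.1 hd
  have hpi := Real.pi_pos
  set F : ℝ → ℝ := fun u => (2 * Real.sin (u / 2)) ^ (1 - 2 * d) * Real.cos ((h + 1 / 2) * u)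
  set F' : ℝ → ℝ := fun u => (h + 1 - d) * (Real.cos ((h + 1 : ℝ) * u) * fracDensity d u)
    - (h + d) * (Real.cos (h * u) * fracDensity d u)
  have hFc : ContinuousOn F (Set.Icc 0 Real.pi) := by
    refine ContinuousOn.mul (ContinuousOn.rpow_const (by fun_prop) fun u _ => ?_) (by fun_prop)
    right; linarith
  have hFd : ∀ u ∈ Set.Ioo 0 Real.pi, HasDerivAt F (F' u) u := fun u hu => by
    have hS := two_mul_sin_half_pos (Set.Ioo_subset_Ioc_self hu)
    have h1 : HasDerivAt (fun u : ℝ => 2 * Real.sin (u / 2)) (Real.cos (u / 2)) u := by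
      refine ((((hasDerivAt_id u).div_const 2).sin).const_mul 2).congr_deriv ?_
      simp only [id]; ring
    have h2 : HasDerivAt (fun u : ℝ => Real.cos ((h + 1 / 2) * u))
        (-Real.sin ((h + 1 / 2) * u) * (h + 1 / 2)) u := by
      refine (((hasDerivAt_id u).const_mul ((h : ℝ) + 1 / 2)).cos).congr_deriv ?_
      simp only [id, mul_one]
    have h3 := (h1.rpow_const (p := 1 - 2 * d) (Or.inl hS.ne')).mul h2
    refine h3.congr_deriv ?_
    have e1 : (2 * Real.sin (u / 2)) ^ (1 - 2 * d) =
        (2 * Real.sin (u / 2)) * fracDensity d u := by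
      rw [fracDensity, show 1 - 2 * d = 1 + -2 * d by ring, Real.rpow_add hS, Real.rpow_one]
    rw [show 1 - 2 * d - 1 = -2 * d by ring, e1]
    simp only [F']
    rw [show (h + 1 : ℝ) * u = (h + 1 / 2) * u + u / 2 by ring,
      show (h : ℝ) * u = (h + 1 / 2) * u - u / 2 by ring, Real.cos_add, Real.cos_sub]
    simp only [fracDensity]
    ring
  have i1 := (intervalIntegrable_fracDensity hd).cos_mul (h + 1 : ℝ)
  have i0 := (intervalIntegrable_fracDensity hd).cos_mul (h : ℝ)
  have hint : IntervalIntegrable F' volume 0 Real.pi := (i1.const_mul _).sub (i0.const_mul _)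
  have key := intervalIntegral.integral_eq_sub_of_hasDerivAt_of_le hpi.le hFc hFd hint
  have hFpi : F Real.pi = 0 := by
    have : Real.cos ((h + 1 / 2) * Real.pi) = 0 := by
      rw [Real.cos_eq_zero_iff]; exact ⟨h, by push_cast; ring⟩
    simp only [F, this, mul_zero]
  have hF0 : F 0 = 0 := by
    have : (0 : ℝ) ^ (1 - 2 * d) = 0 := Real.zero_rpow (by linarith)
    simp [F, this]
  rw [hFpi, hF0, intervalIntegral.integral_sub (i1.const_mul _) (i0.const_mul _),
    intervalIntegral.integral_const_mul, intervalIntegral.integral_const_mul] at key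
  simp only [cosCoeff]
  push_cast
  linarith

/-- With `p = 1 - 2d`, the recursion gives the ratio `1 - p/(h + 1 - d)`, which lies in `[0, 1]`
once `h ≥ 1`; this is the monotonicity. For the decay, `|c h| (h + 1 - d)^p` is nonincreasing: with
`y = h + 1 - d`, `1 - p/y ≤ e^{-p/y}` and `(1 + 1/y)^p ≤ e^{p/y}`. -/
theorem exists_abs_cosCoeff_fracDensity_le (hd : |d| < 1 / 2) :
    ∃ G : ℝ, 0 ≤ G ∧ ∀ h : ℕ, 1 ≤ h →
      |cosCoeff (fracDensity d) h| ≤ G * (h : ℝ) ^ (2 * d - 1) ∧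
      |cosCoeff (fracDensity d) h - cosCoeff (fracDensity d) (h + 1 : ℕ)| ≤
        |cosCoeff (fracDensity d) h| - |cosCoeff (fracDensity d) (h + 1 : ℕ)| := by
  have hd' := abs_lt.1 hd
  set c : ℕ → ℝ := fun h => cosCoeff (fracDensity d) h with hc
  set p : ℝ := 1 - 2 * d with hp
  have hp0 : 0 < p := by rw [hp]; linarith
  have hratio : ∀ h : ℕ, 1 ≤ h → c (h + 1) = (1 - p / (h + 1 - d)) * c h := fun h hh => by
    have hh' : (1 : ℝ) ≤ h := by exact_mod_cast hh
    have h1 := cosCoeff_fracDensity_succ hd h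
    have h2 : (h + 1 - d : ℝ) ≠ 0 := by linarith
    simp only [hc]
    field_simp
    linear_combination h1
  have hr0 : ∀ h : ℕ, 1 ≤ h → 0 ≤ 1 - p / (h + 1 - d) ∧ 1 - p / (h + 1 - d) ≤ 1 := fun h hh => by
    have hh' : (1 : ℝ) ≤ h := by exact_mod_cast hh
    have h2 : (0 : ℝ) < h + 1 - d := by linarith
    constructor
    · rw [sub_nonneg, div_le_one h2]; linarith
    · have : 0 ≤ p / (h + 1 - d) := by positivity
      linarith
  have hy : ∀ h : ℕ, 1 ≤ h → |c h| * ((h : ℝ) + 1 - d) ^ p ≤ |c 1| * (2 - d) ^ p := fun h hh => by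
    induction h, hh using Nat.le_induction with
    | base => norm_num [show (1 : ℝ) + 1 - d = 2 - d by ring]
    | succ h hh ih =>
      refine le_trans ?_ ih
      have hh' : (1 : ℝ) ≤ h := by exact_mod_cast hh
      have h2 : (0 : ℝ) < h + 1 - d := by linarith
      obtain ⟨r0, -⟩ := hr0 h hh
      rw [hratio h hh, abs_mul, abs_of_nonneg r0]
      have h3 : (1 - p / (h + 1 - d)) * (((h + 1 : ℕ) : ℝ) + 1 - d) ^ p ≤ ((h : ℝ) + 1 - d) ^ p := by
        have e : (((h + 1 : ℕ) : ℝ) + 1 - d) = (h + 1 - d) * (1 + 1 / (h + 1 - d)) := by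
          push_cast; field_simp; ring
        rw [e, Real.mul_rpow h2.le (by positivity)]
        have h4 : (1 + 1 / ((h : ℝ) + 1 - d)) ^ p ≤ Real.exp (p / (h + 1 - d)) := by
          calc (1 + 1 / ((h : ℝ) + 1 - d)) ^ p ≤ (Real.exp (1 / (h + 1 - d))) ^ p := by
                refine Real.rpow_le_rpow (by positivity) ?_ hp0.le
                linarith [Real.add_one_le_exp (1 / ((h : ℝ) + 1 - d))]
            _ = Real.exp (p / (h + 1 - d)) := by
                rw [← Real.exp_mul]; congr 1; ring
        have h5 : 1 - p / ((h : ℝ) + 1 - d) ≤ Real.exp (-(p / (h + 1 - d))) := by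
          linarith [Real.add_one_le_exp (-(p / ((h : ℝ) + 1 - d)))]
        have h6 : (1 - p / ((h : ℝ) + 1 - d)) * (1 + 1 / ((h : ℝ) + 1 - d)) ^ p ≤ 1 := by
          refine (mul_le_mul h5 h4 (by positivity) (Real.exp_nonneg _)).trans ?_
          rw [← Real.exp_add]; simp
        calc _ = ((h : ℝ) + 1 - d) ^ p *
              ((1 - p / ((h : ℝ) + 1 - d)) * (1 + 1 / ((h : ℝ) + 1 - d)) ^ p) := by ring
          _ ≤ ((h : ℝ) + 1 - d) ^ p * 1 := by gcongr
          _ = _ := mul_one _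
      calc _ = |c h| * ((1 - p / (h + 1 - d)) * (((h + 1 : ℕ) : ℝ) + 1 - d) ^ p) := by ring
        _ ≤ _ := by gcongr
  refine ⟨|c 1| * (2 - d) ^ p, mul_nonneg (abs_nonneg _) (Real.rpow_nonneg (by linarith) _),
    fun h hh => ⟨?_, ?_⟩⟩
  · have hh' : (1 : ℝ) ≤ h := by exact_mod_cast hh
    rw [show 2 * d - 1 = -p by rw [hp]; ring, Real.rpow_neg (by positivity), ← div_eq_mul_inv,
      le_div_iff₀ (by positivity)]
    refine le_trans ?_ (hy h hh)
    gcongr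
    linarith
  · obtain ⟨r0, r1⟩ := hr0 h hh
    change |c h - c (h + 1)| ≤ |c h| - |c (h + 1)|
    rw [hratio h hh, show c h - (1 - p / (h + 1 - d)) * c h = (1 - (1 - p / (h + 1 - d))) * c h by ring,
      abs_mul, abs_mul, abs_of_nonneg r0, abs_of_nonneg (by linarith)]
    linarith

/-- The truncated conjugate series of the fractional noise density is dominated by the density. -/
theorem exists_abs_sum_cosCoeff_mul_sin_le (hd : |d| < 1 / 2) :
    ∃ C : ℝ, 0 ≤ C ∧ ∀ (v : ℝ) (n : ℕ), v ∈ Set.Ioc 0 Real.pi →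
      |∑ h ∈ Finset.Ico 1 n, cosCoeff (fracDensity d) (h : ℕ) * Real.sin (h * v)|
        ≤ C * v ^ (-2 * d) := by
  have hd' := abs_lt.1 hd
  obtain ⟨G, hG0, hG⟩ := exists_abs_cosCoeff_fracDensity_le hd
  set A : ℝ := (min (2 * d + 1) 1)⁻¹
  have hA : 0 ≤ A := inv_nonneg.2 (le_min (by linarith) zero_le_one)
  refine ⟨G * A + Real.pi * G, by have := Real.pi_pos; positivity, fun v n hv => ?_⟩
  have hv0 := hv.1
  set c : ℕ → ℝ := fun h => cosCoeff (fracDensity d) h with hc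
  -- The sum is cut at `h ≈ 1/v`. Below, `|sin(hv)| ≤ hv` and `∑ h^{2d}` is of order `v^{-2d-1}`.
  -- Above, Abel summation leaves `(π/v) |c(m+1)|`, again of order `v^{-2d}`.
  set m : ℕ := ⌊v⁻¹⌋₊ with hm
  have hmv : (m : ℝ) ≤ v⁻¹ := Nat.floor_le (by positivity)
  have hmv' : v⁻¹ ≤ (m + 1 : ℕ) := by push_cast; exact (Nat.lt_floor_add_one _).le
  have low : ∀ k, k ≤ m + 1 → |∑ h ∈ Finset.Ico 1 k, c h * Real.sin (h * v)|
      ≤ G * A * v ^ (-2 * d) := fun k hk => by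
    calc |∑ h ∈ Finset.Ico 1 k, c h * Real.sin (h * v)|
        ≤ ∑ h ∈ Finset.Ico 1 k, |c h * Real.sin (h * v)| := Finset.abs_sum_le_sum_abs _ _
      _ ≤ ∑ h ∈ Finset.Ico 1 k, G * v * (h : ℝ) ^ (2 * d) := by
          refine Finset.sum_le_sum fun h hh => ?_
          have h1 : 1 ≤ h := (Finset.mem_Ico.1 hh).1
          have h1' : (0 : ℝ) < h := by exact_mod_cast h1
          rw [abs_mul]
          calc |c h| * |Real.sin (h * v)| ≤ (G * (h : ℝ) ^ (2 * d - 1)) * (h * v) := by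
                refine mul_le_mul (hG h h1).1 ?_ (abs_nonneg _) (by positivity)
                refine Real.abs_sin_le_abs.trans_eq (abs_of_nonneg (by positivity))
            _ = G * v * (h : ℝ) ^ (2 * d) := by
                rw [Real.rpow_sub_one h1'.ne']; field_simp
      _ ≤ ∑ h ∈ Finset.Icc 1 m, G * v * (h : ℝ) ^ (2 * d) := by
          refine Finset.sum_le_sum_of_subset_of_nonneg (fun h hh => ?_) fun h _ _ => by positivity
          simp only [Finset.mem_Ico, Finset.mem_Icc] at hh ⊢
          omega
      _ ≤ G * v * (A * (m : ℝ) ^ (2 * d + 1)) := by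
          rw [← Finset.mul_sum]
          gcongr
          exact sum_Icc_rpow_le (by linarith) m
      _ ≤ G * v * (A * (v⁻¹) ^ (2 * d + 1)) := by
          gcongr
          linarith
      _ = G * A * v ^ (-2 * d) := by
          rw [Real.inv_rpow hv0.le, ← Real.rpow_neg hv0.le, show -(2 * d + 1) = -2 * d - 1 by ring,
            Real.rpow_sub_one hv0.ne']
          field_simp
  rcases le_total n (m + 1) with hn | hn
  · refine (low n hn).trans ?_
    rw [add_mul]
    have : 0 ≤ Real.pi * G * v ^ (-2 * d) := by have := Real.pi_pos; positivity
    linarith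
  · rw [← Finset.sum_Ico_consecutive _ (show 1 ≤ m + 1 by omega) hn, add_mul]
    refine (abs_add_le _ _).trans (add_le_add (low _ le_rfl) ?_)
    refine (abs_sum_mul_le_of_abs_sub_le (a := c) (z := fun i => Real.sin (i * v)) hn
      (fun i hi => (hG i (by omega)).2) (fun k => abs_sum_Ico_sin_le hv0 hv.2 _ _)).trans ?_
    calc Real.pi / v * |c (m + 1)| ≤ Real.pi / v * (G * ((m + 1 : ℕ) : ℝ) ^ (2 * d - 1)) := by
          have := Real.pi_pos
          gcongr
          exact (hG (m + 1) (by omega)).1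
      _ ≤ Real.pi / v * (G * (v⁻¹) ^ (2 * d - 1)) := by
          have := Real.pi_pos
          have := Real.rpow_le_rpow_of_nonpos (inv_pos.2 hv0) hmv'
            (show 2 * d - 1 ≤ 0 by linarith)
          gcongr
      _ = Real.pi * G * v ^ (-2 * d) := by
          rw [Real.inv_rpow hv0.le, ← Real.rpow_neg hv0.le, show -(2 * d - 1) = -2 * d + 1 by ring,
            Real.rpow_add_one hv0.ne']
          field_simp

end FractionalNoise

/-! ### Toeplitz forms at pairs of Fourier frequencies -/

noncomputable section Toeplitz

/-- The Toeplitz bilinear form `∑_{t,s=1}^n x_t y_s c(t-s)`. -/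
def toeplitzForm (c : ℤ → ℝ) (n : ℕ) (x y : ℕ → ℝ) : ℝ :=
  ∑ t ∈ Finset.Icc 1 n, ∑ s ∈ Finset.Icc 1 n, x t * y s * c ((t : ℤ) - s)

/-- The cosine (`true`) and sine (`false`) vectors of frequency `θ`. -/
def trigVec (θ : ℝ) (σ : Bool) (t : ℕ) : ℝ := if σ then Real.cos (t * θ) else Real.sin (t * θ)

theorem sum_sum_sub_succ (n : ℕ) (F : ℕ → ℕ → ℂ) :
    ∑ t ∈ Finset.range n, ∑ s ∈ Finset.range n, (F t s - F (t + 1) (s + 1)) =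
      ∑ t ∈ Finset.range n, (F t 0 - F t n) + ∑ s ∈ Finset.range n, (F 0 (s + 1) - F n (s + 1)) := by
  have h1 : ∀ t s, F t s - F (t + 1) (s + 1) =
      (F t s - F t (s + 1)) + (F t (s + 1) - F (t + 1) (s + 1)) := fun t s => by ring
  simp_rw [h1, Finset.sum_add_distrib]
  congr 1
  · exact Finset.sum_congr rfl fun t _ => Finset.sum_range_sub' (F t) n
  · rw [Finset.sum_comm]
    exact Finset.sum_congr rfl fun s _ => Finset.sum_range_sub' (fun t => F t (s + 1)) n

/-- Multiplying by `1 - zw` subtracts from each term its neighbour on the same diagonal, where `c(t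
- s)` is constant. Only the border of the square survives; evenness of `c` and `z^n = w^n = 1` turn
it into two truncated conjugate series, with the terms `c 0` and `c n` cancelling. -/
theorem one_sub_mul_sum_toeplitz {c : ℤ → ℝ} (hc : ∀ k, c (-k) = c k) {n : ℕ} {z w : ℂ}
    (hz : z ^ n = 1) (hw : w ^ n = 1) (hz0 : z ≠ 0) (hw0 : w ≠ 0) :
    (1 - z * w) * ∑ t ∈ Finset.range n, ∑ s ∈ Finset.range n, (c ((t : ℤ) - s) : ℂ) * (z ^ t * w ^ s) =
      ∑ h ∈ Finset.Ico 1 n, (c h : ℂ) * (z ^ h - (z⁻¹) ^ h) +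
      ∑ h ∈ Finset.Ico 1 n, (c h : ℂ) * (w ^ h - (w⁻¹) ^ h) := by
  rcases Nat.eq_zero_or_pos n with rfl | hn
  · simp
  set F : ℕ → ℕ → ℂ := fun t s => (c ((t : ℤ) - s) : ℂ) * (z ^ t * w ^ s) with hF
  have key := sum_sum_sub_succ n F
  have hpow : ∀ {x : ℂ}, x ≠ 0 → x ^ n = 1 → ∀ h, h ≤ n → x ^ (n - h) = (x⁻¹) ^ h := by
    intro x hx hxn h hh
    rw [inv_pow, eq_comm, inv_eq_iff_eq_inv, ← one_div, eq_div_iff (pow_ne_zero _ hx), ← pow_add,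
      Nat.add_sub_cancel' hh, hxn]
  have hleft : (1 - z * w) * ∑ t ∈ Finset.range n, ∑ s ∈ Finset.range n, F t s =
      ∑ t ∈ Finset.range n, ∑ s ∈ Finset.range n, (F t s - F (t + 1) (s + 1)) := by
    rw [Finset.mul_sum]
    refine Finset.sum_congr rfl fun t _ => ?_
    rw [Finset.mul_sum]
    refine Finset.sum_congr rfl fun s _ => ?_
    simp only [hF]
    rw [show ((t + 1 : ℕ) : ℤ) - ((s + 1 : ℕ) : ℤ) = (t : ℤ) - s by push_cast; ring]
    ring
  have hA : ∀ G : ℕ → ℂ, ∑ h ∈ Finset.range n, G h = G 0 + ∑ h ∈ Finset.Ico 1 n, G h := fun G => by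
    rw [Finset.range_eq_Ico, Finset.sum_eq_sum_Ico_succ_bot hn]
  have hB : ∀ G : ℕ → ℂ, ∑ h ∈ Finset.range n, G (h + 1) = ∑ h ∈ Finset.Ico 1 n, G h + G n :=
    fun G => by
      rw [Finset.range_eq_Ico, Finset.sum_Ico_add' G 0 n 1, zero_add, Finset.sum_Ico_succ_top hn]
  have hz1 : ∑ t ∈ Finset.range n, F t 0 = c 0 + ∑ h ∈ Finset.Ico 1 n, (c h : ℂ) * z ^ h := by
    rw [hA]
    simp [hF]
  have hz2 : ∑ t ∈ Finset.range n, F t n =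
      ∑ h ∈ Finset.Ico 1 n, (c h : ℂ) * (z⁻¹) ^ h + c n := by
    have := hB (fun h => (c h : ℂ) * (z⁻¹) ^ h)
    rw [← hpow hz0 hz n le_rfl, Nat.sub_self, pow_zero, mul_one] at this
    rw [← this, ← Finset.sum_range_reflect]
    refine Finset.sum_congr rfl fun j hj => ?_
    have hj' := Finset.mem_range.1 hj
    have e : ((n - 1 - j : ℕ) : ℤ) - n = -((j + 1 : ℕ) : ℤ) := by omega
    simp only [hF]
    rw [e, hc, hw, mul_one, ← hpow hz0 hz (j + 1) (by omega),
      show n - 1 - j = n - (j + 1) by omega]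
  have hw1 : ∑ s ∈ Finset.range n, F 0 (s + 1) =
      ∑ h ∈ Finset.Ico 1 n, (c h : ℂ) * w ^ h + c n := by
    have := hB (fun h => (c h : ℂ) * w ^ h)
    rw [hw, mul_one] at this
    rw [← this]
    refine Finset.sum_congr rfl fun j _ => ?_
    simp only [hF]
    rw [Nat.cast_zero, zero_sub, hc, pow_zero, one_mul]
  have hw2 : ∑ s ∈ Finset.range n, F n (s + 1) =
      c 0 + ∑ h ∈ Finset.Ico 1 n, (c h : ℂ) * (w⁻¹) ^ h := by
    have := hA (fun h => (c h : ℂ) * (w⁻¹) ^ h)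
    rw [pow_zero, mul_one, Nat.cast_zero] at this
    rw [← this, ← Finset.sum_range_reflect]
    refine Finset.sum_congr rfl fun j hj => ?_
    have hj' := Finset.mem_range.1 hj
    have e : (n : ℤ) - ((n - 1 - j + 1 : ℕ) : ℤ) = j := by omega
    simp only [hF]
    rw [e, hz, one_mul, ← hpow hw0 hw j (by omega), show n - 1 - j + 1 = n - j by omega]
  rw [hleft, key, Finset.sum_sub_distrib, Finset.sum_sub_distrib, hz1, hz2, hw1, hw2]
  simp only [mul_sub, Finset.sum_sub_distrib]
  ring

/-- The exponential sum attached to a Toeplitz matrix, at two `n`-th roots of unity. -/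
theorem norm_sum_toeplitz_mul_le {c : ℤ → ℝ} (hc : ∀ k, c (-k) = c k) {n : ℕ} {α β : ℝ}
    (hα : Complex.exp (Complex.I * α) ^ n = 1) (hβ : Complex.exp (Complex.I * β) ^ n = 1) :
    2 * |Real.sin ((α + β) / 2)| * ‖∑ t ∈ Finset.Icc 1 n, ∑ s ∈ Finset.Icc 1 n,
      (c ((t : ℤ) - s) : ℂ) *
        (Complex.exp (Complex.I * α) ^ t * Complex.exp (Complex.I * β) ^ s)‖ ≤
      2 * |∑ h ∈ Finset.Ico 1 n, c h * Real.sin (h * α)| +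
      2 * |∑ h ∈ Finset.Ico 1 n, c h * Real.sin (h * β)| := by
  set z := Complex.exp (Complex.I * α) with hz
  set w := Complex.exp (Complex.I * β) with hw
  have hS : ∀ x : ℝ, ‖∑ h ∈ Finset.Ico 1 n, (c h : ℂ) * (Complex.exp (Complex.I * x) ^ h -
      ((Complex.exp (Complex.I * x))⁻¹) ^ h)‖ =
      2 * |∑ h ∈ Finset.Ico 1 n, c h * Real.sin (h * x)| := fun x => by
    have : ∑ h ∈ Finset.Ico 1 n, (c h : ℂ) * (Complex.exp (Complex.I * x) ^ h -
      ((Complex.exp (Complex.I * x))⁻¹) ^ h) =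
        (2 * Complex.I) * ((∑ h ∈ Finset.Ico 1 n, c h * Real.sin (h * x) : ℝ) : ℂ) := by
      push_cast
      rw [Finset.mul_sum]
      refine Finset.sum_congr rfl fun h _ => ?_
      rw [← Complex.exp_neg, ← Complex.exp_nat_mul, ← Complex.exp_nat_mul, Complex.sin,
        show (h : ℂ) * -(Complex.I * x) = -(h * x) * Complex.I by ring,
        show (h : ℂ) * (Complex.I * x) = (h * x) * Complex.I by ring]
      linear_combination (c h : ℂ) * (Complex.exp (-(h * x) * Complex.I) -
        Complex.exp ((h * x) * Complex.I)) * (-Complex.I_sq)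
    rw [this, norm_mul, Complex.norm_real, Real.norm_eq_abs]
    simp
  have hshift : ∑ t ∈ Finset.Icc 1 n, ∑ s ∈ Finset.Icc 1 n, (c ((t : ℤ) - s) : ℂ) * (z ^ t * w ^ s)
      = (z * w) * ∑ t ∈ Finset.range n, ∑ s ∈ Finset.range n,
        (c ((t : ℤ) - s) : ℂ) * (z ^ t * w ^ s) := by
    rw [Finset.mul_sum, ← Finset.Ico_add_one_right_eq_Icc 1 n, Finset.range_eq_Ico,
      ← zero_add 1, ← Finset.sum_Ico_add' _ 0 n 1]
    refine Finset.sum_congr rfl fun t _ => ?_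
    rw [Finset.mul_sum, ← Finset.sum_Ico_add' _ 0 n 1]
    refine Finset.sum_congr rfl fun s _ => ?_
    rw [show ((t + 1 : ℕ) : ℤ) - ((s + 1 : ℕ) : ℤ) = (t : ℤ) - s by push_cast; ring]
    ring
  have hzw : ‖1 - z * w‖ = 2 * |Real.sin ((α + β) / 2)| := by
    rw [norm_sub_rev, hz, hw, ← Complex.exp_add, ← mul_add, ← Complex.ofReal_add,
      Complex.norm_exp_I_mul_ofReal_sub_one, norm_mul, Real.norm_eq_abs, Real.norm_eq_abs]
    simp
  rw [hshift, ← hzw, norm_mul, norm_mul, hz, hw, Complex.norm_exp_I_mul_ofReal,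
    Complex.norm_exp_I_mul_ofReal, one_mul, one_mul, ← norm_mul,
    one_sub_mul_sum_toeplitz hc hα hβ (Complex.exp_ne_zero _) (Complex.exp_ne_zero _), ← hS, ← hS]
  exact norm_add_le _ _

theorem sin_add_half_sq_sub (u v : ℝ) :
    Real.sin ((u + v) / 2) ^ 2 - Real.sin ((u - v) / 2) ^ 2 = Real.sin u * Real.sin v := by
  rw [show (u + v) / 2 = u / 2 + v / 2 by ring, show (u - v) / 2 = u / 2 - v / 2 by ring,
    Real.sin_add, Real.sin_sub]
  have h1 : Real.sin u = 2 * Real.sin (u / 2) * Real.cos (u / 2) := by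
    rw [← Real.sin_two_mul]; congr 1; ring
  have h2 : Real.sin v = 2 * Real.sin (v / 2) * Real.cos (v / 2) := by
    rw [← Real.sin_two_mul]; congr 1; ring
  rw [h1, h2]
  ring

/-- The four exponential sums in a product of real trigonometric vectors carry the factors `sin((u ±
v)/2)`. The difference gives the smaller one, so a single lower bound serves them all. -/
theorem abs_sin_sub_half_le {u v : ℝ} (hu : u ∈ Set.Icc 0 Real.pi) (hv : v ∈ Set.Icc 0 Real.pi) :
    |Real.sin ((u - v) / 2)| ≤ |Real.sin ((u + v) / 2)| := by
  rw [← sq_le_sq]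
  have := sin_add_half_sq_sub u v
  have := mul_nonneg (Real.sin_nonneg_of_mem_Icc hu) (Real.sin_nonneg_of_mem_Icc hv)
  linarith

theorem abs_le_pi_mul_abs_sin_half {x : ℝ} (hx : |x| ≤ Real.pi) :
    |x| ≤ Real.pi * |Real.sin (x / 2)| := by
  have h := Real.le_two_mul_sin_half (abs_nonneg x) hx
  have h1 : Real.sin (|x| / 2) ≤ |Real.sin (x / 2)| := by
    rcases abs_cases x with ⟨e, -⟩ | ⟨e, -⟩ <;> rw [e]
    · exact le_abs_self _
    · rw [neg_div, Real.sin_neg]; exact neg_le_abs _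
  have hpi := Real.pi_pos
  rw [div_mul_eq_mul_div, div_le_iff₀ hpi] at h
  nlinarith

theorem trigVec_eq_exp (θ : ℝ) (σ : Bool) : ∃ p q : ℂ, ‖p‖ = 1 / 2 ∧ ‖q‖ = 1 / 2 ∧
    ∀ t : ℕ, (trigVec θ σ t : ℂ) = p * Complex.exp (Complex.I * θ) ^ t +
      q * Complex.exp (Complex.I * (-θ : ℝ)) ^ t := by
  cases σ
  · refine ⟨-Complex.I / 2, Complex.I / 2, by simp, by simp, fun t => ?_⟩
    simp only [trigVec, Bool.false_eq_true, if_false]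
    push_cast
    rw [← Complex.exp_nat_mul, ← Complex.exp_nat_mul, Complex.sin,
      show (t : ℂ) * (Complex.I * -θ) = -(t * θ) * Complex.I by ring,
      show (t : ℂ) * (Complex.I * θ) = (t * θ) * Complex.I by ring]
    ring
  · refine ⟨1 / 2, 1 / 2, by simp, by simp, fun t => ?_⟩
    simp only [trigVec, if_true]
    push_cast
    rw [← Complex.exp_nat_mul, ← Complex.exp_nat_mul, Complex.cos,
      show (t : ℂ) * (Complex.I * -θ) = -(t * θ) * Complex.I by ring,
      show (t : ℂ) * (Complex.I * θ) = (t * θ) * Complex.I by ring]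
    ring

/-- Euler's formulas split the form into four exponential sums at `(±α, ±β)` with coefficients of
modulus `1/4`. Each is controlled by the conjugate series at `α` and `β`, which change only sign
under reflection, and `|α - β| ≤ π |sin((α - β)/2)|`. -/
theorem abs_toeplitzForm_trigVec_le {c : ℤ → ℝ} (hc : ∀ k, c (-k) = c k) {n : ℕ} {α β : ℝ}
    (hα : Complex.exp (Complex.I * α) ^ n = 1) (hβ : Complex.exp (Complex.I * β) ^ n = 1)
    (hα' : α ∈ Set.Icc 0 Real.pi) (hβ' : β ∈ Set.Icc 0 Real.pi) (σ τ : Bool) :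
    |α - β| * |toeplitzForm c n (trigVec α σ) (trigVec β τ)| ≤
      Real.pi * (|∑ h ∈ Finset.Ico 1 n, c h * Real.sin (h * α)| +
        |∑ h ∈ Finset.Ico 1 n, c h * Real.sin (h * β)|) := by
  set A := |∑ h ∈ Finset.Ico 1 n, c h * Real.sin (h * α)| +
        |∑ h ∈ Finset.Ico 1 n, c h * Real.sin (h * β)| with hA
  set E : ℝ → ℝ → ℂ := fun a b => ∑ t ∈ Finset.Icc 1 n, ∑ s ∈ Finset.Icc 1 n,
      (c ((t : ℤ) - s) : ℂ) *
        (Complex.exp (Complex.I * a) ^ t * Complex.exp (Complex.I * b) ^ s) with hE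
  have hneg : ∀ a : ℝ, Complex.exp (Complex.I * a) ^ n = 1 →
      Complex.exp (Complex.I * (-a : ℝ)) ^ n = 1 := fun a ha => by
    rw [Complex.ofReal_neg, mul_neg, Complex.exp_neg, inv_pow, ha, inv_one]
  have hsneg : ∀ a : ℝ, |∑ h ∈ Finset.Ico 1 n, c h * Real.sin (h * -a)| =
      |∑ h ∈ Finset.Ico 1 n, c h * Real.sin (h * a)| := fun a => by
    simp only [mul_neg, Real.sin_neg, Finset.sum_neg_distrib, abs_neg]
  have hd : |α - β| ≤ Real.pi * |Real.sin ((α - β) / 2)| := by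
    refine abs_le_pi_mul_abs_sin_half (abs_le.2 ⟨?_, ?_⟩) <;> linarith [hα'.1, hα'.2, hβ'.1, hβ'.2]
  have hs := abs_sin_sub_half_le hα' hβ'
  have hpi := Real.pi_pos
  have hsin : ∀ x : ℝ, |Real.sin ((α - β) / 2)| ≤ |Real.sin x| → ∀ y : ℂ,
      2 * |Real.sin x| * ‖y‖ ≤ 2 * A → |α - β| * ‖y‖ ≤ Real.pi * A := fun x hx y hy => by
    calc |α - β| * ‖y‖ ≤ (Real.pi * |Real.sin x|) * ‖y‖ := by
          gcongr
          exact hd.trans (by gcongr)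
      _ = Real.pi / 2 * (2 * |Real.sin x| * ‖y‖) := by ring
      _ ≤ Real.pi / 2 * (2 * A) := by gcongr
      _ = _ := by ring
  have e1 : |α - β| * ‖E α β‖ ≤ Real.pi * A := by
    refine hsin _ hs _ ((norm_sum_toeplitz_mul_le hc hα hβ).trans_eq ?_)
    rw [hA]; ring
  have e2 : |α - β| * ‖E α (-β)‖ ≤ Real.pi * A := by
    refine hsin ((α + -β) / 2) (by rw [← sub_eq_add_neg]) _
      ((norm_sum_toeplitz_mul_le hc hα (hneg β hβ)).trans_eq ?_)
    rw [hA, hsneg]; ring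
  have e3 : |α - β| * ‖E (-α) β‖ ≤ Real.pi * A := by
    refine hsin ((-α + β) / 2) ?_ _
      ((norm_sum_toeplitz_mul_le hc (hneg α hα) hβ).trans_eq ?_)
    · rw [show (-α + β) / 2 = -((α - β) / 2) by ring, Real.sin_neg, abs_neg]
    · rw [hA, hsneg]; ring
  have e4 : |α - β| * ‖E (-α) (-β)‖ ≤ Real.pi * A := by
    refine hsin ((-α + -β) / 2) ?_ _
      ((norm_sum_toeplitz_mul_le hc (hneg α hα) (hneg β hβ)).trans_eq ?_)
    · rwa [show (-α + -β) / 2 = -((α + β) / 2) by ring, Real.sin_neg, abs_neg]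
    · rw [hA, hsneg, hsneg]; ring
  obtain ⟨p, q, hp, hq, hpq⟩ := trigVec_eq_exp α σ
  obtain ⟨p', q', hp', hq', hpq'⟩ := trigVec_eq_exp β τ
  have key : (toeplitzForm c n (trigVec α σ) (trigVec β τ) : ℂ) =
      p * p' * E α β + p * q' * E α (-β) + q * p' * E (-α) β + q * q' * E (-α) (-β) := by
    simp only [toeplitzForm, hE]
    push_cast
    simp only [Finset.mul_sum, ← Finset.sum_add_distrib]
    refine Finset.sum_congr rfl fun t _ => Finset.sum_congr rfl fun s _ => ?_
    have h1 := hpq t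
    have h2 := hpq' s
    push_cast at h1 h2
    rw [h1, h2]
    ring
  have hn : |toeplitzForm c n (trigVec α σ) (trigVec β τ)| ≤
      1 / 4 * (‖E α β‖ + ‖E α (-β)‖ + ‖E (-α) β‖ + ‖E (-α) (-β)‖) := by
    rw [← Real.norm_eq_abs, ← Complex.norm_real, key]
    refine (norm_add_le _ _).trans ((add_le_add (norm_add₃_le) le_rfl).trans_eq ?_)
    simp only [norm_mul, hp, hq, hp', hq']
    ring
  calc _ ≤ |α - β| * (1 / 4 * (‖E α β‖ + ‖E α (-β)‖ + ‖E (-α) β‖ + ‖E (-α) (-β)‖)) := by gcongr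
    _ ≤ _ := by linarith

end Toeplitz

/-! ### The Fejér kernel and its folded version -/

noncomputable section FejerKernel

/-- The normalized Fejér kernel `(2πn)⁻¹ |∑_{t=1}^n e^{itx}|²`. -/
def fejer (n : ℕ) (x : ℝ) : ℝ :=
  (2 * Real.pi * n)⁻¹ * ((∑ t ∈ Finset.Icc 1 n, Real.cos (t * x)) ^ 2 +
    (∑ t ∈ Finset.Icc 1 n, Real.sin (t * x)) ^ 2)

/-- The Fejér kernel at frequency `v`, folded to `[0, π]`. -/
def foldedFejer (n : ℕ) (v u : ℝ) : ℝ := fejer n (u + v) + fejer n (u - v)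

theorem fejer_eq_sum (n : ℕ) (x : ℝ) : fejer n x = (2 * Real.pi * n)⁻¹ *
    ∑ t ∈ Finset.Icc 1 n, ∑ s ∈ Finset.Icc 1 n, Real.cos (((t : ℝ) - s) * x) := by
  rw [fejer, pow_two, pow_two, Finset.sum_mul_sum, Finset.sum_mul_sum, ← Finset.sum_add_distrib]
  congr 1
  refine Finset.sum_congr rfl fun t _ => ?_
  rw [← Finset.sum_add_distrib]
  refine Finset.sum_congr rfl fun s _ => ?_
  rw [sub_mul, Real.cos_sub]

theorem fejer_nonneg (n : ℕ) (x : ℝ) : 0 ≤ fejer n x := by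
  have := Real.pi_pos
  unfold fejer
  positivity

theorem fejer_zero (n : ℕ) : fejer n 0 = n / (2 * Real.pi) := by
  have := Real.pi_pos
  rcases Nat.eq_zero_or_pos n with rfl | hn
  · simp [fejer]
  · have hn' : (0 : ℝ) < n := by exact_mod_cast hn
    simp [fejer]
    field_simp

theorem fejer_le (n : ℕ) (x : ℝ) : fejer n x ≤ n / (2 * Real.pi) := by
  have := Real.pi_pos
  rw [← fejer_zero, fejer_eq_sum, fejer_eq_sum]
  gcongr with t _ s _
  simpa using Real.cos_le_one _

theorem continuous_fejer (n : ℕ) : Continuous (fejer n) := by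
  unfold fejer; fun_prop

theorem continuous_foldedFejer (n : ℕ) (v : ℝ) : Continuous (foldedFejer n v) :=
  ((continuous_fejer n).comp (by fun_prop)).add ((continuous_fejer n).comp (by fun_prop))

theorem foldedFejer_nonneg (n : ℕ) (v u : ℝ) : 0 ≤ foldedFejer n v u :=
  add_nonneg (fejer_nonneg _ _) (fejer_nonneg _ _)

/-- The closed form of the kernel, kept free of division so that it also holds at the zeros of
`sin(x/2)`. -/
theorem sin_half_sq_mul_fejer (n : ℕ) (x : ℝ) :
    Real.sin (x / 2) ^ 2 * (2 * Real.pi * n * fejer n x) = Real.sin (n * x / 2) ^ 2 := by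
  rcases Nat.eq_zero_or_pos n with rfl | hn
  · simp
  have h1 : 2 * Real.sin (x / 2) * ∑ t ∈ Finset.Icc 1 n, Real.cos (t * x) =
      Real.sin ((n + 1 / 2) * x) - Real.sin (x / 2) := by
    clear hn
    induction n with
    | zero => simp [show (2⁻¹ : ℝ) * x = x / 2 by ring]
    | succ n ih =>
      rw [Finset.sum_Icc_succ_top (by omega), mul_add, ih, Nat.cast_succ,
        show ((n : ℝ) + 1 + 1 / 2) * x = (n + 1) * x + x / 2 by ring,
        show ((n : ℝ) + 1 / 2) * x = (n + 1) * x - x / 2 by ring, Real.sin_add, Real.sin_sub]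
      ring
  have h2 : 2 * Real.sin (x / 2) * ∑ t ∈ Finset.Icc 1 n, Real.sin (t * x) =
      Real.cos (x / 2) - Real.cos ((n + 1 / 2) * x) := by
    clear hn h1
    induction n with
    | zero => simp [show (2⁻¹ : ℝ) * x = x / 2 by ring]
    | succ n ih =>
      rw [Finset.sum_Icc_succ_top (by omega), mul_add, ih, Nat.cast_succ,
        show ((n : ℝ) + 1 + 1 / 2) * x = (n + 1) * x + x / 2 by ring,
        show ((n : ℝ) + 1 / 2) * x = (n + 1) * x - x / 2 by ring, Real.cos_add, Real.cos_sub]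
      ring
  have hn' : (0 : ℝ) < n := by exact_mod_cast hn
  have hpi := Real.pi_pos
  have h3 : 2 * Real.pi * n * fejer n x = (∑ t ∈ Finset.Icc 1 n, Real.cos (t * x)) ^ 2 +
    (∑ t ∈ Finset.Icc 1 n, Real.sin (t * x)) ^ 2 := by
    rw [fejer, ← mul_assoc, mul_inv_cancel₀ (by positivity), one_mul]
  have h4 : 4 * (Real.sin (x / 2) ^ 2 * (2 * Real.pi * n * fejer n x)) =
      4 * Real.sin (n * x / 2) ^ 2 := by
    calc _ = (2 * Real.sin (x / 2) * ∑ t ∈ Finset.Icc 1 n, Real.cos (t * x)) ^ 2 +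
          (2 * Real.sin (x / 2) * ∑ t ∈ Finset.Icc 1 n, Real.sin (t * x)) ^ 2 := by rw [h3]; ring
      _ = _ := by
        rw [h1, h2, show ((n : ℝ) + 1 / 2) * x = n * x / 2 + (n * x / 2 + x / 2) by ring,
          Real.sin_add (n * x / 2) (n * x / 2 + x / 2),
          Real.cos_add (n * x / 2) (n * x / 2 + x / 2), Real.sin_add (n * x / 2) (x / 2),
          Real.cos_add (n * x / 2) (x / 2)]
        have a1 := Real.sin_sq_add_cos_sq (x / 2)
        have a2 := Real.sin_sq_add_cos_sq (n * x / 2)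
        set s := Real.sin (x / 2)
        set k := Real.cos (x / 2)
        set S := Real.sin (n * x / 2)
        set K := Real.cos (n * x / 2)
        have e : (S * (K * k - S * s) + K * (S * k + K * s) - s) =
            2 * S * (K * k - S * s) := by linear_combination s * a2
        have e' : k - (K * (K * k - S * s) - S * (S * k + K * s)) =
            2 * S * (S * k + K * s) := by linear_combination (-k) * a2
        rw [e, e']
        linear_combination (4 * S ^ 2 * (K ^ 2 + S ^ 2)) * a1 + 4 * S ^ 2 * a2
  linarith

/-- At a Fourier frequency `nv` is a multiple of `2π`, so the numerators `sin²(n(u ± v)/2)` agree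
and only the denominators differ. The reflected half of the folded kernel is therefore dominated by
the main half. -/
theorem fejer_add_le_fejer_sub {n : ℕ} {u v : ℝ} (hn : 0 < n) (hnv : Complex.exp (Complex.I * v) ^ n = 1)
    (hu : u ∈ Set.Icc 0 Real.pi) (hv : v ∈ Set.Icc 0 Real.pi) :
    fejer n (u + v) ≤ fejer n (u - v) := by
  have hpi := Real.pi_pos
  have hn' : (0 : ℝ) < n := by exact_mod_cast hn
  -- A vanishing denominator forces `u = v`, where the right side is the maximum of the kernel.
  by_cases h0 : Real.sin ((u - v) / 2) = 0
  · have : (u - v) / 2 = 0 := by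
      refine (Real.sin_eq_zero_iff_of_lt_of_lt ?_ ?_).1 h0 <;> linarith [hu.1, hu.2, hv.1, hv.2]
    rw [show u - v = 0 by linarith, fejer_zero]
    exact fejer_le _ _
  · have hs := (abs_sin_sub_half_le hu hv)
    rw [← sq_le_sq] at hs
    have hpos : 0 < Real.sin ((u - v) / 2) ^ 2 := by positivity
    have hexp : Complex.exp ((n * v : ℝ) * Complex.I) = 1 := by
      rw [← hnv, ← Complex.exp_nat_mul]; congr 1; push_cast; ring
    obtain ⟨m, hm⟩ := Complex.exp_eq_one_iff.1 hexp
    have hm' : (n : ℝ) * v = m * (2 * Real.pi) := by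
      have := congrArg Complex.im hm
      simpa [mul_comm, mul_assoc, mul_left_comm] using this
    have heq : Real.sin (n * (u + v) / 2) ^ 2 = Real.sin (n * (u - v) / 2) ^ 2 := by
      have e : n * (u + v) = n * (u - v) + (2 * m : ℤ) * (2 * Real.pi) := by
        push_cast; linear_combination 2 * hm'
      rw [Real.sin_sq_eq_half_sub, Real.sin_sq_eq_half_sub,
        show 2 * (n * (u + v) / 2) = n * (u + v) by ring,
        show 2 * (n * (u - v) / 2) = n * (u - v) by ring, e, Real.cos_add_int_mul_two_pi]
    have h1 := sin_half_sq_mul_fejer n (u + v)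
    have h2 := sin_half_sq_mul_fejer n (u - v)
    rw [heq, ← h2] at h1
    have hc : 0 < 2 * Real.pi * n := by positivity
    have hle : Real.sin ((u - v) / 2) ^ 2 * (2 * Real.pi * n * fejer n (u + v)) ≤
        Real.sin ((u - v) / 2) ^ 2 * (2 * Real.pi * n * fejer n (u - v)) := by
      rw [← h1]
      have := fejer_nonneg n (u + v)
      gcongr
    exact le_of_mul_le_mul_left (le_of_mul_le_mul_left hle hpos) hc

/-- Combines the bound `n/(2π)`, sharp near the origin, with `n x² fejer n x ≤ π/2` from the closed
form, through `(1 + y)² ≤ 2 + 2y²`. -/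
theorem fejer_le_of_abs_le_pi {n : ℕ} {x : ℝ} (hx : |x| ≤ Real.pi) :
    (1 + n * |x|) ^ 2 * fejer n x ≤ 4 * n := by
  have hpi := Real.pi_pos
  have hpi3 := Real.pi_gt_three
  have hpi4 := Real.pi_lt_d2
  rcases Nat.eq_zero_or_pos n with rfl | hn
  · simp [fejer]
  have hn' : (0 : ℝ) < n := by exact_mod_cast hn
  have h0 := fejer_nonneg n x
  have h1 : fejer n x ≤ n / 6 := (fejer_le n x).trans (by gcongr; linarith)
  have h2 : n * x ^ 2 * fejer n x ≤ Real.pi / 2 := by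
    have h3 := sin_half_sq_mul_fejer n x
    have h4 : |x| ^ 2 ≤ Real.pi ^ 2 * Real.sin (x / 2) ^ 2 := by
      rw [← sq_abs (Real.sin _), ← mul_pow]
      exact pow_le_pow_left₀ (abs_nonneg x) (abs_le_pi_mul_abs_sin_half hx) 2
    rw [sq_abs] at h4
    have h5 := Real.sin_sq_le_one (n * x / 2)
    have h6 : n * fejer n x * x ^ 2 ≤ n * fejer n x * (Real.pi ^ 2 * Real.sin (x / 2) ^ 2) := by
      gcongr
    have h7 : n * fejer n x * (Real.pi ^ 2 * Real.sin (x / 2) ^ 2) =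
        Real.pi / 2 * Real.sin (n * x / 2) ^ 2 := by rw [← h3]; ring
    nlinarith
  have h8 : (1 + n * |x|) ^ 2 ≤ 2 + 2 * (n * (n * x ^ 2)) := by
    have : (n * |x|) ^ 2 = n * (n * x ^ 2) := by rw [mul_pow, sq_abs]; ring
    nlinarith [sq_nonneg (1 - n * |x|)]
  calc (1 + n * |x|) ^ 2 * fejer n x ≤ (2 + 2 * (n * (n * x ^ 2))) * fejer n x := by gcongr
    _ = 2 * fejer n x + 2 * n * (n * x ^ 2 * fejer n x) := by ring
    _ ≤ 2 * (n / 6) + 2 * n * (Real.pi / 2) := by gcongr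
    _ ≤ 4 * n := by nlinarith

theorem foldedFejer_le {n : ℕ} {u v : ℝ} (hn : 0 < n) (hnv : Complex.exp (Complex.I * v) ^ n = 1)
    (hu : u ∈ Set.Icc 0 Real.pi) (hv : v ∈ Set.Icc 0 Real.pi) :
    (1 + n * |u - v|) ^ 2 * foldedFejer n v u ≤ 8 * n := by
  have h1 := fejer_add_le_fejer_sub hn hnv hu hv
  have h2 : (1 + n * |u - v|) ^ 2 * fejer n (u - v) ≤ 4 * n := by
    refine fejer_le_of_abs_le_pi (abs_le.2 ⟨?_, ?_⟩) <;> linarith [hu.1, hu.2, hv.1, hv.2]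
  have h3 : (1 + n * |u - v|) ^ 2 * fejer n (u + v) ≤ (1 + n * |u - v|) ^ 2 * fejer n (u - v) := by
    gcongr
  rw [foldedFejer, mul_add]
  linarith

/-- The diagonal of the Toeplitz form at a frequency is an average against the folded kernel. -/
theorem toeplitzForm_trigVec_add {f : ℝ → ℝ} (hf : IntervalIntegrable f volume 0 Real.pi) {n : ℕ}
    (hn : 0 < n) (v : ℝ) :
    toeplitzForm (cosCoeff f) n (trigVec v true) (trigVec v true) +
      toeplitzForm (cosCoeff f) n (trigVec v false) (trigVec v false) =
      2 * Real.pi * n * ∫ u in (0 : ℝ)..Real.pi, foldedFejer n v u * f u := by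
  have hpi := Real.pi_pos
  have hn' : (0 : ℝ) < n := by exact_mod_cast hn
  have e1 : toeplitzForm (cosCoeff f) n (trigVec v true) (trigVec v true) +
      toeplitzForm (cosCoeff f) n (trigVec v false) (trigVec v false) =
      ∑ t ∈ Finset.Icc 1 n, ∑ s ∈ Finset.Icc 1 n, ∫ u in (0 : ℝ)..Real.pi,
        2 * Real.cos (((t : ℝ) - s) * v) * (Real.cos (((t : ℝ) - s) * u) * f u) := by
    simp only [toeplitzForm, ← Finset.sum_add_distrib]
    refine Finset.sum_congr rfl fun t _ => Finset.sum_congr rfl fun s _ => ?_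
    rw [intervalIntegral.integral_const_mul, sub_mul, Real.cos_sub]
    simp only [trigVec, cosCoeff, if_true, Bool.false_eq_true, if_false]
    push_cast
    ring
  have hint : ∀ t s : ℕ, IntervalIntegrable (fun u => 2 * Real.cos (((t : ℝ) - s) * v) *
      (Real.cos (((t : ℝ) - s) * u) * f u)) volume 0 Real.pi := fun t s =>
    (hf.cos_mul _).const_mul _
  rw [e1, ← intervalIntegral.integral_const_mul]
  have e2 : ∀ t ∈ Finset.Icc 1 n, ∑ s ∈ Finset.Icc 1 n, ∫ u in (0 : ℝ)..Real.pi,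
        2 * Real.cos (((t : ℝ) - s) * v) * (Real.cos (((t : ℝ) - s) * u) * f u) =
      ∫ u in (0 : ℝ)..Real.pi, ∑ s ∈ Finset.Icc 1 n,
        2 * Real.cos (((t : ℝ) - s) * v) * (Real.cos (((t : ℝ) - s) * u) * f u) := fun t _ =>
    (intervalIntegral.integral_finsetSum fun s _ => hint t s).symm
  rw [Finset.sum_congr rfl e2, ← intervalIntegral.integral_finsetSum fun t _ =>
    (by simpa only [Finset.sum_fn] using IntervalIntegrable.sum _ fun s _ => hint t s)]
  refine intervalIntegral.integral_congr fun u _ => ?_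
  simp only [foldedFejer, fejer_eq_sum]
  rw [← mul_add, ← Finset.sum_add_distrib, ← mul_assoc, ← mul_assoc,
    mul_inv_cancel₀ (by positivity), one_mul, Finset.sum_mul]
  refine Finset.sum_congr rfl fun t _ => ?_
  rw [← Finset.sum_add_distrib, Finset.sum_mul]
  refine Finset.sum_congr rfl fun s _ => ?_
  rw [mul_add, mul_sub _ u v, Real.cos_add, Real.cos_sub]
  ring

/-- For the constant density `1` the Toeplitz matrix is `2π` times the identity, and `cos² + sin² =
1` gives the total `2πn`. -/
theorem integral_foldedFejer {n : ℕ} (hn : 0 < n) (v : ℝ) :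
    ∫ u in (0 : ℝ)..Real.pi, foldedFejer n v u = 1 := by
  have hpi := Real.pi_pos
  have hn' : (0 : ℝ) < n := by exact_mod_cast hn
  have hc : ∀ k : ℤ, cosCoeff (fun _ => 1) k = if k = 0 then 2 * Real.pi else 0 := fun k => by
    rw [cosCoeff]
    split_ifs with h
    · simp [h]
    · have : (k : ℝ) ≠ 0 := by exact_mod_cast h
      simp [intervalIntegral.integral_comp_mul_left, this, Real.sin_int_mul_pi]
  have h := toeplitzForm_trigVec_add (f := fun _ => 1) (by simp) hn v
  have e : toeplitzForm (cosCoeff fun _ => 1) n (trigVec v true) (trigVec v true) +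
      toeplitzForm (cosCoeff fun _ => 1) n (trigVec v false) (trigVec v false) =
      2 * Real.pi * n := by
    simp only [toeplitzForm, ← Finset.sum_add_distrib, hc, sub_eq_zero, Nat.cast_inj, mul_ite,
      mul_zero]
    calc _ = ∑ t ∈ Finset.Icc 1 n, 2 * Real.pi := by
          refine Finset.sum_congr rfl fun t ht => ?_
          rw [Finset.sum_add_distrib, Finset.sum_ite_eq, Finset.sum_ite_eq, if_pos ht, if_pos ht,
            ← add_mul]
          simp only [trigVec, if_true, Bool.false_eq_true, if_false]
          rw [← pow_two, ← pow_two, Real.cos_sq_add_sin_sq, one_mul]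
      _ = _ := by simp; ring
  rw [e] at h
  simp only [mul_one] at h
  have : (2 * Real.pi * n) ≠ 0 := by positivity
  exact (mul_right_eq_self₀.1 h.symm).resolve_right this

theorem abs_integral_foldedFejer_mul_sub_le {F B : ℝ → ℝ}
    (hF : IntervalIntegrable F volume 0 Real.pi) {n : ℕ} (hn : 0 < n) {v : ℝ}
    (hB : IntervalIntegrable B volume 0 Real.pi)
    (hFB : ∀ u ∈ Set.Ioc 0 Real.pi, foldedFejer n v u * |F u - F v| ≤ B u) :
    |(∫ u in (0 : ℝ)..Real.pi, foldedFejer n v u * F u) - F v| ≤ ∫ u in (0 : ℝ)..Real.pi, B u := by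
  have hK := (continuous_foldedFejer n v)
  have i1 : IntervalIntegrable (fun u => foldedFejer n v u * F u) volume 0 Real.pi :=
    hF.continuousOn_mul hK.continuousOn
  have i2 : IntervalIntegrable (fun u => foldedFejer n v u * F v) volume 0 Real.pi :=
    (hK.mul continuous_const).intervalIntegrable _ _
  have e : (∫ u in (0 : ℝ)..Real.pi, foldedFejer n v u * F u) - F v =
      ∫ u in (0 : ℝ)..Real.pi, foldedFejer n v u * (F u - F v) := by
    simp_rw [mul_sub]
    rw [intervalIntegral.integral_sub i1 i2, intervalIntegral.integral_mul_const,
      integral_foldedFejer hn, one_mul]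
  rw [e, ← Real.norm_eq_abs]
  refine intervalIntegral.norm_integral_le_of_norm_le Real.pi_pos.le ?_ hB
  filter_upwards with u hu
  rw [norm_mul, Real.norm_eq_abs, Real.norm_eq_abs, abs_of_nonneg (foldedFejer_nonneg _ _ _)]
  exact hFB u hu

end FejerKernel

/-! ### Approximation rates for Fejér averages -/

noncomputable section FejerApproximation

variable {γ : ℝ}

theorem integrable_one_add_abs_rpow (hγ : γ < 1) :
    Integrable (fun y : ℝ => (1 + |y|) ^ (γ - 2)) volume := by
  have := integrable_one_add_norm (E := ℝ) (μ := volume) (r := 2 - γ) (by simp; linarith)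
  simpa [Real.norm_eq_abs] using this

theorem intervalIntegrable_one_add_mul_abs_rpow (n : ℕ) (v a b : ℝ) :
    IntervalIntegrable (fun u => (1 + n * |u - v|) ^ (γ - 2)) volume a b := by
  refine Continuous.intervalIntegrable (Continuous.rpow_const (by fun_prop) fun u => ?_) _ _
  left; positivity

theorem integral_one_add_mul_abs_rpow_le (hγ : γ < 1) {n : ℕ} (hn : 0 < n) (v : ℝ) :
    ∫ u in (0 : ℝ)..Real.pi, (1 + n * |u - v|) ^ (γ - 2) ≤
      (n : ℝ)⁻¹ * ∫ y : ℝ, (1 + |y|) ^ (γ - 2) := by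
  have hn' : (0 : ℝ) < n := by exact_mod_cast hn
  have e : ∀ u : ℝ, (1 + n * |u - v|) ^ (γ - 2) = (1 + |n * (u - v)|) ^ (γ - 2) := fun u => by
    rw [abs_mul, abs_of_pos hn']
  have h1 : Integrable (fun u : ℝ => (1 + |n * (u - v)|) ^ (γ - 2)) volume :=
    ((integrable_one_add_abs_rpow hγ).comp_mul_left' hn'.ne').comp_sub_right v
  rw [intervalIntegral.integral_of_le Real.pi_pos.le]
  simp_rw [e]
  refine (setIntegral_le_integral h1 (Eventually.of_forall fun u => by positivity)).trans_eq ?_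
  rw [integral_sub_right_eq_self (fun u : ℝ => (1 + |n * u|) ^ (γ - 2)) v,
    Measure.integral_comp_mul_left (fun u : ℝ => (1 + |u|) ^ (γ - 2)), abs_of_pos (inv_pos.2 hn'),
    smul_eq_mul]

/-- From `|u - v| ≤ (1 + n|u - v|)/n`: the Hölder factor becomes `n^{-γ}` at the price of slower
decay of the kernel, which stays integrable for `γ < 1`. -/
theorem foldedFejer_mul_abs_rpow_le (hγ0 : 0 ≤ γ) {n : ℕ} {u v : ℝ} (hn : 0 < n)
    (hnv : Complex.exp (Complex.I * v) ^ n = 1)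
    (hu : u ∈ Set.Icc 0 Real.pi) (hv : v ∈ Set.Icc 0 Real.pi) :
    foldedFejer n v u * |u - v| ^ γ ≤ 8 * (n : ℝ) ^ (1 - γ) * (1 + n * |u - v|) ^ (γ - 2) := by
  have hn' : (0 : ℝ) < n := by exact_mod_cast hn
  set y := 1 + n * |u - v| with hy
  have hy0 : 0 < y := by positivity
  have h1 := foldedFejer_le hn hnv hu hv
  have h2 : |u - v| ^ γ ≤ (n : ℝ) ^ (-γ) * y ^ γ := by
    rw [Real.rpow_neg hn'.le, ← Real.inv_rpow hn'.le, ← Real.mul_rpow (by positivity) hy0.le]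
    refine Real.rpow_le_rpow (abs_nonneg _) ?_ hγ0
    rw [le_inv_mul_iff₀ hn']
    linarith
  have h3 : foldedFejer n v u ≤ 8 * n * y ^ (-2 : ℝ) := by
    rw [Real.rpow_neg hy0.le, ← div_eq_mul_inv, le_div_iff₀ (by positivity), Real.rpow_two]
    linarith
  calc foldedFejer n v u * |u - v| ^ γ ≤ (8 * n * y ^ (-2 : ℝ)) * ((n : ℝ) ^ (-γ) * y ^ γ) :=
        mul_le_mul h3 h2 (by positivity) (by positivity)
    _ = 8 * (n : ℝ) ^ (1 - γ) * y ^ (γ - 2) := by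
      rw [sub_eq_add_neg 1 γ, Real.rpow_add hn', Real.rpow_one, sub_eq_add_neg γ, Real.rpow_add hy0]
      ring

/-- Uniform Hölder regularity gives a uniform rate for Fejér averages. -/
theorem exists_abs_integral_foldedFejer_sub_le_of_holder {F : ℝ → ℝ} {L : ℝ} (hγ0 : 0 ≤ γ) (hγ1 : γ < 1)
    (hL : 0 ≤ L) (hF : IntervalIntegrable F volume 0 Real.pi)
    (hH : ∀ u ∈ Set.Ioc 0 Real.pi, ∀ v ∈ Set.Ioc 0 Real.pi, |F u - F v| ≤ L * |u - v| ^ γ) :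
    ∃ C : ℝ, 0 ≤ C ∧ ∀ (n : ℕ) (v : ℝ), 0 < n → v ∈ Set.Ioc 0 Real.pi →
      Complex.exp (Complex.I * v) ^ n = 1 →
      |(∫ u in (0 : ℝ)..Real.pi, foldedFejer n v u * F u) - F v| ≤ C * (n : ℝ) ^ (-γ) := by
  set J := ∫ y : ℝ, (1 + |y|) ^ (γ - 2) with hJ
  have hJ0 : 0 ≤ J := integral_nonneg fun y => by positivity
  refine ⟨8 * L * J, by positivity, fun n v hn hv hnv => ?_⟩
  have hn' : (0 : ℝ) < n := by exact_mod_cast hn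
  refine (abs_integral_foldedFejer_mul_sub_le hF hn
    (B := fun u => L * (8 * (n : ℝ) ^ (1 - γ)) * (1 + n * |u - v|) ^ (γ - 2))
    ((intervalIntegrable_one_add_mul_abs_rpow n v _ _).const_mul _) fun u hu => ?_).trans ?_
  · calc foldedFejer n v u * |F u - F v| ≤ foldedFejer n v u * (L * |u - v| ^ γ) :=
          mul_le_mul_of_nonneg_left (hH u hu v hv) (foldedFejer_nonneg _ _ _)
      _ = L * (foldedFejer n v u * |u - v| ^ γ) := by ring
      _ ≤ L * (8 * (n : ℝ) ^ (1 - γ) * (1 + n * |u - v|) ^ (γ - 2)) := by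
          have := foldedFejer_mul_abs_rpow_le hγ0 hn hnv (Set.Ioc_subset_Icc_self hu)
            (Set.Ioc_subset_Icc_self hv)
          gcongr
      _ = _ := by ring
  · rw [intervalIntegral.integral_const_mul]
    calc _ ≤ L * (8 * (n : ℝ) ^ (1 - γ)) * ((n : ℝ)⁻¹ * J) := by
          have := integral_one_add_mul_abs_rpow_le hγ1 hn v
          gcongr
      _ = 8 * L * J * (n : ℝ) ^ (-γ) := by
          rw [sub_eq_add_neg 1 γ, Real.rpow_add hn', Real.rpow_one]
          field_simp

/-- Controls the points far from `v`, where the kernel is `O(1/(n max(u,v)²))`. The integral is cut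
at `v`: the part below converges because `p > -1`, and the part above is bounded independently of
the upper limit because `p < 1`. -/
theorem integral_rpow_add_div_max_sq_le {p v : ℝ} (hp : |p| < 1) (hv : v ∈ Set.Ioc 0 Real.pi) :
    IntervalIntegrable (fun u => (u ^ p + v ^ p) / (max u v) ^ 2) volume 0 Real.pi ∧
    ∫ u in (0 : ℝ)..Real.pi, (u ^ p + v ^ p) / (max u v) ^ 2 ≤
      (1 / (p + 1) + 1 / (1 - p) + 2) * v ^ (p - 1) := by
  obtain ⟨hp1, hp2⟩ := abs_lt.1 hp
  have hv0 := hv.1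
  set f : ℝ → ℝ := fun u => (u ^ p + v ^ p) / (max u v) ^ 2 with hf
  set g₁ : ℝ → ℝ := fun u => (v ^ 2)⁻¹ * (u ^ p + v ^ p) with hg₁
  set g₂ : ℝ → ℝ := fun u => u ^ (p - 2) + v ^ p * u ^ (-2 : ℝ) with hg₂
  have hnot : (0 : ℝ) ∉ Set.uIcc v Real.pi := by
    rw [Set.uIcc_of_le hv.2]; exact fun h => absurd h.1 (not_le.2 hv0)
  have i0 : IntervalIntegrable (fun u : ℝ => u ^ p) volume 0 v :=
    intervalIntegral.intervalIntegrable_rpow' hp1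
  have i1 : IntervalIntegrable g₁ volume 0 v := (i0.add (by simp)).const_mul _
  have j1 : IntervalIntegrable (fun u : ℝ => u ^ (p - 2)) volume v Real.pi :=
    intervalIntegral.intervalIntegrable_rpow (Or.inr hnot)
  have j2 : IntervalIntegrable (fun u : ℝ => u ^ (-2 : ℝ)) volume v Real.pi :=
    intervalIntegral.intervalIntegrable_rpow (Or.inr hnot)
  have i2 : IntervalIntegrable g₂ volume v Real.pi := j1.add (j2.const_mul _)
  have e1 : Set.EqOn g₁ f (Set.uIoc 0 v) := fun u hu => by
    rw [Set.uIoc_of_le hv0.le] at hu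
    simp only [hf, hg₁]
    rw [max_eq_right hu.2, div_eq_inv_mul]
  have e2 : Set.EqOn g₂ f (Set.uIoc v Real.pi) := fun u hu => by
    rw [Set.uIoc_of_le hv.2] at hu
    have hu0 : 0 < u := hv0.trans hu.1
    simp only [hf, hg₂]
    rw [max_eq_left hu.1.le, Real.rpow_sub hu0, Real.rpow_neg hu0.le, Real.rpow_two]
    ring
  have k1 : IntervalIntegrable f volume 0 v := i1.congr e1
  have k2 : IntervalIntegrable f volume v Real.pi := i2.congr e2
  refine ⟨k1.trans k2, ?_⟩
  rw [← intervalIntegral.integral_add_adjacent_intervals k1 k2]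
  have m1 : ∫ u in (0 : ℝ)..v, f u = (1 / (p + 1) + 1) * v ^ (p - 1) := by
    rw [← intervalIntegral.integral_congr_ae (Eventually.of_forall e1)]
    simp only [hg₁]
    rw [intervalIntegral.integral_const_mul, intervalIntegral.integral_add i0 (by simp),
      integral_rpow (Or.inl hp1), intervalIntegral.integral_const, smul_eq_mul, sub_zero,
      Real.zero_rpow (by linarith), Real.rpow_add_one hv0.ne', Real.rpow_sub_one hv0.ne']
    field_simp
    ring
  have m2 : ∫ u in v..Real.pi, f u ≤ (1 / (1 - p) + 1) * v ^ (p - 1) := by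
    rw [← intervalIntegral.integral_congr_ae (Eventually.of_forall e2)]
    simp only [hg₂]
    rw [intervalIntegral.integral_add j1 (j2.const_mul _), intervalIntegral.integral_const_mul,
      integral_rpow (Or.inr ⟨by linarith, hnot⟩), integral_rpow (Or.inr ⟨by norm_num, hnot⟩)]
    rw [show p - 2 + 1 = p - 1 by ring, show (-2 : ℝ) + 1 = -1 by norm_num]
    have q1 : (Real.pi ^ (p - 1) - v ^ (p - 1)) / (p - 1) ≤ 1 / (1 - p) * v ^ (p - 1) := by
      have := Real.rpow_nonneg Real.pi_pos.le (p - 1)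
      rw [← neg_div_neg_eq, neg_sub, neg_sub, one_div, ← div_eq_inv_mul]
      exact div_le_div_of_nonneg_right (by linarith) (by linarith)
    have q2 : v ^ p * ((Real.pi ^ (-1 : ℝ) - v ^ (-1 : ℝ)) / (-1)) ≤ v ^ (p - 1) := by
      have := Real.rpow_nonneg Real.pi_pos.le (-1)
      calc _ ≤ v ^ p * v ^ (-1 : ℝ) := by
            gcongr
            rw [div_neg, div_one]; linarith
        _ = v ^ (p - 1) := by rw [← Real.rpow_add hv0]; rfl
    linarith
  linarith

/-- Hölder regularity of `F` relative to the size `v ^ p`, on the scale of the distance of `v` to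
the origin, gives a relative rate for Fejér averages. -/
theorem exists_abs_integral_foldedFejer_sub_le {F : ℝ → ℝ} {p A L : ℝ} (hp : |p| < 1)
    (hγ0 : 0 ≤ γ) (hγ1 : γ < 1) (hL : 0 ≤ L) (hA : 0 ≤ A)
    (hF : IntervalIntegrable F volume 0 Real.pi) (hFA : ∀ u ∈ Set.Ioc 0 Real.pi, |F u| ≤ A * u ^ p)
    (hH : ∀ u ∈ Set.Ioc 0 Real.pi, ∀ v ∈ Set.Ioc 0 Real.pi, |u - v| ≤ v / 2 →
      |F u - F v| ≤ L * v ^ (p - γ) * |u - v| ^ γ) :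
    ∃ C : ℝ, 0 ≤ C ∧ ∀ (n : ℕ) (v : ℝ), 0 < n → v ∈ Set.Ioc 0 Real.pi →
      Complex.exp (Complex.I * v) ^ n = 1 → 1 ≤ n * v →
      |(∫ u in (0 : ℝ)..Real.pi, foldedFejer n v u * F u) - F v| ≤ C * v ^ p * (n * v) ^ (-γ) := by
  obtain ⟨hp1, hp2⟩ := abs_lt.1 hp
  set J := ∫ y : ℝ, (1 + |y|) ^ (γ - 2) with hJ
  have hJ0 : 0 ≤ J := integral_nonneg fun y => by positivity
  set M := 1 / (p + 1) + 1 / (1 - p) + 2 with hM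
  have hM0 : 0 ≤ M := by
    have : 0 < 1 / (p + 1) := by apply one_div_pos.2; linarith
    have : 0 < 1 / (1 - p) := by apply one_div_pos.2; linarith
    linarith
  refine ⟨8 * L * J + 72 * A * M, by positivity, fun n v hn hv hnv h1 => ?_⟩
  have hn' : (0 : ℝ) < n := by exact_mod_cast hn
  have hv0 := hv.1
  obtain ⟨hi, hle⟩ := integral_rpow_add_div_max_sq_le hp hv
  set a := L * v ^ (p - γ) * (8 * (n : ℝ) ^ (1 - γ)) with ha
  set b := 72 * A / n with hb
  have ha0 : 0 ≤ a := by positivity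
  have hb0 : 0 ≤ b := by positivity
  have i1 : IntervalIntegrable (fun u => a * (1 + n * |u - v|) ^ (γ - 2)) volume 0 Real.pi :=
    (intervalIntegrable_one_add_mul_abs_rpow n v _ _).const_mul _
  have i2 : IntervalIntegrable (fun u => b * ((u ^ p + v ^ p) / (max u v) ^ 2)) volume 0 Real.pi :=
    hi.const_mul _
  refine (abs_integral_foldedFejer_mul_sub_le hF hn (B := fun u =>
    a * (1 + n * |u - v|) ^ (γ - 2) + b * ((u ^ p + v ^ p) / (max u v) ^ 2))
    (i1.add i2) fun u hu => ?_).trans ?_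
  · have hu0 := hu.1
    have hK := foldedFejer_nonneg n v u
    -- Near `v` the local Hölder bound applies. Far from `v` only the sizes of `F u` and `F v` are
    -- used, against the quadratic decay of the kernel. The majorant is the sum of the two
    -- estimates.
    rcases le_or_gt |u - v| (v / 2) with hnear | hfar
    · have : 0 ≤ b * ((u ^ p + v ^ p) / (max u v) ^ 2) := by positivity
      refine le_trans ?_ (le_add_of_nonneg_right this)
      calc foldedFejer n v u * |F u - F v| ≤ foldedFejer n v u * (L * v ^ (p - γ) * |u - v| ^ γ) := by
            gcongr
            exact hH u hu v hv hnear
        _ = L * v ^ (p - γ) * (foldedFejer n v u * |u - v| ^ γ) := by ring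
        _ ≤ L * v ^ (p - γ) * (8 * (n : ℝ) ^ (1 - γ) * (1 + n * |u - v|) ^ (γ - 2)) := by
            have := foldedFejer_mul_abs_rpow_le hγ0 hn hnv (Set.Ioc_subset_Icc_self hu)
              (Set.Ioc_subset_Icc_self hv)
            gcongr
        _ = _ := by rw [ha]; ring
    · have : 0 ≤ a * (1 + n * |u - v|) ^ (γ - 2) := by positivity
      refine le_trans ?_ (le_add_of_nonneg_left this)
      -- In the far region `v < 2|u - v|`, hence `u ≤ v + |u - v| ≤ 3|u - v|`. The constant `72`
      -- below is `3² · 8`.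
      have hmax : max u v ≤ 3 * |u - v| := by
        refine max_le ?_ (by linarith)
        have := le_abs_self (u - v)
        linarith
      have hmax0 : 0 < max u v := lt_max_of_lt_left hu0
      have hK' : foldedFejer n v u ≤ 72 / (n * (max u v) ^ 2) := by
        rw [le_div_iff₀ (by positivity)]
        have h2 := foldedFejer_le hn hnv (Set.Ioc_subset_Icc_self hu) (Set.Ioc_subset_Icc_self hv)
        have h3 : n ^ 2 * (max u v) ^ 2 ≤ 9 * (1 + n * |u - v|) ^ 2 := by
          have : n * max u v ≤ 3 * (1 + n * |u - v|) := by nlinarith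
          have := pow_le_pow_left₀ (by positivity) this 2
          nlinarith
        have h4 : foldedFejer n v u * (n ^ 2 * (max u v) ^ 2) ≤ 9 * (8 * n) := by
          calc _ ≤ foldedFejer n v u * (9 * (1 + n * |u - v|) ^ 2) := by gcongr
            _ = 9 * ((1 + n * |u - v|) ^ 2 * foldedFejer n v u) := by ring
            _ ≤ _ := by gcongr
        have h5 : n * (foldedFejer n v u * (n * (max u v) ^ 2)) ≤ n * 72 := by linarith
        exact le_of_mul_le_mul_left h5 hn'
      have hFF : |F u - F v| ≤ A * (u ^ p + v ^ p) := by
        refine (abs_sub _ _).trans ?_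
        rw [mul_add]
        exact add_le_add (hFA u hu) (hFA v hv)
      calc _ ≤ 72 / (n * (max u v) ^ 2) * (A * (u ^ p + v ^ p)) :=
            mul_le_mul hK' hFF (abs_nonneg _) (by positivity)
        _ = _ := by rw [hb]; field_simp
  · rw [intervalIntegral.integral_add i1 i2, intervalIntegral.integral_const_mul,
      intervalIntegral.integral_const_mul, add_mul, add_mul]
    refine add_le_add ?_ ?_
    · calc _ ≤ a * ((n : ℝ)⁻¹ * J) := by
            gcongr
            exact integral_one_add_mul_abs_rpow_le hγ1 hn v
        _ = 8 * L * J * v ^ p * (n * v) ^ (-γ) := by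
            rw [ha, Real.mul_rpow hn'.le hv0.le, sub_eq_add_neg 1 γ, Real.rpow_add hn',
              Real.rpow_one, sub_eq_add_neg p γ, Real.rpow_add hv0]
            field_simp
    · calc _ ≤ b * (M * v ^ (p - 1)) := by gcongr
        _ = 72 * A * M * v ^ p * (n * v) ^ (-1 : ℝ) := by
            rw [hb, Real.rpow_neg_one, Real.rpow_sub_one hv0.ne']
            field_simp
        -- The far region contributes the better rate `(nv)^{-1}`, weakened here using `nv ≥ 1` and
        -- `γ < 1`.
        _ ≤ 72 * A * M * v ^ p * (n * v) ^ (-γ) := by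
            gcongr

/-- Functions with `|F'(u)| ≤ K u^{p-1}` are Hölder regular relative to `v ^ p`. -/
theorem exists_abs_sub_le_of_hasDerivWithinAt {F : ℝ → ℝ} {p K : ℝ} (hγ1 : γ ≤ 1)
    (hF : ∀ u ∈ Set.Ioc 0 Real.pi, ∃ D : ℝ, HasDerivWithinAt F D (Set.Ioc 0 Real.pi) u ∧
      |D| ≤ K * u ^ (p - 1)) :
    ∃ L : ℝ, 0 ≤ L ∧ ∀ u ∈ Set.Ioc 0 Real.pi, ∀ v ∈ Set.Ioc 0 Real.pi, |u - v| ≤ v / 2 →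
      |F u - F v| ≤ L * v ^ (p - γ) * |u - v| ^ γ := by
  have hF' : ∀ u : ℝ, ∃ D : ℝ, u ∈ Set.Ioc 0 Real.pi →
      HasDerivWithinAt F D (Set.Ioc 0 Real.pi) u ∧ |D| ≤ K * u ^ (p - 1) := fun u => by
    by_cases hu : u ∈ Set.Ioc 0 Real.pi
    · obtain ⟨D, hD⟩ := hF u hu
      exact ⟨D, fun _ => hD⟩
    · exact ⟨0, fun h => absurd h hu⟩
  choose D hD using hF'
  have hK : 0 ≤ K := by
    have h := (hD Real.pi ⟨Real.pi_pos, le_rfl⟩).2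
    have := Real.rpow_pos_of_pos Real.pi_pos (p - 1)
    exact nonneg_of_mul_nonneg_left ((abs_nonneg _).trans h) this
  refine ⟨K * 2 ^ |p - 1|, by positivity, fun u hu v hv huv => ?_⟩
  have hv0 := hv.1
  obtain ⟨huv1, huv2⟩ := abs_le.1 huv
  rcases eq_or_ne u v with rfl | hne
  · rw [sub_self, abs_zero]; positivity
  have hpos : 0 < |u - v| := abs_pos.2 (sub_ne_zero.2 hne)
  have hsub : Set.uIcc v u ⊆ Set.Ioc 0 Real.pi := fun x hx => by
    obtain ⟨h1, h2⟩ := hx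
    exact ⟨lt_of_lt_of_le (lt_min hv.1 hu.1) h1, h2.trans (max_le hv.2 hu.2)⟩
  have h1 : ‖F u - F v‖ ≤ K * 2 ^ |p - 1| * v ^ (p - 1) * ‖u - v‖ := by
    refine (convex_uIcc v u).norm_image_sub_le_of_norm_hasDerivWithin_le
      (f' := D) (fun x hx => ((hD x (hsub hx)).1).mono hsub) (fun x hx => ?_)
      Set.left_mem_uIcc Set.right_mem_uIcc
    refine (hD x (hsub hx)).2.trans ?_
    rw [mul_assoc]
    refine mul_le_mul_of_nonneg_left ?_ hK
    -- Points between `u` and `v` lie in `[v/2, 3v/2]`, so their powers are comparable to those of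
    -- `v` with ratio `2`.
    have hx' := Set.abs_sub_left_of_mem_uIcc hx
    obtain ⟨hx1, hx2⟩ := abs_le.1 (hx'.trans huv)
    exact Real.rpow_le_rpow_abs_mul (hsub hx).1 hv0 (by linarith) (by linarith) _
  rw [Real.norm_eq_abs, Real.norm_eq_abs] at h1
  refine h1.trans ?_
  rw [mul_assoc (K * _), mul_assoc (K * _)]
  refine mul_le_mul_of_nonneg_left ?_ (by positivity)
  -- The mean value bound is Lipschitz; the surplus `|u - v|^{1-γ}` is absorbed into `v^{1-γ}`.
  calc v ^ (p - 1) * |u - v| = v ^ (p - 1) * (|u - v| ^ γ * |u - v| ^ (1 - γ)) := by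
        rw [← Real.rpow_add hpos]; simp
    _ ≤ v ^ (p - 1) * (|u - v| ^ γ * v ^ (1 - γ)) := by
        gcongr
        linarith
    _ = v ^ (p - γ) * |u - v| ^ γ := by
        rw [show p - γ = (p - 1) + (1 - γ) by ring, Real.rpow_add hv0]; ring

theorem exists_abs_rpow_sub_rpow_le (p : ℝ) (hγ1 : γ ≤ 1) :
    ∃ L : ℝ, 0 ≤ L ∧ ∀ u ∈ Set.Ioc 0 Real.pi, ∀ v ∈ Set.Ioc 0 Real.pi, |u - v| ≤ v / 2 →
      |u ^ p - v ^ p| ≤ L * v ^ (p - γ) * |u - v| ^ γ := by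
  refine exists_abs_sub_le_of_hasDerivWithinAt (F := fun u => u ^ p) (K := |p|) hγ1
    fun u hu => ⟨p * u ^ (p - 1), ?_, ?_⟩
  · exact (Real.hasDerivAt_rpow_const (Or.inl hu.1.ne')).hasDerivWithinAt
  · rw [abs_mul, abs_of_nonneg (Real.rpow_nonneg hu.1.le _)]

end FejerApproximation

/-! ### Evenness of the spectral density and covariances as cosine coefficients -/

noncomputable section SpectralSymmetry

/-- A continuous function on the circle with summable Fourier coefficients is the pointwise sum of
its Fourier series; here all coefficients vanish. -/
theorem eq_zero_of_forall_integral_exp_mul_eq_zero {F : ℝ → ℂ}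
    (hF : ContinuousOn F (Set.Icc (-Real.pi) Real.pi)) (hper : F (-Real.pi) = F Real.pi)
    (h0 : ∀ k : ℤ, ∫ v in (-Real.pi)..Real.pi, Complex.exp (Complex.I * k * v) * F v = 0)
    {v : ℝ} (hv : v ∈ Set.Ico (-Real.pi) Real.pi) : F v = 0 := by
  have hpi := Real.pi_pos
  have : Fact (0 < 2 * Real.pi) := ⟨by positivity⟩
  have hb : -Real.pi + 2 * Real.pi = Real.pi := by ring
  have hcont : Continuous (AddCircle.liftIco (2 * Real.pi) (-Real.pi) F) :=
    AddCircle.liftIco_continuous (by rw [hb]; exact hper) (by rwa [hb])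
  set G : C(AddCircle (2 * Real.pi), ℂ) := ⟨_, hcont⟩ with hG
  have hcoef : ∀ k, fourierCoeff G k = 0 := fun k => by
    rw [hG, ContinuousMap.coe_mk, fourierCoeff_liftIco_eq, fourierCoeffOn_eq_integral]
    have : ∀ x : ℝ, fourier (-k) (x : AddCircle (-Real.pi + 2 * Real.pi - -Real.pi)) • F x =
        Complex.exp (Complex.I * ((-k : ℤ) : ℂ) * x) * F x := fun x => by
      rw [fourier_coe_apply, smul_eq_mul]
      congr 2
      have : (Real.pi : ℂ) ≠ 0 := by exact_mod_cast hpi.ne'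
      push_cast
      field_simp
      ring
    simp_rw [this]
    rw [hb, h0, smul_zero]
  have hs := has_pointwise_sum_fourier_series_of_summable (f := G)
    ((summable_zero (α := ℂ)).congr fun k => (hcoef k).symm) (v : AddCircle (2 * Real.pi))
  simp only [hcoef, zero_smul] at hs
  have h1 := hs.unique hasSum_zero
  rw [hG, ContinuousMap.coe_mk, AddCircle.liftIco_coe_apply (by rwa [hb])] at h1
  exact h1

variable {Ω : Type*} [MeasurableSpace Ω] {P : Measure Ω} {X : ℤ → Ω → ℝ} {f g : ℝ → ℝ} {d : ℝ}

theorem intervalIntegrable_exp_mul {F : ℝ → ℝ} {a b : ℝ} (hF : IntervalIntegrable F volume a b)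
    (k : ℤ) : IntervalIntegrable (fun v => Complex.exp (Complex.I * k * v) * (F v : ℂ)) volume a b :=
  IntervalIntegrable.continuousOn_mul ⟨hF.1.ofReal, hF.2.ofReal⟩ (by fun_prop)

/-- Reflection conjugates the exponential, and the integral, being a covariance of real variables,
equals its own conjugate. -/
theorem IsSpectralDensity.integral_exp_mul_neg (hf : IsSpectralDensity P X f) (k : ℤ) :
    ∫ v in (-Real.pi)..Real.pi, Complex.exp (Complex.I * k * v) * (f (-v) : ℂ) =
      ∫ v in (-Real.pi)..Real.pi, Complex.exp (Complex.I * k * v) * (f v : ℂ) := by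
  have h1 := intervalIntegral.integral_comp_neg (a := -Real.pi) (b := Real.pi)
    (fun v : ℝ => Complex.exp (Complex.I * k * (-v : ℝ)) * (f v : ℂ))
  simp only [neg_neg] at h1
  rw [h1, ← hf.cov_eq 0 k]
  have h2 := congrArg (starRingEnd ℂ) (hf.cov_eq 0 k)
  rw [Complex.conj_ofReal] at h2
  rw [h2, intervalIntegral, intervalIntegral, map_sub, ← integral_conj, ← integral_conj,
    ← intervalIntegral]
  refine intervalIntegral.integral_congr fun v _ => ?_
  simp only [map_mul, Complex.conj_ofReal, ← Complex.exp_conj, Complex.conj_I, Complex.ofReal_neg]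
  congr 2
  simp

theorem IsSpectralDensity.integral_exp_mul_odd_part (hf : IsSpectralDensity P X f) (k : ℤ) :
    ∫ v in (-Real.pi)..Real.pi, Complex.exp (Complex.I * k * v) * ((f v - f (-v) : ℝ) : ℂ) = 0 := by
  have hneg : IntervalIntegrable (fun v => f (-v)) volume (-Real.pi) Real.pi := by
    simpa [div_neg] using (hf.integrable.comp_mul_left (c := -1)).symm
  push_cast
  simp only [mul_sub]
  rw [intervalIntegral.integral_sub (intervalIntegrable_exp_mul hf.integrable k)
    (intervalIntegrable_exp_mul hneg k), hf.integral_exp_mul_neg, sub_self]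

/-- The spectral density of a real process is even. -/
theorem IsSpectralDensity.even (hf : IsSpectralDensity P X f) (hfg : HasMemoryForm f d g)
    {v : ℝ} (hv : v ∈ Set.Ioo 0 Real.pi) : f (-v) = f v := by
  have hpi := Real.pi_pos
  have hd := abs_lt.1 hfg.abs_d_lt
  -- The odd part of `f` may be singular at `0` and need not be periodic. Multiplied by `sin² v` it
  -- becomes continuous at `0` and vanishes at `±π`. Writing the product through `sinc` gives a
  -- formula valid at `0` as well.
  set H : ℝ → ℝ := fun v => |v| ^ (2 - 2 * d) * Real.sinc v ^ 2 * (g v - g (-v)) with hH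
  have hmaps : Set.MapsTo (fun v : ℝ => -v) (Set.Icc (-Real.pi) Real.pi)
      (Set.Icc (-Real.pi) Real.pi) := fun v hv => ⟨by linarith [hv.2], by linarith [hv.1]⟩
  have hHc : ContinuousOn H (Set.Icc (-Real.pi) Real.pi) := by
    refine ContinuousOn.mul (Continuous.continuousOn ?_)
      (hfg.continuousOn.sub (hfg.continuousOn.comp (by fun_prop) hmaps))
    exact (Continuous.rpow_const (by fun_prop) fun v => Or.inr (by linarith)).mul
      (Real.continuous_sinc.pow 2)
  have hHeq : ∀ v ∈ Set.Icc (-Real.pi) Real.pi, v ≠ 0 →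
      H v = (f v - f (-v)) * Real.sin v ^ 2 := fun v hv hv0 => by
    rw [hfg.eq v hv hv0, hfg.eq (-v) (hmaps hv) (neg_ne_zero.2 hv0), abs_neg, hH]
    simp only
    rw [Real.sinc_of_ne_zero hv0, show 2 - 2 * d = 2 + -2 * d by ring,
      Real.rpow_add (abs_pos.2 hv0), Real.rpow_two, sq_abs]
    field_simp
  have hzero := eq_zero_of_forall_integral_exp_mul_eq_zero (F := fun v => (H v : ℂ))
    (Complex.continuous_ofReal.comp_continuousOn hHc) ?_ (fun k => ?_)
    (v := v) ⟨by linarith [hv.1], hv.2⟩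
  · have h1 : H v = 0 := by exact_mod_cast hzero
    rw [hHeq v ⟨by linarith [hv.1], hv.2.le⟩ hv.1.ne'] at h1
    have h2 : Real.sin v ^ 2 ≠ 0 := pow_ne_zero _ (Real.sin_pos_of_mem_Ioo hv).ne'
    have := (mul_eq_zero.1 h1).resolve_right h2
    linarith
  · simp only [hH, Real.sinc_of_ne_zero hpi.ne', Real.sinc_neg, Real.sin_pi]
    simp
  · have hodd : IntervalIntegrable (fun v => f v - f (-v)) volume (-Real.pi) Real.pi := by
      refine hf.integrable.sub ?_
      simpa [div_neg] using (hf.integrable.comp_mul_left (c := -1)).symm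
    -- As `sin² v = 1/2 - (e^{2iv} + e^{-2iv})/4`, the `k`-th coefficient of `H` combines those of
    -- the odd part at `k` and `k ± 2`, all of which vanish.
    have e : ∀ᵐ v : ℝ, v ∈ Set.uIoc (-Real.pi) Real.pi →
        Complex.exp (Complex.I * k * v) * (H v : ℂ) =
        (1 / 2 : ℂ) * (Complex.exp (Complex.I * k * v) * ((f v - f (-v) : ℝ) : ℂ))
        - ((1 / 4 : ℂ) * (Complex.exp (Complex.I * (k + 2 : ℤ) * v) * ((f v - f (-v) : ℝ) : ℂ))
        + (1 / 4 : ℂ) * (Complex.exp (Complex.I * (k - 2 : ℤ) * v) * ((f v - f (-v) : ℝ) : ℂ))) := by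
      filter_upwards [Measure.ae_ne volume (0 : ℝ)] with v hv0 hv
      rw [Set.uIoc_of_le (by linarith)] at hv
      rw [hHeq v (Set.Ioc_subset_Icc_self hv) hv0]
      have e1 : Complex.exp (Complex.I * (k + 2 : ℤ) * v) =
          Complex.exp (Complex.I * k * v) * Complex.exp (v * Complex.I) ^ 2 := by
        rw [← Complex.exp_nat_mul, ← Complex.exp_add]; congr 1; push_cast; ring
      have e2 : Complex.exp (Complex.I * (k - 2 : ℤ) * v) =
          Complex.exp (Complex.I * k * v) * Complex.exp (-v * Complex.I) ^ 2 := by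
        rw [← Complex.exp_nat_mul, ← Complex.exp_add]; congr 1; push_cast; ring
      have e3 : Complex.exp (v * Complex.I) * Complex.exp (-v * Complex.I) = 1 := by
        rw [← Complex.exp_add]; simp
      rw [e1, e2]
      push_cast
      rw [Complex.sin, mul_div_assoc]
      linear_combination (Complex.exp (Complex.I * k * v) * ((f v : ℂ) - f (-v))) *
        ((Complex.exp (-v * Complex.I) - Complex.exp (v * Complex.I)) ^ 2 / 4 * Complex.I_sq
          + 1 / 2 * e3)
    rw [intervalIntegral.integral_congr_ae e, intervalIntegral.integral_sub,
      intervalIntegral.integral_add, intervalIntegral.integral_const_mul,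
      intervalIntegral.integral_const_mul, intervalIntegral.integral_const_mul,
      hf.integral_exp_mul_odd_part, hf.integral_exp_mul_odd_part, hf.integral_exp_mul_odd_part]
    · simp
    · exact (intervalIntegrable_exp_mul hodd _).const_mul _
    · exact (intervalIntegrable_exp_mul hodd _).const_mul _
    · exact (intervalIntegrable_exp_mul hodd _).const_mul _
    · exact ((intervalIntegrable_exp_mul hodd _).const_mul _).add
        ((intervalIntegrable_exp_mul hodd _).const_mul _)

theorem IsSpectralDensity.intervalIntegrable_zero_pi (hf : IsSpectralDensity P X f) :
    IntervalIntegrable f volume 0 Real.pi := by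
  have hpi := Real.pi_pos
  refine hf.integrable.mono_set ?_
  rw [Set.uIcc_of_le hpi.le, Set.uIcc_of_le (by linarith)]
  exact Set.Icc_subset_Icc_left (by linarith)

/-- Evenness folds the integral onto `[0, π]`; from here on only the values of `f` on that interval
matter. -/
theorem IsSpectralDensity.covariance_eq_cosCoeff (hf : IsSpectralDensity P X f)
    (hfg : HasMemoryForm f d g) (t s : ℤ) :
    covariance (X t) (X s) P = cosCoeff f (t - s) := by
  have hpi := Real.pi_pos
  set k := t - s with hk
  have h1 := congrArg Complex.re (hf.cov_eq s k)
  rw [show s + k = t by rw [hk]; ring, Complex.ofReal_re] at h1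
  have i1 := hf.intervalIntegrable_zero_pi
  have i2 : IntervalIntegrable f volume (-Real.pi) 0 := by
    refine hf.integrable.mono_set ?_
    rw [Set.uIcc_of_le (by linarith), Set.uIcc_of_le (by linarith)]
    exact Set.Icc_subset_Icc_right hpi.le
  have h2 : (∫ v in (-Real.pi)..Real.pi, Complex.exp (Complex.I * k * v) * (f v : ℂ)).re =
      ∫ v in (-Real.pi)..Real.pi, Real.cos (k * v) * f v := by
    have := Complex.reCLM.intervalIntegral_comp_comm (intervalIntegrable_exp_mul hf.integrable k)
    simp only [Complex.reCLM_apply] at this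
    rw [← this]
    refine intervalIntegral.integral_congr fun v _ => ?_
    have e : Complex.I * k * v = ((k * v : ℝ) : ℂ) * Complex.I := by push_cast; ring
    simp only [Complex.re_mul_ofReal, e, Complex.exp_ofReal_mul_I_re]
  have h3 : ∫ v in (-Real.pi)..0, Real.cos (k * v) * f v =
      ∫ v in (0 : ℝ)..Real.pi, Real.cos (k * v) * f v := by
    have h4 := intervalIntegral.integral_comp_neg (a := 0) (b := Real.pi)
      (fun v : ℝ => Real.cos (k * v) * f v)
    rw [neg_zero] at h4
    rw [← h4]
    refine intervalIntegral.integral_congr_Ioo_of_le hpi.le fun v hv => ?_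
    simp only [mul_neg, Real.cos_neg, hf.even hfg hv]
  rw [h1, h2, ← intervalIntegral.integral_add_adjacent_intervals (i2.cos_mul k) (i1.cos_mul k), h3,
    cosCoeff, two_mul]

end SpectralSymmetry

/-! ### Monotonicity of the Frobenius norm -/

section Frobenius

open scoped MatrixOrder in
-- If `M = C* C`, the trace equals that of `C N C*`, which is positive semidefinite.
theorem Matrix.PosSemidef.trace_mul_nonneg_real {R : Type*} [Fintype R] {M N : Matrix R R ℝ}
    (hM : M.PosSemidef) (hN : N.PosSemidef) : 0 ≤ (M * N).trace := by
  classical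
  obtain ⟨C, rfl⟩ := CStarAlgebra.nonneg_iff_eq_star_mul_self.1 hM.nonneg
  rw [Matrix.mul_assoc, Matrix.trace_mul_comm]
  exact (hN.mul_mul_conjTranspose_same C).trace_nonneg

/-- The Frobenius norm is monotone on positive semidefinite matrices. -/
theorem Matrix.PosSemidef.sum_sq_le_sum_sq {R : Type*} [Fintype R] {A B : Matrix R R ℝ}
    (hA : A.PosSemidef) (hAB : (B - A).PosSemidef) :
    ∑ r, ∑ s, A r s ^ 2 ≤ ∑ r, ∑ s, B r s ^ 2 := by
  have hB : B.PosSemidef := by simpa using hAB.add hA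
  have htr : ∀ {M : Matrix R R ℝ}, M.PosSemidef → (M * M).trace = ∑ r, ∑ s, M r s ^ 2 :=
    fun {M} hM => by
      simp only [Matrix.trace, Matrix.diag, Matrix.mul_apply]
      refine Finset.sum_congr rfl fun r _ => Finset.sum_congr rfl fun s _ => ?_
      rw [show M s r = M r s by simpa using hM.1.apply r s, pow_two]
  -- The trace of `(B - A)(B + A)` is `tr B² - tr A²`, since `tr AB = tr BA`.
  have h := hAB.trace_mul_nonneg_real (hB.add hA)
  rw [sub_mul, mul_add, mul_add, Matrix.trace_sub, Matrix.trace_add, Matrix.trace_add,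
    Matrix.trace_mul_comm A B, htr hA, htr hB] at h
  linarith

end Frobenius

/-! ### Comparison of Toeplitz forms for ordered densities -/

noncomputable section ToeplitzComparison

theorem toeplitzForm_comm {c : ℤ → ℝ} (hc : ∀ k, c (-k) = c k) (n : ℕ) (x y : ℕ → ℝ) :
    toeplitzForm c n x y = toeplitzForm c n y x := by
  rw [toeplitzForm, Finset.sum_comm, toeplitzForm]
  refine Finset.sum_congr rfl fun t _ => Finset.sum_congr rfl fun s _ => ?_
  rw [← hc, neg_sub]
  ring

theorem toeplitzForm_sum_left {R : Type*} [Fintype R] (c : ℤ → ℝ) (n : ℕ) (x : R → ℕ → ℝ)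
    (y : ℕ → ℝ) :
    toeplitzForm c n (fun t => ∑ r, x r t) y = ∑ r, toeplitzForm c n (x r) y := by
  simp only [toeplitzForm, Finset.sum_mul]
  rw [Finset.sum_congr rfl fun t _ => Finset.sum_comm, Finset.sum_comm]

theorem toeplitzForm_sum_right {R : Type*} [Fintype R] (c : ℤ → ℝ) (n : ℕ) (x : ℕ → ℝ)
    (y : R → ℕ → ℝ) :
    toeplitzForm c n x (fun t => ∑ r, y r t) = ∑ r, toeplitzForm c n x (y r) := by
  simp only [toeplitzForm, Finset.mul_sum, Finset.sum_mul]
  rw [Finset.sum_congr rfl fun t _ => Finset.sum_comm, Finset.sum_comm]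

theorem toeplitzForm_smul (c : ℤ → ℝ) (n : ℕ) (a b : ℝ) (x y : ℕ → ℝ) :
    toeplitzForm c n (fun t => a * x t) (fun t => b * y t) = a * b * toeplitzForm c n x y := by
  simp only [toeplitzForm, Finset.mul_sum]
  refine Finset.sum_congr rfl fun t _ => Finset.sum_congr rfl fun s _ => by ring

/-- The integrand is `|∑ x_t e^{itu}|² f(u)`, so an inequality between densities becomes an
inequality between quadratic forms. -/
theorem toeplitzForm_cosCoeff_self {f : ℝ → ℝ} (hf : IntervalIntegrable f volume 0 Real.pi)
    (n : ℕ) (x : ℕ → ℝ) : toeplitzForm (cosCoeff f) n x x =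
      2 * ∫ u in (0 : ℝ)..Real.pi, ((∑ t ∈ Finset.Icc 1 n, x t * Real.cos (t * u)) ^ 2 +
        (∑ t ∈ Finset.Icc 1 n, x t * Real.sin (t * u)) ^ 2) * f u := by
  have e1 : toeplitzForm (cosCoeff f) n x x =
      2 * ∑ t ∈ Finset.Icc 1 n, ∑ s ∈ Finset.Icc 1 n, ∫ u in (0 : ℝ)..Real.pi,
        x t * x s * (Real.cos (((t : ℝ) - s) * u) * f u) := by
    simp only [toeplitzForm, Finset.mul_sum]
    refine Finset.sum_congr rfl fun t _ => Finset.sum_congr rfl fun s _ => ?_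
    rw [intervalIntegral.integral_const_mul]
    simp only [cosCoeff]
    push_cast
    ring
  have hint : ∀ t s : ℕ, IntervalIntegrable (fun u => x t * x s *
      (Real.cos (((t : ℝ) - s) * u) * f u)) volume 0 Real.pi := fun t s =>
    (hf.cos_mul _).const_mul _
  have e2 : ∀ t ∈ Finset.Icc 1 n, ∑ s ∈ Finset.Icc 1 n, ∫ u in (0 : ℝ)..Real.pi,
        x t * x s * (Real.cos (((t : ℝ) - s) * u) * f u) =
      ∫ u in (0 : ℝ)..Real.pi, ∑ s ∈ Finset.Icc 1 n,
        x t * x s * (Real.cos (((t : ℝ) - s) * u) * f u) := fun t _ =>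
    (intervalIntegral.integral_finsetSum fun s _ => hint t s).symm
  rw [e1, Finset.sum_congr rfl e2, ← intervalIntegral.integral_finsetSum fun t _ =>
    (by simpa only [Finset.sum_fn] using IntervalIntegrable.sum _ fun s _ => hint t s)]
  congr 1
  refine intervalIntegral.integral_congr fun u _ => ?_
  rw [pow_two, pow_two, Finset.sum_mul_sum, Finset.sum_mul_sum, ← Finset.sum_add_distrib,
    Finset.sum_mul]
  refine Finset.sum_congr rfl fun t _ => ?_
  rw [← Finset.sum_add_distrib, Finset.sum_mul]
  refine Finset.sum_congr rfl fun s _ => ?_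
  rw [sub_mul, Real.cos_sub]
  ring

theorem toeplitzForm_cosCoeff_self_le {f h : ℝ → ℝ} (hf : IntervalIntegrable f volume 0 Real.pi)
    (hh : IntervalIntegrable h volume 0 Real.pi) (hfh : ∀ u ∈ Set.Ioo 0 Real.pi, f u ≤ h u)
    (n : ℕ) (x : ℕ → ℝ) :
    toeplitzForm (cosCoeff f) n x x ≤ toeplitzForm (cosCoeff h) n x x := by
  have hc : Continuous fun u : ℝ => (∑ t ∈ Finset.Icc 1 n, x t * Real.cos (t * u)) ^ 2 +
        (∑ t ∈ Finset.Icc 1 n, x t * Real.sin (t * u)) ^ 2 := by fun_prop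
  rw [toeplitzForm_cosCoeff_self hf, toeplitzForm_cosCoeff_self hh]
  refine mul_le_mul_of_nonneg_left ?_ zero_le_two
  refine intervalIntegral.integral_mono_on_of_le_Ioo Real.pi_pos.le
    (hf.continuousOn_mul hc.continuousOn) (hh.continuousOn_mul hc.continuousOn) fun u hu => ?_
  exact mul_le_mul_of_nonneg_left (hfh u hu) (by positivity)

theorem toeplitzForm_cosCoeff_self_nonneg {f : ℝ → ℝ} (hf : IntervalIntegrable f volume 0 Real.pi)
    (hf0 : ∀ u ∈ Set.Ioo 0 Real.pi, 0 ≤ f u) (n : ℕ) (x : ℕ → ℝ) :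
    0 ≤ toeplitzForm (cosCoeff f) n x x := by
  have := toeplitzForm_cosCoeff_self_le (f := fun _ => 0) (by simp) hf hf0 n x
  refine le_trans (le_of_eq ?_) this
  simp [toeplitzForm, cosCoeff]

/-- Positivity of the quadratic form at `x + y` and `x - y`. -/
theorem abs_toeplitzForm_le {f : ℝ → ℝ} (hf : IntervalIntegrable f volume 0 Real.pi)
    (hf0 : ∀ u ∈ Set.Ioo 0 Real.pi, 0 ≤ f u) (n : ℕ) (x y : ℕ → ℝ) :
    2 * |toeplitzForm (cosCoeff f) n x y| ≤
      toeplitzForm (cosCoeff f) n x x + toeplitzForm (cosCoeff f) n y y := by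
  have hcomm := toeplitzForm_comm (cosCoeff_neg f) n y x
  have key : ∀ ε : ℝ, ε ^ 2 = 1 → 0 ≤ toeplitzForm (cosCoeff f) n x x +
      2 * ε * toeplitzForm (cosCoeff f) n x y + toeplitzForm (cosCoeff f) n y y := fun ε hε => by
    have h := toeplitzForm_cosCoeff_self_nonneg hf hf0 n (fun t => x t + ε * y t)
    refine h.trans_eq ?_
    calc _ = toeplitzForm (cosCoeff f) n x x + ε * toeplitzForm (cosCoeff f) n x y +
          ε * toeplitzForm (cosCoeff f) n y x + ε ^ 2 * toeplitzForm (cosCoeff f) n y y := by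
          simp only [toeplitzForm, Finset.mul_sum, ← Finset.sum_add_distrib]
          refine Finset.sum_congr rfl fun t _ => Finset.sum_congr rfl fun s _ => by ring
      _ = _ := by rw [hcomm, hε]; ring
  have h1 := key 1 (by norm_num)
  have h2 := key (-1) (by norm_num)
  rcases abs_cases (toeplitzForm (cosCoeff f) n x y) with ⟨e, -⟩ | ⟨e, -⟩ <;> rw [e] <;> linarith

/-- Domination of spectral densities is inherited by weighted Frobenius norms of Gram matrices. -/
theorem sum_mul_toeplitzForm_sq_le {f h : ℝ → ℝ} (hf : IntervalIntegrable f volume 0 Real.pi)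
    (hh : IntervalIntegrable h volume 0 Real.pi) (hf0 : ∀ u ∈ Set.Ioo 0 Real.pi, 0 ≤ f u)
    (hfh : ∀ u ∈ Set.Ioo 0 Real.pi, f u ≤ h u)
    (n : ℕ) {R : Type*} [Fintype R] (β : R → ℝ) (x : R → ℕ → ℝ) :
    ∑ r, ∑ s, β r * β s * toeplitzForm (cosCoeff f) n (x r) (x s) ^ 2 ≤
      ∑ r, ∑ s, |β r| * |β s| * toeplitzForm (cosCoeff h) n (x r) (x s) ^ 2 := by
  -- The weights enter the vectors as `√|β|`, so that the weighted matrices are still Gram matrices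
  -- and stay ordered. Passing from `β_r β_s` to `|β_r| |β_s|` only increases a sum of squares.
  set G : (ℝ → ℝ) → Matrix R R ℝ := fun φ => Matrix.of fun r s =>
    toeplitzForm (cosCoeff φ) n (fun t => √|β r| * x r t) (fun t => √|β s| * x s t) with hG
  have hherm : ∀ φ, (G φ).IsHermitian := fun φ => by
    ext r s
    simp only [hG, Matrix.conjTranspose_apply, Matrix.of_apply, star_trivial]
    exact toeplitzForm_comm (cosCoeff_neg φ) _ _ _
  have hquad : ∀ φ (y : R → ℝ), star y ⬝ᵥ (G φ).mulVec y =
      toeplitzForm (cosCoeff φ) n (fun t => ∑ r, y r * (√|β r| * x r t))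
        (fun t => ∑ r, y r * (√|β r| * x r t)) := fun φ y => by
    simp only [toeplitzForm_sum_left, toeplitzForm_sum_right]
    simp only [dotProduct, Matrix.mulVec, Finset.mul_sum, hG, Matrix.of_apply, star_trivial]
    refine Finset.sum_congr rfl fun r _ => Finset.sum_congr rfl fun s _ => ?_
    rw [toeplitzForm_smul _ _ (y s) (y r), toeplitzForm_comm (cosCoeff_neg φ)]
    ring
  have hA : (G f).PosSemidef := .of_dotProduct_mulVec_nonneg (hherm f) fun y => by
    rw [hquad]; exact toeplitzForm_cosCoeff_self_nonneg hf hf0 _ _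
  have hAB : (G h - G f).PosSemidef :=
    .of_dotProduct_mulVec_nonneg ((hherm h).sub (hherm f)) fun y => by
      rw [Matrix.sub_mulVec, dotProduct_sub, hquad, hquad, sub_nonneg]
      exact toeplitzForm_cosCoeff_self_le hf hh hfh _ _
  have hsq : ∀ φ r s, G φ r s ^ 2 =
      |β r| * |β s| * toeplitzForm (cosCoeff φ) n (x r) (x s) ^ 2 := fun φ r s => by
    simp only [hG, Matrix.of_apply]
    rw [toeplitzForm_smul, mul_pow, mul_pow, Real.sq_sqrt (abs_nonneg _),
      Real.sq_sqrt (abs_nonneg _)]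
  have key := hA.sum_sq_le_sum_sq hAB
  simp only [hsq] at key
  refine le_trans (Finset.sum_le_sum fun r _ => Finset.sum_le_sum fun s _ => ?_) key
  exact mul_le_mul_of_nonneg_right ((le_abs_self _).trans_eq (abs_mul _ _)) (sq_nonneg _)

end ToeplitzComparison

/-! ### Fourier frequencies -/

noncomputable section FourierFrequencies

variable {d : ℝ} {n j k : ℕ}

theorem four_le_of_mem_Icc_numFreq (hj : j ∈ Finset.Icc 1 (numFreq n)) : 4 ≤ n := by
  rw [Finset.mem_Icc, numFreq] at hj; omega

theorem fourierFreq_mem (hj : j ∈ Finset.Icc 1 (numFreq n)) :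
    fourierFreq n j ∈ Set.Ioo 0 Real.pi := by
  have h4 := four_le_of_mem_Icc_numFreq hj
  rw [Finset.mem_Icc, numFreq] at hj
  have hn : (0 : ℝ) < n := by exact_mod_cast (by omega : 0 < n)
  have hj0 : (0 : ℝ) < j := by exact_mod_cast hj.1
  have h2 : 2 * (j : ℝ) < n := by exact_mod_cast (by omega : 2 * j < n)
  have hpi := Real.pi_pos
  unfold fourierFreq
  refine ⟨by positivity, ?_⟩
  rw [div_lt_iff₀ hn]
  nlinarith

theorem exp_fourierFreq_pow (hn : 0 < n) (j : ℕ) :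
    Complex.exp (Complex.I * (fourierFreq n j : ℝ)) ^ n = 1 := by
  have hn' : (n : ℂ) ≠ 0 := by exact_mod_cast hn.ne'
  rw [← Complex.exp_nat_mul, fourierFreq, Complex.exp_eq_one_iff]
  refine ⟨j, ?_⟩
  push_cast
  field_simp

theorem natCast_mul_fourierFreq (hn : 0 < n) (j : ℕ) :
    n * fourierFreq n j = 2 * Real.pi * j := by
  have hn' : (n : ℝ) ≠ 0 := by exact_mod_cast hn.ne'
  rw [fourierFreq]; field_simp

theorem one_le_mul_fourierFreq (hn : 0 < n) (hj : 1 ≤ j) : 1 ≤ n * fourierFreq n j := by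
  rw [natCast_mul_fourierFreq hn]
  have : (1 : ℝ) ≤ j := by exact_mod_cast hj
  nlinarith [Real.pi_gt_three]

/-- For distinct positive integers `j ≤ k + |j - k| ≤ 2|j - k| k`, and symmetrically. This uniform
comparison is what allows powers of `u_j` and `u_k` to be exchanged. -/
theorem fourierFreq_rpow_le (hn : 0 < n) (hj : 1 ≤ j) (hk : 1 ≤ k) (hjk : j ≠ k) (p : ℝ) :
    fourierFreq n j ^ p ≤ (2 * |(j : ℝ) - k|) ^ |p| * fourierFreq n k ^ p := by
  have hn' : (0 : ℝ) < n := by exact_mod_cast hn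
  have hj' : (1 : ℝ) ≤ j := by exact_mod_cast hj
  have hk' : (1 : ℝ) ≤ k := by exact_mod_cast hk
  have hpi := Real.pi_pos
  have h1 : (1 : ℝ) ≤ |(j : ℝ) - k| := by
    have : (1 : ℤ) ≤ |(j : ℤ) - k| := Int.one_le_abs (by omega)
    exact_mod_cast this
  have h2 : ∀ {a b : ℝ}, 1 ≤ b → |a - b| = |(j : ℝ) - k| →
      2 * Real.pi * a / n ≤ 2 * |(j : ℝ) - k| * (2 * Real.pi * b / n) := fun {a b} hb hab => by
    rw [← mul_div_assoc]
    refine div_le_div_of_nonneg_right ?_ hn'.le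
    have : a ≤ 2 * |(j : ℝ) - k| * b := by
      have := le_abs_self (a - b)
      nlinarith
    have := mul_le_mul_of_nonneg_left this (by positivity : 0 ≤ 2 * Real.pi)
    linarith
  unfold fourierFreq
  exact Real.rpow_le_rpow_abs_mul (by positivity) (by positivity) (h2 hk' rfl)
    (h2 hj' (abs_sub_comm _ _)) p

end FourierFrequencies

/-! ### Almost orthogonality for fractional noise -/

noncomputable section FractionalGram

variable {d : ℝ}

/-- Off the diagonal, the telescoped bound is combined with the conjugate series estimate and `|u_j
- u_k| = 2π|j - k|/n`. On the diagonal, the cosine and sine forms are nonnegative and their sum is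
`2πn` times a Fejér average of the density, comparable to the average of `u^{-2d}`. -/
theorem exists_abs_toeplitzForm_fracDensity_le (hd : |d| < 1 / 2) :
    ∃ C : ℝ, 0 ≤ C ∧ ∀ (n j k : ℕ) (σ τ : Bool), j ∈ Finset.Icc 1 (numFreq n) →
      k ∈ Finset.Icc 1 (numFreq n) →
      |toeplitzForm (cosCoeff (fracDensity d)) n (trigVec (fourierFreq n j) σ)
        (trigVec (fourierFreq n k) τ)| ≤ C * n * (fourierFreq n j ^ (-2 * d) +
          fourierFreq n k ^ (-2 * d)) * (if j = k then 1 else |(j : ℝ) - k|⁻¹) := by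
  have hpi := Real.pi_pos
  have hd' := abs_lt.1 hd
  have hp : |(-2 * d)| < 1 := by rw [abs_lt]; constructor <;> linarith
  obtain ⟨C₁, hC₁, h₁⟩ := exists_abs_sum_cosCoeff_mul_sin_le hd
  have hi := intervalIntegrable_fracDensity hd
  have hw : IntervalIntegrable (fun v : ℝ => v ^ (-2 * d)) volume 0 Real.pi :=
    intervalIntegral.intervalIntegrable_rpow' (by linarith)
  -- Any exponent in `[0, 1)` would do: the average of `u^{-2d}` only has to be bounded by a
  -- multiple of `v^{-2d}`.
  obtain ⟨L, hL, hH⟩ := exists_abs_rpow_sub_rpow_le (γ := 1 / 2) (-2 * d) (by norm_num)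
  obtain ⟨C₂, hC₂, h₂⟩ := exists_abs_integral_foldedFejer_sub_le (γ := 1 / 2) (A := 1) hp
    (by norm_num) (by norm_num) hL zero_le_one hw
    (fun u hu => by rw [one_mul, abs_of_nonneg (Real.rpow_nonneg hu.1.le _)]) hH
  set D := (Real.pi / 2) ^ |-2 * d| with hD
  have hD0 : 0 ≤ D := by positivity
  have hfn : ∀ u ∈ Set.Ioo 0 Real.pi, 0 ≤ fracDensity d u := fun u hu =>
    fracDensity_nonneg (Set.Ioo_subset_Ioc_self hu)
  have hdiag : ∀ (n j : ℕ), j ∈ Finset.Icc 1 (numFreq n) → ∀ σ,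
      toeplitzForm (cosCoeff (fracDensity d)) n (trigVec (fourierFreq n j) σ)
        (trigVec (fourierFreq n j) σ) ≤
        2 * Real.pi * (D * (C₂ + 1)) * n * fourierFreq n j ^ (-2 * d) := fun n j hj σ => by
    have hn : 0 < n := by have := four_le_of_mem_Icc_numFreq hj; omega
    have hv := fourierFreq_mem hj
    set v := fourierFreq n j with hvdef
    have hnonneg := fun σ => toeplitzForm_cosCoeff_self_nonneg hi hfn n (trigVec v σ)
    have hadd := toeplitzForm_trigVec_add hi hn v
    have h1 : toeplitzForm (cosCoeff (fracDensity d)) n (trigVec v σ) (trigVec v σ) ≤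
        2 * Real.pi * n * ∫ u in (0 : ℝ)..Real.pi, foldedFejer n v u * fracDensity d u := by
      rw [← hadd]
      cases σ
      · linarith [hnonneg true]
      · linarith [hnonneg false]
    have h2 : ∫ u in (0 : ℝ)..Real.pi, foldedFejer n v u * fracDensity d u ≤
        D * ∫ u in (0 : ℝ)..Real.pi, foldedFejer n v u * u ^ (-2 * d) := by
      rw [← intervalIntegral.integral_const_mul]
      have hc := (continuous_foldedFejer n v).continuousOn (s := Set.uIcc 0 Real.pi)
      refine intervalIntegral.integral_mono_on_of_le_Ioo hpi.le (hi.continuousOn_mul hc)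
        ((hw.continuousOn_mul hc).const_mul _) fun u hu => ?_
      have := fracDensity_le (d := d) (Set.Ioo_subset_Ioc_self hu)
      have hK := foldedFejer_nonneg n v u
      calc _ ≤ foldedFejer n v u * (D * u ^ (-2 * d)) := by gcongr
        _ = _ := by ring
    have h3 : ∫ u in (0 : ℝ)..Real.pi, foldedFejer n v u * u ^ (-2 * d) ≤
        (C₂ + 1) * v ^ (-2 * d) := by
      have hge : 1 ≤ n * v := one_le_mul_fourierFreq hn (Finset.mem_Icc.1 hj).1
      have := h₂ n v hn (Set.Ioo_subset_Ioc_self hv) (exp_fourierFreq_pow hn j) hge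
      have h4 : ((n : ℝ) * v) ^ (-(1 / 2) : ℝ) ≤ 1 :=
        Real.rpow_le_one_of_one_le_of_nonpos hge (by norm_num)
      have hv0 : 0 ≤ v ^ (-2 * d) := Real.rpow_nonneg hv.1.le _
      have h5 : C₂ * v ^ (-2 * d) * ((n : ℝ) * v) ^ (-(1 / 2) : ℝ) ≤ C₂ * v ^ (-2 * d) * 1 := by
        gcongr
      linarith [(abs_le.1 this).2]
    calc _ ≤ 2 * Real.pi * n * (D * ((C₂ + 1) * v ^ (-2 * d))) :=
          h1.trans (by gcongr; exact h2.trans (by gcongr))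
      _ = _ := by ring
  refine ⟨C₁ + 2 * Real.pi * (D * (C₂ + 1)), by positivity, fun n j k σ τ hj hk => ?_⟩
  have hn : 0 < n := by have := four_le_of_mem_Icc_numFreq hj; omega
  have hn' : (0 : ℝ) < n := by exact_mod_cast hn
  have hv := fourierFreq_mem hj
  have hw' := fourierFreq_mem hk
  have hv0 : 0 ≤ fourierFreq n j ^ (-2 * d) := Real.rpow_nonneg hv.1.le _
  have hw0 : 0 ≤ fourierFreq n k ^ (-2 * d) := Real.rpow_nonneg hw'.1.le _
  split_ifs with hjk
  · subst hjk
    -- A mixed cosine–sine form at one frequency is bounded by the mean of the two pure ones.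
    have h1 := abs_toeplitzForm_le hi hfn n (trigVec (fourierFreq n j) σ) (trigVec (fourierFreq n j) τ)
    have h2 := hdiag n j hj σ
    have h3 := hdiag n j hj τ
    have h4 : 0 ≤ C₁ * n * fourierFreq n j ^ (-2 * d) := by positivity
    have h5 : 0 ≤ 2 * Real.pi * (D * (C₂ + 1)) * n * fourierFreq n j ^ (-2 * d) := by positivity
    linarith
  · have h1 := abs_toeplitzForm_trigVec_le (cosCoeff_neg (fracDensity d))
      (exp_fourierFreq_pow hn j) (exp_fourierFreq_pow hn k) (Set.Ioo_subset_Icc_self hv)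
      (Set.Ioo_subset_Icc_self hw') σ τ
    have h2 := h₁ _ n (Set.Ioo_subset_Ioc_self hv)
    have h3 := h₁ _ n (Set.Ioo_subset_Ioc_self hw')
    have hsub : |fourierFreq n j - fourierFreq n k| = 2 * Real.pi / n * |(j : ℝ) - k| := by
      rw [fourierFreq, fourierFreq, ← sub_div, ← mul_sub, abs_div, abs_mul, abs_of_pos hn',
        abs_of_pos (by positivity : 0 < 2 * Real.pi)]
      ring
    have hm : 0 < |(j : ℝ) - k| := abs_pos.2 (sub_ne_zero.2 (by exact_mod_cast hjk))
    rw [hsub] at h1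
    set T := |toeplitzForm (cosCoeff (fracDensity d)) n (trigVec (fourierFreq n j) σ)
        (trigVec (fourierFreq n k) τ)| with hT
    have h4 : 2 * Real.pi / n * |(j : ℝ) - k| * T ≤
        Real.pi * (C₁ * (fourierFreq n j ^ (-2 * d) + fourierFreq n k ^ (-2 * d))) := by
      refine h1.trans ?_
      gcongr
      linarith
    have h5 : T ≤ C₁ / 2 * n * (fourierFreq n j ^ (-2 * d) + fourierFreq n k ^ (-2 * d)) *
        |(j : ℝ) - k|⁻¹ := by
      rw [← div_eq_mul_inv, le_div_iff₀ hm]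
      have h6 : n / (2 * Real.pi) * (2 * Real.pi / n * |(j : ℝ) - k| * T) ≤ n / (2 * Real.pi) *
        (Real.pi * (C₁ * (fourierFreq n j ^ (-2 * d) + fourierFreq n k ^ (-2 * d)))) := by gcongr
      calc _ = n / (2 * Real.pi) * (2 * Real.pi / n * |(j : ℝ) - k| * T) := by field_simp
        _ ≤ _ := h6
        _ = _ := by field_simp
    refine h5.trans ?_
    have : 0 ≤ 2 * Real.pi * (D * (C₂ + 1)) := by positivity
    gcongr
    linarith

/-- Reindexing by `j - k` bounds every row by the same convergent series over `ℤ`. -/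
theorem exists_sum_abs_sub_rpow_le {q : ℝ} (hq : q < -1) :
    ∃ S : ℝ, 0 ≤ S ∧ ∀ (s : Finset ℕ) (j : ℕ),
      ∑ k ∈ s, (if j = k then 1 else |(j : ℝ) - k| ^ q) ≤ S := by
  set κ : ℤ → ℝ := fun m => (if m = 0 then 1 else 0) + |(m : ℝ)| ^ q with hκ
  have hs : Summable κ := by
    refine Summable.add (summable_of_hasFiniteSupport ?_) ?_
    · exact (Set.finite_singleton (0 : ℤ)).subset fun m hm => by
        by_contra h; simp only [Set.mem_singleton_iff] at h; simp [h] at hm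
    · simpa using Real.summable_abs_int_rpow (b := -q) (by linarith)
  have h0 : ∀ m, 0 ≤ κ m := fun m => by simp only [hκ]; split_ifs <;> positivity
  refine ⟨∑' m, κ m, tsum_nonneg h0, fun s j => ?_⟩
  have hinj : Set.InjOn (fun k : ℕ => (j : ℤ) - k) s := fun a _ b _ h => by
    simp only at h; omega
  calc ∑ k ∈ s, (if j = k then 1 else |(j : ℝ) - k| ^ q) ≤ ∑ k ∈ s, κ ((j : ℤ) - k) := by
        refine Finset.sum_le_sum fun k _ => ?_
        simp only [hκ]
        push_cast
        have : 0 ≤ |(j : ℝ) - k| ^ q := by positivity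
        by_cases h : j = k
        · have h' : (j : ℤ) - k = 0 := by omega
          rw [if_pos h, if_pos h']; linarith
        · have h' : ¬ (j : ℤ) - k = 0 := by omega
          rw [if_neg h, if_neg h', zero_add]
    _ = ∑ m ∈ s.image (fun k : ℕ => (j : ℤ) - k), κ m := (Finset.sum_image hinj).symm
    _ ≤ _ := hs.sum_le_tsum _ fun m _ => h0 m

/-- Schur's test: `|x_j| |x_k| ≤ (x_j² + x_k²)/2`, and each half is summed along rows or, by
symmetry, columns. -/
theorem sum_sum_mul_le_of_symm {s : Finset ℕ} {κ : ℕ → ℕ → ℝ} {S : ℝ} {x : ℕ → ℝ}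
    (hκ0 : ∀ j k, 0 ≤ κ j k) (hκ : ∀ j k, κ j k = κ k j) (hS : ∀ j, ∑ k ∈ s, κ j k ≤ S) :
    ∑ j ∈ s, ∑ k ∈ s, |x j| * |x k| * κ j k ≤ S * ∑ j ∈ s, x j ^ 2 := by
  have h1 : ∀ y : ℕ → ℝ, ∑ j ∈ s, ∑ k ∈ s, y j ^ 2 * κ j k ≤ S * ∑ j ∈ s, y j ^ 2 := fun y => by
    rw [Finset.mul_sum]
    refine Finset.sum_le_sum fun j _ => ?_
    rw [← Finset.mul_sum, mul_comm]
    exact mul_le_mul_of_nonneg_right (hS j) (sq_nonneg _)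
  have h2 : ∑ j ∈ s, ∑ k ∈ s, x k ^ 2 * κ j k ≤ S * ∑ j ∈ s, x j ^ 2 := by
    rw [Finset.sum_comm]
    simp_rw [fun j k => hκ k j]
    exact h1 x
  have h3 : ∑ j ∈ s, ∑ k ∈ s, |x j| * |x k| * κ j k ≤
      ∑ j ∈ s, ∑ k ∈ s, (1 / 2 * (x j ^ 2 * κ j k) + 1 / 2 * (x k ^ 2 * κ j k)) := by
    refine Finset.sum_le_sum fun j _ => Finset.sum_le_sum fun k _ => ?_
    have : |x j| * |x k| ≤ 1 / 2 * x j ^ 2 + 1 / 2 * x k ^ 2 := by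
      rw [← sq_abs (x j), ← sq_abs (x k)]
      nlinarith [sq_nonneg (|x j| - |x k|)]
    have := mul_le_mul_of_nonneg_right this (hκ0 j k)
    linarith
  refine h3.trans ?_
  have h1x := h1 x
  simp only [Finset.sum_add_distrib, ← Finset.mul_sum] at h1x h2 ⊢
  linarith

/-- Almost orthogonality of the discrete Fourier transforms of fractional noise. -/
theorem exists_sum_mul_toeplitzForm_fracDensity_sq_le (hd : |d| < 1 / 2) :
    ∃ C : ℝ, 0 ≤ C ∧ ∀ (n : ℕ) (b : ℕ → ℝ),
      ∑ j ∈ Finset.Icc 1 (numFreq n), ∑ k ∈ Finset.Icc 1 (numFreq n), ∑ σ : Bool, ∑ τ : Bool,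
        |b j| * |b k| * toeplitzForm (cosCoeff (fracDensity d)) n (trigVec (fourierFreq n j) σ)
          (trigVec (fourierFreq n k) τ) ^ 2 ≤
      C * n ^ 2 * ∑ j ∈ Finset.Icc 1 (numFreq n), (b j * fourierFreq n j ^ (-2 * d)) ^ 2 := by
  have hd' := abs_lt.1 hd
  set p := -2 * d with hp
  have hp1 : |p| < 1 := by rw [hp, abs_lt]; constructor <;> linarith
  obtain ⟨C, hC, h⟩ := exists_abs_toeplitzForm_fracDensity_le hd
  obtain ⟨S, hS, hκ⟩ := exists_sum_abs_sub_rpow_le (q := |p| - 2) (by linarith)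
  refine ⟨64 * C ^ 2 * S, by positivity, fun n b => ?_⟩
  set κ : ℕ → ℕ → ℝ := fun j k => if j = k then 1 else |(j : ℝ) - k| ^ (|p| - 2) with hκdef
  have hκ0 : ∀ j k, 0 ≤ κ j k := fun j k => by simp only [hκdef]; split_ifs <;> positivity
  have hκs : ∀ j k, κ j k = κ k j := fun j k => by
    simp only [hκdef, eq_comm (a := j), abs_sub_comm (j : ℝ)]
  set w : ℕ → ℝ := fun j => fourierFreq n j ^ p with hw
  -- The frequency comparison turns `(w_j + w_k)²` into a multiple of `w_j w_k |j - k|^{|p|}`. The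
  -- squared factor `|j - k|^{-2}` leaves the exponent `|p| - 2 < -1`, where `|d| < 1/2` is used.
  have hratio : ∀ j ∈ Finset.Icc 1 (numFreq n), ∀ k ∈ Finset.Icc 1 (numFreq n),
      ((w j + w k) * (if j = k then 1 else |(j : ℝ) - k|⁻¹)) ^ 2 ≤ 16 * (w j * w k * κ j k) := by
    intro j hj k hk
    have hn : 0 < n := by have := four_le_of_mem_Icc_numFreq hj; omega
    have hj1 := (Finset.mem_Icc.1 hj).1
    have hk1 := (Finset.mem_Icc.1 hk).1
    have hwj : 0 < w j := Real.rpow_pos_of_pos (fourierFreq_mem hj).1 _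
    have hwk : 0 < w k := Real.rpow_pos_of_pos (fourierFreq_mem hk).1 _
    by_cases hjk : j = k
    · subst hjk
      simp only [hκdef, if_true]
      nlinarith [sq_nonneg (w j)]
    · simp only [hκdef, if_neg hjk]
      have hm : 0 < |(j : ℝ) - k| := abs_pos.2 (sub_ne_zero.2 (by exact_mod_cast hjk))
      set m := |(j : ℝ) - k| with hmdef
      have h2 : (2 * m) ^ |p| ≤ 2 * m ^ |p| := by
        rw [Real.mul_rpow zero_le_two hm.le]
        gcongr
        calc (2 : ℝ) ^ |p| ≤ 2 ^ (1 : ℝ) := by gcongr; norm_num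
          _ = 2 := Real.rpow_one _
      have r1 : w j ≤ 2 * m ^ |p| * w k :=
        (fourierFreq_rpow_le hn hj1 hk1 hjk p).trans (by gcongr)
      have r2 : w k ≤ 2 * m ^ |p| * w j := by
        have := fourierFreq_rpow_le hn hk1 hj1 (Ne.symm hjk) p
        rw [abs_sub_comm] at this
        exact this.trans (by gcongr)
      have e : m ^ (|p| - 2) = m ^ |p| * (m⁻¹) ^ 2 := by
        rw [Real.rpow_sub hm, Real.rpow_two, inv_pow, div_eq_mul_inv]
      have h3 : (w j + w k) ^ 2 ≤ 16 * (w j * w k * m ^ |p|) := by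
        have a1 := mul_le_mul_of_nonneg_left r1 hwj.le
        have a2 := mul_le_mul_of_nonneg_left r2 hwk.le
        nlinarith [sq_nonneg (w j - w k)]
      rw [e, mul_pow]
      calc (w j + w k) ^ 2 * m⁻¹ ^ 2 ≤ 16 * (w j * w k * m ^ |p|) * m⁻¹ ^ 2 := by gcongr
        _ = _ := by ring
  have hterm : ∀ j ∈ Finset.Icc 1 (numFreq n), ∀ k ∈ Finset.Icc 1 (numFreq n),
      ∑ σ : Bool, ∑ τ : Bool, |b j| * |b k| * toeplitzForm (cosCoeff (fracDensity d)) n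
        (trigVec (fourierFreq n j) σ) (trigVec (fourierFreq n k) τ) ^ 2 ≤
      64 * C ^ 2 * n ^ 2 * (|b j * w j| * |b k * w k| * κ j k) := by
    intro j hj k hk
    have hwj : 0 < w j := Real.rpow_pos_of_pos (fourierFreq_mem hj).1 _
    have hwk : 0 < w k := Real.rpow_pos_of_pos (fourierFreq_mem hk).1 _
    have h1 : ∀ σ τ : Bool, toeplitzForm (cosCoeff (fracDensity d)) n
        (trigVec (fourierFreq n j) σ) (trigVec (fourierFreq n k) τ) ^ 2 ≤
        16 * C ^ 2 * n ^ 2 * (w j * w k * κ j k) := fun σ τ => by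
      rw [← sq_abs]
      refine (pow_le_pow_left₀ (abs_nonneg _) (h n j k σ τ hj hk) 2).trans ?_
      have h2 := hratio j hj k hk
      calc _ = C ^ 2 * n ^ 2 * ((w j + w k) * (if j = k then 1 else |(j : ℝ) - k|⁻¹)) ^ 2 := by
            ring
        _ ≤ C ^ 2 * n ^ 2 * (16 * (w j * w k * κ j k)) := by gcongr
        _ = _ := by ring
    calc _ ≤ ∑ σ : Bool, ∑ τ : Bool, |b j| * |b k| * (16 * C ^ 2 * n ^ 2 * (w j * w k * κ j k)) := by
          refine Finset.sum_le_sum fun σ _ => Finset.sum_le_sum fun τ _ => ?_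
          have := h1 σ τ
          gcongr
      _ = _ := by
          rw [abs_mul, abs_mul, abs_of_pos hwj, abs_of_pos hwk]
          simp only [Finset.sum_const, Finset.card_univ, Fintype.card_bool, nsmul_eq_mul]
          push_cast
          ring
  calc _ ≤ ∑ j ∈ Finset.Icc 1 (numFreq n), ∑ k ∈ Finset.Icc 1 (numFreq n),
        64 * C ^ 2 * n ^ 2 * (|b j * w j| * |b k * w k| * κ j k) :=
        Finset.sum_le_sum fun j hj => Finset.sum_le_sum fun k hk => hterm j hj k hk
    _ = 64 * C ^ 2 * n ^ 2 * ∑ j ∈ Finset.Icc 1 (numFreq n), ∑ k ∈ Finset.Icc 1 (numFreq n),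
        |b j * w j| * |b k * w k| * κ j k := by simp only [Finset.mul_sum]
    _ ≤ 64 * C ^ 2 * n ^ 2 * (S * ∑ j ∈ Finset.Icc 1 (numFreq n), (b j * w j) ^ 2) := by
        gcongr
        exact sum_sum_mul_le_of_symm (x := fun j => b j * w j) hκ0 hκs fun j => hκ _ j
    _ = _ := by ring

end FractionalGram

/-! ### Transforms of the linear process -/

noncomputable section LinearProcess

variable {Ω : Type*} [MeasurableSpace Ω] {P : Measure Ω}
  {a : ℕ → ℝ} {ζ X : ℤ → Ω → ℝ} {f g : ℝ → ℝ} {d : ℝ}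

/-- The real (cosine or sine) transform of a sample path. -/
def trigTransform (n : ℕ) (θ : ℝ) (σ : Bool) (x : ℤ → ℝ) : ℝ :=
  ∑ t ∈ Finset.Icc 1 n, trigVec θ σ t * x t

theorem periodogram_eq (n : ℕ) (x : ℤ → ℝ) (u : ℝ) :
    periodogram n x u = (2 * Real.pi * n)⁻¹ * ∑ σ : Bool, trigTransform n u σ x ^ 2 := by
  have h : ∑ t ∈ Finset.Icc 1 n, Complex.exp (Complex.I * (t : ℂ) * (u : ℂ)) * (x (t : ℤ) : ℂ) =
      (trigTransform n u true x : ℂ) + (trigTransform n u false x : ℂ) * Complex.I := by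
    simp only [trigTransform]
    push_cast
    rw [Finset.sum_mul, ← Finset.sum_add_distrib]
    refine Finset.sum_congr rfl fun t _ => ?_
    rw [show Complex.I * (t : ℂ) * (u : ℂ) = ((t * u : ℝ) : ℂ) * Complex.I by push_cast; ring,
      Complex.exp_mul_I]
    simp only [trigVec, if_true, Bool.false_eq_true, if_false]
    push_cast
    ring
  rw [periodogram, h, ← Complex.normSq_eq_norm_sq, Complex.normSq_add_mul_I]
  simp

/-- Indexing by frequency and by cosine or sine brings the statistic to the form `∑ β_r Y_r²`
required by the variance bound. -/
theorem weightedPeriodogramSum_eq {Ω : Type*} [MeasurableSpace Ω] (b : ℕ → ℕ → ℝ) (X : ℤ → Ω → ℝ) (n : ℕ) :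
    weightedPeriodogramSum b X n = fun ω => ∑ r : Finset.Icc 1 (numFreq n) × Bool,
      b n r.1 * (2 * Real.pi * n)⁻¹ *
        trigTransform n (fourierFreq n r.1) r.2 (fun t => X t ω) ^ 2 := by
  ext ω
  rw [weightedPeriodogramSum, Fintype.sum_prod_type, ← Finset.sum_coe_sort (Finset.Icc 1 (numFreq n))]
  refine Finset.sum_congr rfl fun j _ => ?_
  rw [periodogram_eq, Finset.mul_sum, Finset.mul_sum]
  exact Finset.sum_congr rfl fun σ _ => by ring

namespace IsLinearProcess

/-- The partial sums of the moving average. -/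
def partialSum {Ω : Type*} (a : ℕ → ℝ) (ζ : ℤ → Ω → ℝ) (N : ℕ) (j : ℤ) : Ω → ℝ :=
  ∑ k ∈ Finset.range N, a k • ζ (j - k)

theorem partialSum_mem_span {Ω : Type*} (a : ℕ → ℝ) (ζ : ℤ → Ω → ℝ) (N : ℕ) (j : ℤ) :
    partialSum a ζ N j ∈ Submodule.span ℝ (Set.range ζ) :=
  Submodule.sum_mem _ fun _ _ => Submodule.smul_mem _ _ (Submodule.subset_span ⟨_, rfl⟩)

theorem tendsto_partialSum (hX : IsLinearProcess P a ζ X) (j : ℤ) :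
    Tendsto (fun N => eLpNorm (partialSum a ζ N j - X j) 2 P) atTop (𝓝 0) := by
  refine (hX.tendsto_series j).congr fun N => ?_
  rw [eLpNorm_sub_comm]
  congr 1
  ext ω
  simp [partialSum]

theorem memLp_partialSum [IsProbabilityMeasure P] (hζ : IsStandardizedNoise P ζ) (a : ℕ → ℝ)
    (N : ℕ) (j : ℤ) : MemLp (partialSum a ζ N j) 2 P :=
  memLp_finsetSum' _ fun _ _ => (hζ.memLp_two _).const_smul _

/-- The mean is the inner product with `1`, which is continuous along the mean-square convergent
series. -/
theorem integral_eq_zero [IsProbabilityMeasure P] (hζ : IsStandardizedNoise P ζ)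
    (hX : IsLinearProcess P a ζ X) (j : ℤ) : ∫ ω, X j ω ∂P = 0 := by
  have h := tendsto_integral_mul_of_tendsto_eLpNorm (g := fun _ => 1) (G := fun _ _ => 1)
    (hX.memLp j) (memLp_const 1) (fun N => memLp_partialSum hζ a N j) (fun _ => memLp_const 1)
    (hX.tendsto_partialSum j) (by simp)
  simp only [mul_one] at h
  refine tendsto_nhds_unique h ?_
  have : ∀ N, ∫ ω, partialSum a ζ N j ω ∂P = 0 := fun N => by
    simp only [partialSum, Finset.sum_apply, Pi.smul_apply, smul_eq_mul]
    rw [integral_finsetSum _ fun k _ => ((hζ.memLp_two _).integrable one_le_two).const_mul _]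
    simp [integral_const_mul, hζ.integral_eq_zero]
  simp [this]

theorem integral_mul_eq_cosCoeff [IsProbabilityMeasure P] (hζ : IsStandardizedNoise P ζ)
    (hX : IsLinearProcess P a ζ X) (hf : IsSpectralDensity P X f) (hfg : HasMemoryForm f d g)
    (t s : ℤ) : ∫ ω, X t ω * X s ω ∂P = cosCoeff f (t - s) := by
  rw [← hf.covariance_eq_cosCoeff hfg, covariance_eq_sub (hX.memLp t) (hX.memLp s),
    hX.integral_eq_zero hζ, zero_mul, sub_zero]
  rfl

theorem memLp_trigTransform (hX : IsLinearProcess P a ζ X) (n : ℕ) (θ : ℝ) (σ : Bool) :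
    MemLp (fun ω => trigTransform n θ σ (fun t => X t ω)) 2 P :=
  memLp_finsetSum _ fun _ _ => (hX.memLp _).const_mul _

theorem integral_trigTransform_mul [IsProbabilityMeasure P] (hζ : IsStandardizedNoise P ζ)
    (hX : IsLinearProcess P a ζ X) (hf : IsSpectralDensity P X f) (hfg : HasMemoryForm f d g)
    (n : ℕ) (α β : ℝ) (σ τ : Bool) :
    ∫ ω, trigTransform n α σ (fun t => X t ω) * trigTransform n β τ (fun t => X t ω) ∂P =
      toeplitzForm (cosCoeff f) n (trigVec α σ) (trigVec β τ) := by
  have hi : ∀ t s : ℕ, Integrable (fun ω => X t ω * X s ω) P := fun t s =>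
    (hX.memLp t).integrable_mul (hX.memLp s)
  have : ∀ ω, trigTransform n α σ (fun t => X t ω) * trigTransform n β τ (fun t => X t ω) =
      ∑ t ∈ Finset.Icc 1 n, ∑ s ∈ Finset.Icc 1 n,
        trigVec α σ t * trigVec β τ s * (X t ω * X s ω) := fun ω => by
    rw [trigTransform, trigTransform, Finset.sum_mul_sum]
    refine Finset.sum_congr rfl fun t _ => Finset.sum_congr rfl fun s _ => by ring
  simp_rw [this]
  rw [integral_finsetSum _ fun t _ => integrable_finsetSum _ fun s _ => (hi t s).const_mul _]
  refine Finset.sum_congr rfl fun t _ => ?_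
  rw [integral_finsetSum _ fun s _ => (hi t s).const_mul _]
  simp only [integral_const_mul, hX.integral_mul_eq_cosCoeff hζ hf hfg]

theorem tendsto_trigTransform [IsProbabilityMeasure P] (hζ : IsStandardizedNoise P ζ)
    (hX : IsLinearProcess P a ζ X) (n : ℕ) (θ : ℝ) (σ : Bool) :
    Tendsto (fun N => eLpNorm ((∑ t ∈ Finset.Icc 1 n, trigVec θ σ t • partialSum a ζ N t) -
      fun ω => trigTransform n θ σ (fun t => X t ω)) 2 P) atTop (𝓝 0) := by
  have h0 : Tendsto (fun N => ∑ t ∈ Finset.Icc 1 n,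
      ‖trigVec θ σ t‖ₑ * eLpNorm (partialSum a ζ N t - X t) 2 P) atTop (𝓝 0) := by
    rw [show (0 : ENNReal) = ∑ t ∈ Finset.Icc 1 n, ‖trigVec θ σ t‖ₑ * 0 by simp]
    exact tendsto_finsetSum _ fun t _ =>
      ENNReal.Tendsto.const_mul (hX.tendsto_partialSum t) (Or.inr (by simp))
  refine tendsto_of_tendsto_of_tendsto_of_le_of_le tendsto_const_nhds h0 (fun _ => zero_le)
    fun N => ?_
  have e : (∑ t ∈ Finset.Icc 1 n, trigVec θ σ t • partialSum a ζ N t) -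
      (fun ω => trigTransform n θ σ (fun t => X t ω)) =
      ∑ t ∈ Finset.Icc 1 n, trigVec θ σ t • (partialSum a ζ N t - X t) := by
    ext ω
    simp [trigTransform, mul_sub, Finset.sum_sub_distrib]
  simp only [e]
  refine (eLpNorm_sum_le (fun t _ => ?_) one_le_two).trans_eq ?_
  · exact (((memLp_partialSum hζ a N t).sub (hX.memLp t)).const_smul _).1
  · exact Finset.sum_congr rfl fun t _ => eLpNorm_const_smul _ _ _ _

end IsLinearProcess

end LinearProcess

/-! ### The variance bound -/

noncomputable section Variance

variable {Ω : Type*} [MeasurableSpace Ω] {P : Measure Ω} [IsProbabilityMeasure P]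
  {a : ℕ → ℝ} {ζ X : ℤ → Ω → ℝ} {f g : ℝ → ℝ} {d : ℝ}

theorem HasMemoryForm.eq_rpow_mul (hfg : HasMemoryForm f d g) {u : ℝ}
    (hu : u ∈ Set.Ioc 0 Real.pi) : f u = u ^ (-2 * d) * g u := by
  have := hfg.eq u ⟨by linarith [hu.1, Real.pi_pos], hu.2⟩ hu.1.ne'
  rwa [abs_of_pos hu.1] at this

theorem HasMemoryForm.exists_bounds (hfg : HasMemoryForm f d g) :
    ∃ C₁ C₂ : ℝ, 0 < C₁ ∧ 0 < C₂ ∧ ∀ u ∈ Set.Ioc 0 Real.pi,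
      C₁ * u ^ (-2 * d) ≤ f u ∧ f u ≤ C₂ * u ^ (-2 * d) ∧ |g u| ≤ C₂ := by
  obtain ⟨C₁, C₂, h1, h⟩ := hfg.bounds
  have hsub : ∀ u ∈ Set.Ioc 0 Real.pi, u ∈ Set.Icc (-Real.pi) Real.pi := fun u hu =>
    ⟨by linarith [hu.1, Real.pi_pos], hu.2⟩
  have hpi := h Real.pi (hsub _ ⟨Real.pi_pos, le_rfl⟩)
  refine ⟨C₁, C₂, h1, by linarith, fun u hu => ?_⟩
  obtain ⟨h2, h3⟩ := h u (hsub u hu)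
  have hw := Real.rpow_nonneg hu.1.le (-2 * d)
  rw [hfg.eq_rpow_mul hu, abs_of_nonneg (by linarith), mul_comm _ (g u)]
  exact ⟨by gcongr, by gcongr, h3⟩

theorem weightNorm_sq (b : ℕ → ℕ → ℝ) (f : ℝ → ℝ) (n : ℕ) : weightNorm b f n ^ 2 =
    ∑ j ∈ Finset.Icc 1 (numFreq n), (b n j * f (fourierFreq n j)) ^ 2 :=
  Real.sq_sqrt (Finset.sum_nonneg fun _ _ => sq_nonneg _)

theorem cosCoeff_const_mul (c : ℝ) (f : ℝ → ℝ) (k : ℤ) :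
    cosCoeff (fun u => c * f u) k = c * cosCoeff f k := by
  simp only [cosCoeff]
  rw [mul_left_comm c, ← intervalIntegral.integral_const_mul c]
  refine congrArg (2 * ·) (intervalIntegral.integral_congr fun u _ => ?_)
  ring

theorem toeplitzForm_cosCoeff_const_mul (c : ℝ) (f : ℝ → ℝ) (n : ℕ) (x y : ℕ → ℝ) :
    toeplitzForm (cosCoeff fun u => c * f u) n x y = c * toeplitzForm (cosCoeff f) n x y := by
  simp only [toeplitzForm, cosCoeff_const_mul, Finset.mul_sum]
  refine Finset.sum_congr rfl fun t _ => Finset.sum_congr rfl fun s _ => by ring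

/-- Domination by a multiple of the fractional noise density reduces the Frobenius norm of the
covariances to the almost orthogonal case. The upper bound on `g` gives the domination, and the
lower bound converts `u_j^{-2d}` back to `f(u_j)`. -/
theorem exists_integral_weightedPeriodogramSum_sub_sq_le (hζ : IsStandardizedNoise P ζ)
    (hX : IsLinearProcess P a ζ X) (hf : IsSpectralDensity P X f) (hfg : HasMemoryForm f d g) :
    ∃ C : ℝ, ∀ (b : ℕ → ℕ → ℝ) (n : ℕ),
      MemLp (weightedPeriodogramSum b X n) 2 P ∧
      ∫ ω, (weightedPeriodogramSum b X n ω - ∫ ω', weightedPeriodogramSum b X n ω' ∂P) ^ 2 ∂P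
        ≤ C * weightNorm b f n ^ 2 := by
  obtain ⟨C₁, C₂, hC₁, hC₂, hb⟩ := hfg.exists_bounds
  obtain ⟨C, hC, hGram⟩ := exists_sum_mul_toeplitzForm_fracDensity_sq_le hfg.abs_d_lt
  have hfi := hf.intervalIntegrable_zero_pi
  have hpi := Real.pi_pos
  set M := C₂ * (Real.pi / 2) ^ |-2 * d| with hM
  have hM0 : 0 ≤ M := by positivity
  set μ := ∫ ω, ζ 0 ω ^ 4 ∂P with hμ
  have hμ0 : 0 ≤ μ := integral_nonneg fun ω => by positivity
  refine ⟨(2 + μ) * (M ^ 2 * C * C₁⁻¹ ^ 2), fun b n => ?_⟩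
  rcases Nat.eq_zero_or_pos n with rfl | hn
  · have : weightedPeriodogramSum b X 0 = fun _ => 0 := by
      ext ω; simp [weightedPeriodogramSum, numFreq]
    rw [this]
    refine ⟨MemLp.zero', ?_⟩
    simp [weightNorm, numFreq]
  have hn' : (0 : ℝ) < n := by exact_mod_cast hn
  set β : Finset.Icc 1 (numFreq n) × Bool → ℝ := fun r => b n r.1 * (2 * Real.pi * n)⁻¹ with hβ
  set x : Finset.Icc 1 (numFreq n) × Bool → ℕ → ℝ := fun r => trigVec (fourierFreq n r.1) r.2 with hx
  set Y : Finset.Icc 1 (numFreq n) × Bool → Ω → ℝ := fun r ω => trigTransform n (fourierFreq n r.1) r.2 (fun t => X t ω) with hY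
  obtain ⟨h1, h2⟩ := hζ.integral_sum_sq_sub_sq_le β (Y := Y)
    (W := fun N r => ∑ t ∈ Finset.Icc 1 n, x r t • IsLinearProcess.partialSum a ζ N t)
    (fun r => hX.memLp_trigTransform n _ _)
    (fun N r => Submodule.sum_mem _ fun t _ =>
      Submodule.smul_mem _ _ (IsLinearProcess.partialSum_mem_span a ζ N t))
    (fun r => hX.tendsto_trigTransform hζ n _ _)
  rw [weightedPeriodogramSum_eq]
  refine ⟨h1, h2.trans ?_⟩
  rw [mul_assoc]
  refine mul_le_mul_of_nonneg_left ?_ (by linarith)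
  have hcov : ∀ r s, ∫ ω, Y r ω * Y s ω ∂P = toeplitzForm (cosCoeff f) n (x r) (x s) :=
    fun r s => hX.integral_trigTransform_mul hζ hf hfg n _ _ _ _
  simp only [hcov]
  have hdom : ∀ u ∈ Set.Ioo 0 Real.pi, f u ≤ M * fracDensity d u := fun u hu => by
    have hu' := Set.Ioo_subset_Ioc_self hu
    calc f u ≤ C₂ * u ^ (-2 * d) := (hb u hu').2.1
      _ ≤ C₂ * ((Real.pi / 2) ^ |-2 * d| * fracDensity d u) := by
          have := rpow_le_fracDensity (d := d) hu'
          gcongr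
      _ = _ := by rw [hM]; ring
  have h3 := sum_mul_toeplitzForm_sq_le hfi ((intervalIntegrable_fracDensity hfg.abs_d_lt).const_mul M)
    (fun u hu => hf.nonneg u ⟨by linarith [hu.1], hu.2.le⟩) hdom n β x
  refine h3.trans ?_
  simp only [toeplitzForm_cosCoeff_const_mul]
  have h4 : ∑ r, ∑ s, |β r| * |β s| * (M * toeplitzForm (cosCoeff (fracDensity d)) n (x r) (x s)) ^ 2
      = (M * (2 * Real.pi * n)⁻¹) ^ 2 * ∑ j ∈ Finset.Icc 1 (numFreq n),
        ∑ k ∈ Finset.Icc 1 (numFreq n), ∑ σ : Bool, ∑ τ : Bool,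
        |b n j| * |b n k| * toeplitzForm (cosCoeff (fracDensity d)) n
          (trigVec (fourierFreq n j) σ) (trigVec (fourierFreq n k) τ) ^ 2 := by
    rw [Fintype.sum_prod_type, ← Finset.sum_coe_sort (Finset.Icc 1 (numFreq n)), Finset.mul_sum]
    refine Finset.sum_congr rfl fun j _ => ?_
    simp only [Fintype.sum_prod_type]
    rw [Finset.sum_comm, ← Finset.sum_coe_sort (Finset.Icc 1 (numFreq n)), Finset.mul_sum]
    refine Finset.sum_congr rfl fun k _ => ?_
    rw [Finset.mul_sum]
    refine Finset.sum_congr rfl fun σ _ => ?_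
    rw [Finset.mul_sum]
    refine Finset.sum_congr rfl fun τ _ => ?_
    simp only [hβ, hx, abs_mul, abs_of_pos (by positivity : 0 < (2 * Real.pi * n)⁻¹)]
    ring
  rw [h4, weightNorm_sq]
  have h5 : ∑ j ∈ Finset.Icc 1 (numFreq n), (b n j * fourierFreq n j ^ (-2 * d)) ^ 2 ≤
      C₁⁻¹ ^ 2 * ∑ j ∈ Finset.Icc 1 (numFreq n), (b n j * f (fourierFreq n j)) ^ 2 := by
    rw [Finset.mul_sum]
    refine Finset.sum_le_sum fun j hj => ?_
    have hv := Set.Ioo_subset_Ioc_self (fourierFreq_mem hj)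
    have h6 : fourierFreq n j ^ (-2 * d) ≤ C₁⁻¹ * f (fourierFreq n j) := by
      rw [le_inv_mul_iff₀ hC₁]; exact (hb _ hv).1
    have h7 : 0 ≤ fourierFreq n j ^ (-2 * d) := Real.rpow_nonneg hv.1.le _
    calc _ = b n j ^ 2 * (fourierFreq n j ^ (-2 * d)) ^ 2 := by ring
      _ ≤ b n j ^ 2 * (C₁⁻¹ * f (fourierFreq n j)) ^ 2 := by gcongr
      _ = _ := by ring
  -- The factor `n²` of the Gram bound cancels against the squared normalization of the periodogram;
  -- the remaining `(2π)^{-2}` is at most `1`.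
  calc _ ≤ (M * (2 * Real.pi * n)⁻¹) ^ 2 * (C * n ^ 2 *
        (C₁⁻¹ ^ 2 * ∑ j ∈ Finset.Icc 1 (numFreq n), (b n j * f (fourierFreq n j)) ^ 2)) := by
        refine mul_le_mul_of_nonneg_left ((hGram n (b n)).trans ?_) (by positivity)
        gcongr
    _ = (2 * Real.pi)⁻¹ ^ 2 * (M ^ 2 * C * C₁⁻¹ ^ 2 *
        ∑ j ∈ Finset.Icc 1 (numFreq n), (b n j * f (fourierFreq n j)) ^ 2) := by
        field_simp
    _ ≤ 1 * (M ^ 2 * C * C₁⁻¹ ^ 2 *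
        ∑ j ∈ Finset.Icc 1 (numFreq n), (b n j * f (fourierFreq n j)) ^ 2) := by
        gcongr
        refine pow_le_one₀ (by positivity) (inv_le_one_of_one_le₀ ?_)
        linarith [Real.pi_gt_three]
    _ = _ := one_mul _

end Variance

/-! ### The bias and the mean-square error -/

noncomputable section Bias

variable {Ω : Type*} [MeasurableSpace Ω] {P : Measure Ω}
  {a : ℕ → ℝ} {ζ X : ℤ → Ω → ℝ} {f g : ℝ → ℝ} {d : ℝ}

theorem IsLinearProcess.integrable_periodogram (hX : IsLinearProcess P a ζ X) (n : ℕ) (v : ℝ) :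
    Integrable (fun ω => periodogram n (fun t => X t ω) v) P := by
  simp only [periodogram_eq]
  exact (integrable_finsetSum _ fun σ _ => (hX.memLp_trigTransform n v σ).integrable_sq).const_mul _

theorem IsLinearProcess.integral_periodogram [IsProbabilityMeasure P]
    (hζ : IsStandardizedNoise P ζ)
    (hX : IsLinearProcess P a ζ X) (hf : IsSpectralDensity P X f) (hfg : HasMemoryForm f d g)
    {n : ℕ} (hn : 0 < n) (v : ℝ) : ∫ ω, periodogram n (fun t => X t ω) v ∂P =
      ∫ u in (0 : ℝ)..Real.pi, foldedFejer n v u * f u := by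
  have hn' : (0 : ℝ) < n := by exact_mod_cast hn
  have hpi := Real.pi_pos
  simp only [periodogram_eq]
  rw [integral_const_mul,
    integral_finsetSum _ fun σ _ => (hX.memLp_trigTransform n v σ).integrable_sq]
  have h := fun σ => hX.integral_trigTransform_mul hζ hf hfg n v v σ σ
  simp only [← sq] at h
  rw [Fintype.sum_bool, h, h, toeplitzForm_trigVec_add hf.intervalIntegrable_zero_pi hn,
    inv_mul_cancel_left₀ (by positivity)]

theorem IsLinearProcess.integral_weightedPeriodogramSum [IsProbabilityMeasure P]
    (hζ : IsStandardizedNoise P ζ)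
    (hX : IsLinearProcess P a ζ X) (hf : IsSpectralDensity P X f) (hfg : HasMemoryForm f d g)
    (b : ℕ → ℕ → ℝ) (n : ℕ) : ∫ ω, weightedPeriodogramSum b X n ω ∂P =
      ∑ j ∈ Finset.Icc 1 (numFreq n),
        b n j * ∫ u in (0 : ℝ)..Real.pi, foldedFejer n (fourierFreq n j) u * f u := by
  simp only [weightedPeriodogramSum]
  rw [integral_finsetSum _ fun j _ => (hX.integrable_periodogram n _).const_mul _]
  refine Finset.sum_congr rfl fun j hj => ?_
  have := four_le_of_mem_Icc_numFreq hj
  rw [integral_const_mul, hX.integral_periodogram hζ hf hfg (by omega)]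

theorem abs_integral_weightedPeriodogramSum_sub_le [IsProbabilityMeasure P]
    (hζ : IsStandardizedNoise P ζ)
    (hX : IsLinearProcess P a ζ X) (hf : IsSpectralDensity P X f) (hfg : HasMemoryForm f d g)
    {n : ℕ} {r : ℕ → ℝ} (hr : ∀ j ∈ Finset.Icc 1 (numFreq n),
      |(∫ u in (0 : ℝ)..Real.pi, foldedFejer n (fourierFreq n j) u * f u) - f (fourierFreq n j)| ≤
        r j * |f (fourierFreq n j)|) (b : ℕ → ℕ → ℝ) :
    |(∫ ω, weightedPeriodogramSum b X n ω ∂P) - weightedSpectralSum b f n| ≤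
      ∑ j ∈ Finset.Icc 1 (numFreq n), r j * |b n j * f (fourierFreq n j)| := by
  rw [hX.integral_weightedPeriodogramSum hζ hf hfg, weightedSpectralSum, ← Finset.sum_sub_distrib]
  refine (Finset.abs_sum_le_sum_abs _ _).trans (Finset.sum_le_sum fun j hj => ?_)
  rw [← mul_sub, abs_mul, abs_mul, mul_left_comm]
  exact mul_le_mul_of_nonneg_left (hr j hj) (abs_nonneg _)

theorem sum_mul_abs_le_sqrt_mul_weightNorm (b : ℕ → ℕ → ℝ) (f : ℝ → ℝ) (n : ℕ) (r : ℕ → ℝ)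
    {s : Finset ℕ} (hs : s ⊆ Finset.Icc 1 (numFreq n)) :
    ∑ j ∈ s, r j * |b n j * f (fourierFreq n j)| ≤ √(∑ j ∈ s, r j ^ 2) * weightNorm b f n := by
  refine (Real.sum_mul_le_sqrt_mul_sqrt _ _ _).trans (mul_le_mul_of_nonneg_left
    (Real.sqrt_le_sqrt ?_) (Real.sqrt_nonneg _))
  simp only [sq_abs]
  exact Finset.sum_le_sum_of_subset_of_nonneg hs fun _ _ _ => sq_nonneg _

theorem weightNorm_nonneg (b : ℕ → ℕ → ℝ) (f : ℝ → ℝ) (n : ℕ) : 0 ≤ weightNorm b f n :=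
  Real.sqrt_nonneg _

theorem abs_le_weightMax (b : ℕ → ℕ → ℝ) (f : ℝ → ℝ) {n j : ℕ}
    (hj : j ∈ Finset.Icc 1 (numFreq n)) : |b n j * f (fourierFreq n j)| ≤ weightMax b f n := by
  rw [weightMax, ← Real.norm_eq_abs, ← coe_nnnorm, NNReal.coe_le_coe]
  exact Finset.le_sup (f := fun j => ‖b n j * f (fourierFreq n j)‖₊) hj

theorem weightMax_le_weightNorm (b : ℕ → ℕ → ℝ) (f : ℝ → ℝ) (n : ℕ) :
    weightMax b f n ≤ weightNorm b f n := by
  rw [weightMax, ← Real.coe_toNNReal _ (weightNorm_nonneg b f n), NNReal.coe_le_coe]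
  refine Finset.sup_le fun j hj => ?_
  rw [← NNReal.coe_le_coe, Real.coe_toNNReal _ (weightNorm_nonneg b f n), coe_nnnorm, Real.norm_eq_abs,
    weightNorm]
  refine Real.le_sqrt_of_sq_le ?_
  rw [sq_abs]
  exact Finset.single_le_sum (f := fun j => (b n j * f (fourierFreq n j)) ^ 2)
    (fun _ _ => sq_nonneg _) hj

/-- The exponent is lowered to `min β (3/4)`, still above `1/2`, because the Fejér rates need an
exponent strictly below `1`. The interval is bounded, so this costs only a power of `π`. -/
theorem IsLipschitzAboveHalf.exists_holder (hg : IsLipschitzAboveHalf g) :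
    ∃ γ L : ℝ, 1 / 2 < γ ∧ γ < 1 ∧ 0 ≤ L ∧ ∀ u ∈ Set.Ioc 0 Real.pi, ∀ v ∈ Set.Ioc 0 Real.pi,
      |g u - g v| ≤ L * |u - v| ^ γ := by
  obtain ⟨β, hβ, -, L, hL⟩ := hg
  have hβ' : (1 / 2 : ℝ) < β := by exact_mod_cast hβ
  have h1 : (1 / 2 : ℝ) < min (β : ℝ) (3 / 4) := lt_min hβ' (by norm_num)
  refine ⟨min β (3 / 4), L * Real.pi ^ (β - min (β : ℝ) (3 / 4)), h1,
    (min_le_right _ _).trans_lt (by norm_num), by positivity, fun u hu v hv => ?_⟩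
  have hsub : ∀ u ∈ Set.Ioc 0 Real.pi, u ∈ Set.Icc (-Real.pi) Real.pi := fun u hu =>
    ⟨by linarith [hu.1, Real.pi_pos], hu.2⟩
  have h2 := hL.dist_le (hsub u hu) (hsub v hv)
  rw [Real.dist_eq, Real.dist_eq] at h2
  have h3 : |u - v| ≤ Real.pi := abs_le.2 ⟨by linarith [hu.1, hv.2], by linarith [hv.1, hu.2]⟩
  have h4 : (0 : ℝ) ≤ β - min (β : ℝ) (3 / 4) := sub_nonneg.2 (min_le_left _ _)
  calc |g u - g v| ≤ L * |u - v| ^ (β : ℝ) := h2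
    _ = L * (|u - v| ^ (β - min (β : ℝ) (3 / 4)) * |u - v| ^ (min (β : ℝ) (3 / 4))) := by
        rw [← Real.rpow_add_of_nonneg (abs_nonneg _) h4 (by linarith), sub_add_cancel]
    _ ≤ L * (Real.pi ^ (β - min (β : ℝ) (3 / 4)) * |u - v| ^ (min (β : ℝ) (3 / 4))) := by
        gcongr
    _ = _ := by ring

/-- All three cases give the same local regularity. For Hölder `g`, the product `u^{-2d} g(u)` is
split as in the product rule and `v^γ ≤ π^γ` makes the bound on `g` relative. In case (c3) the mean
value theorem applies directly, `3/4` being one admissible exponent. -/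
theorem HasMemoryForm.exists_local_holder (hfg : HasMemoryForm f d g)
    (h : CaseC1 d g ∨ CaseC2 d g ∨ CaseC3 f d) :
    ∃ γ L : ℝ, 1 / 2 < γ ∧ γ < 1 ∧ 0 ≤ L ∧ ∀ u ∈ Set.Ioc 0 Real.pi, ∀ v ∈ Set.Ioc 0 Real.pi,
      |u - v| ≤ v / 2 → |f u - f v| ≤ L * v ^ (-2 * d - γ) * |u - v| ^ γ := by
  have h' : IsLipschitzAboveHalf g ∨ CaseC3 f d := by
    rcases h with h | h | h
    exacts [Or.inl h.2, Or.inl h.2, Or.inr h]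
  rcases h' with hg | ⟨K, hK⟩
  · obtain ⟨γ, L, h1, h2, hL, hH⟩ := hg.exists_holder
    obtain ⟨M, hM, hp⟩ := exists_abs_rpow_sub_rpow_le (-2 * d) h2.le
    obtain ⟨_, C₂, -, hC₂, hb⟩ := hfg.exists_bounds
    refine ⟨γ, M * C₂ + Real.pi ^ γ * L, h1, h2, by positivity, fun u hu v hv huv => ?_⟩
    have hv0 := hv.1
    have h3 : v ^ (-2 * d) ≤ v ^ (-2 * d - γ) * Real.pi ^ γ := by
      calc v ^ (-2 * d) = v ^ (-2 * d - γ) * v ^ γ := by rw [← Real.rpow_add hv0]; ring_nf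
        _ ≤ _ := by gcongr; exact hv.2
    have e : f u - f v = (u ^ (-2 * d) - v ^ (-2 * d)) * g u + v ^ (-2 * d) * (g u - g v) := by
      rw [hfg.eq_rpow_mul hu, hfg.eq_rpow_mul hv]; ring
    calc |f u - f v| ≤ |u ^ (-2 * d) - v ^ (-2 * d)| * |g u| + v ^ (-2 * d) * |g u - g v| := by
          rw [e]
          refine (abs_add_le _ _).trans_eq ?_
          rw [abs_mul, abs_mul, abs_of_nonneg (Real.rpow_nonneg hv0.le _)]
      _ ≤ (M * v ^ (-2 * d - γ) * |u - v| ^ γ) * C₂ +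
          (v ^ (-2 * d - γ) * Real.pi ^ γ) * (L * |u - v| ^ γ) := by
          gcongr
          exacts [hp u hu v hv huv, (hb u hu).2.2, hH u hu v hv]
      _ = _ := by ring
  · obtain ⟨L, hL, h⟩ := exists_abs_sub_le_of_hasDerivWithinAt (γ := 3 / 4) (p := -2 * d) (K := K)
      (by norm_num) fun u hu => by
        obtain ⟨D, h1, h2⟩ := hK u hu
        exact ⟨D, h1, h2.trans_eq (by ring_nf)⟩
    exact ⟨3 / 4, L, by norm_num, by norm_num, hL, h⟩

/-- The relative rate is `(n u_j)^{-γ}`, and `n u_j = 2πj ≥ j`; the lower bound on `f` makes the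
error relative to `f(u_j)`. -/
theorem exists_abs_integral_foldedFejer_mul_sub_le (hf : IsSpectralDensity P X f)
    (hfg : HasMemoryForm f d g) (h : CaseC1 d g ∨ CaseC2 d g ∨ CaseC3 f d) :
    ∃ C γ : ℝ, 0 ≤ C ∧ 1 / 2 < γ ∧ ∀ n : ℕ, ∀ j ∈ Finset.Icc 1 (numFreq n),
      |(∫ u in (0 : ℝ)..Real.pi, foldedFejer n (fourierFreq n j) u * f u) - f (fourierFreq n j)| ≤
        C * (j : ℝ) ^ (-γ) * |f (fourierFreq n j)| := by
  obtain ⟨γ, L, h1, h2, hL, hH⟩ := hfg.exists_local_holder h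
  obtain ⟨C₁, C₂, hC₁, hC₂, hb⟩ := hfg.exists_bounds
  have hd := hfg.abs_d_lt
  obtain ⟨C, hC, hK⟩ := exists_abs_integral_foldedFejer_sub_le (F := f) (p := -2 * d) (A := C₂)
    (by rw [abs_mul, abs_neg, abs_two]; linarith) (by linarith) h2 hL hC₂.le
    hf.intervalIntegrable_zero_pi (fun u hu => by
      rw [abs_of_nonneg (hf.nonneg u ⟨by linarith [hu.1, Real.pi_pos], hu.2⟩)]
      exact (hb u hu).2.1) hH
  refine ⟨C * C₁⁻¹, γ, by positivity, h1, fun n j hj => ?_⟩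
  have hn : 0 < n := by have := four_le_of_mem_Icc_numFreq hj; omega
  have hj1 := (Finset.mem_Icc.1 hj).1
  have hj0 : (0 : ℝ) < j := by exact_mod_cast hj1
  have hv := Set.Ioo_subset_Ioc_self (fourierFreq_mem hj)
  have h3 : fourierFreq n j ^ (-2 * d) ≤ C₁⁻¹ * |f (fourierFreq n j)| := by
    rw [le_inv_mul_iff₀ hC₁]; exact (hb _ hv).1.trans (le_abs_self _)
  have h4 : (n * fourierFreq n j) ^ (-γ) ≤ (j : ℝ) ^ (-γ) := by
    refine Real.rpow_le_rpow_of_nonpos hj0 ?_ (by linarith)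
    rw [natCast_mul_fourierFreq hn]
    nlinarith [Real.pi_gt_three]
  calc _ ≤ C * fourierFreq n j ^ (-2 * d) * (n * fourierFreq n j) ^ (-γ) :=
        hK n _ hn hv (exp_fourierFreq_pow hn j) (one_le_mul_fourierFreq hn hj1)
    _ ≤ C * (C₁⁻¹ * |f (fourierFreq n j)|) * (j : ℝ) ^ (-γ) := by
        have := Real.rpow_nonneg (mul_nonneg n.cast_nonneg hv.1.le) (-γ)
        gcongr
    _ = _ := by ring

/-- For `d = 0` the density coincides with `g` on `(0, π]`, so the uniform Hölder rate holds also at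
the lowest frequencies, and `f` is bounded below. -/
theorem CaseC1.exists_abs_integral_foldedFejer_mul_sub_le (hf : IsSpectralDensity P X f)
    (hfg : HasMemoryForm f d g) (h : CaseC1 d g) :
    ∃ C γ : ℝ, 0 ≤ C ∧ 1 / 2 < γ ∧ ∀ n : ℕ, ∀ j ∈ Finset.Icc 1 (numFreq n),
      |(∫ u in (0 : ℝ)..Real.pi, foldedFejer n (fourierFreq n j) u * f u) - f (fourierFreq n j)| ≤
        C * (n : ℝ) ^ (-γ) * |f (fourierFreq n j)| := by
  obtain ⟨rfl, hg⟩ := h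
  obtain ⟨γ, L, h1, h2, hL, hH⟩ := hg.exists_holder
  obtain ⟨C₁, C₂, hC₁, hC₂, hb⟩ := hfg.exists_bounds
  have hfeq : ∀ u ∈ Set.Ioc 0 Real.pi, f u = g u := fun u hu => by
    rw [hfg.eq_rpow_mul hu]; simp
  obtain ⟨C, hC, hK⟩ := exists_abs_integral_foldedFejer_sub_le_of_holder (F := f) (by linarith) h2 hL
    hf.intervalIntegrable_zero_pi fun u hu v hv => by
      rw [hfeq u hu, hfeq v hv]; exact hH u hu v hv
  refine ⟨C * C₁⁻¹, γ, by positivity, h1, fun n j hj => ?_⟩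
  have hn : 0 < n := by have := four_le_of_mem_Icc_numFreq hj; omega
  have hv := Set.Ioo_subset_Ioc_self (fourierFreq_mem hj)
  have h3 : 1 ≤ C₁⁻¹ * |f (fourierFreq n j)| := by
    rw [le_inv_mul_iff₀ hC₁]
    simpa using (hb _ hv).1.trans (le_abs_self _)
  calc _ ≤ C * (n : ℝ) ^ (-γ) * 1 := by
        rw [mul_one]; exact hK n _ hn hv (exp_fourierFreq_pow hn j)
    _ ≤ C * (n : ℝ) ^ (-γ) * (C₁⁻¹ * |f (fourierFreq n j)|) := by gcongr
    _ = _ := by ring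

theorem summable_natCast_rpow_neg_sq {γ : ℝ} (hγ : 1 / 2 < γ) :
    Summable fun j : ℕ => ((j : ℝ) ^ (-γ)) ^ 2 := by
  refine (Real.summable_nat_rpow (p := -γ * 2).2 (by linarith)).congr fun j => ?_
  rw [Real.rpow_mul (Nat.cast_nonneg _), Real.rpow_two]

/-- The mean-square error is the variance plus the squared bias. The bias is a sum of `|b_j f(u_j)|`
against the square summable sequence `j^{-γ}`, so Cauchy–Schwarz bounds it by a multiple of `B`. -/
theorem exists_integral_sub_weightedSpectralSum_sq_le [IsProbabilityMeasure P]
    (hζ : IsStandardizedNoise P ζ)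
    (hX : IsLinearProcess P a ζ X) (hf : IsSpectralDensity P X f) (hfg : HasMemoryForm f d g)
    (h : CaseC1 d g ∨ CaseC2 d g ∨ CaseC3 f d) :
    ∃ C : ℝ, ∀ (b : ℕ → ℕ → ℝ) (n : ℕ),
      ∫ ω, (weightedPeriodogramSum b X n ω - weightedSpectralSum b f n) ^ 2 ∂P
        ≤ C * weightNorm b f n ^ 2 := by
  obtain ⟨C, γ, hC, hγ, hbias⟩ := exists_abs_integral_foldedFejer_mul_sub_le hf hfg h
  obtain ⟨V, hV⟩ := exists_integral_weightedPeriodogramSum_sub_sq_le hζ hX hf hfg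
  have hs := (summable_natCast_rpow_neg_sq hγ).mul_left (C ^ 2)
  refine ⟨V + ∑' j : ℕ, C ^ 2 * ((j : ℝ) ^ (-γ)) ^ 2, fun b n => ?_⟩
  obtain ⟨h2, hV⟩ := hV b n
  set Q := weightedPeriodogramSum b X n with hQ
  set T := weightedSpectralSum b f n with hT
  set m := ∫ ω, Q ω ∂P with hm
  have hi := h2.integrable one_le_two
  have hi2 : Integrable (fun ω => (Q ω - m) ^ 2) P := (h2.sub (memLp_const m)).integrable_sq
  have e : ∫ ω, (Q ω - T) ^ 2 ∂P = ∫ ω, (Q ω - m) ^ 2 ∂P + (m - T) ^ 2 := by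
    have e1 : ∀ ω, (Q ω - T) ^ 2 = (Q ω - m) ^ 2 + (2 * (m - T) * (Q ω - m) + (m - T) ^ 2) :=
      fun ω => by ring
    have i1 : Integrable (fun ω => 2 * (m - T) * (Q ω - m)) P :=
      (hi.sub (integrable_const m)).const_mul _
    simp only [e1]
    rw [integral_add hi2 (by fun_prop), integral_add i1 (integrable_const _),
      integral_const_mul, integral_sub hi (integrable_const m)]
    simp [hm]
  have hB : |m - T| ≤ √(∑' j : ℕ, C ^ 2 * ((j : ℝ) ^ (-γ)) ^ 2) * weightNorm b f n := by
    refine (abs_integral_weightedPeriodogramSum_sub_le hζ hX hf hfg (hbias n) b).trans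
      ((sum_mul_abs_le_sqrt_mul_weightNorm b f n _ subset_rfl).trans ?_)
    refine mul_le_mul_of_nonneg_right (Real.sqrt_le_sqrt ?_) (weightNorm_nonneg b f n)
    simp only [mul_pow]
    exact hs.sum_le_tsum _ fun _ _ => by positivity
  rw [e, add_mul]
  refine add_le_add hV ?_
  have := pow_le_pow_left₀ (abs_nonneg _) hB 2
  rwa [sq_abs, mul_pow, Real.sq_sqrt (tsum_nonneg fun _ => by positivity)] at this

/-- Cauchy–Schwarz with the constant error `n^{-γ}` over at most `n` frequencies gives the factor
`n^{1/2-γ}`, which tends to `0`. -/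
theorem CaseC1.isLittleO_integral_sub_weightedSpectralSum [IsProbabilityMeasure P]
    (hζ : IsStandardizedNoise P ζ)
    (hX : IsLinearProcess P a ζ X) (hf : IsSpectralDensity P X f) (hfg : HasMemoryForm f d g)
    (h : CaseC1 d g) (b : ℕ → ℕ → ℝ) :
    (fun n => (∫ ω, weightedPeriodogramSum b X n ω ∂P) - weightedSpectralSum b f n)
      =o[atTop] fun n => weightNorm b f n := by
  obtain ⟨C, γ, hC, hγ, hbias⟩ := h.exists_abs_integral_foldedFejer_mul_sub_le hf hfg
  have ht : Tendsto (fun n : ℕ => C * (n : ℝ) ^ (1 / 2 - γ)) atTop (𝓝 0) := by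
    have := (tendsto_rpow_neg_atTop (y := γ - 1 / 2) (by linarith)).comp tendsto_natCast_atTop_atTop
    simpa using (this.const_mul C)
  have ho : (fun n : ℕ => C * (n : ℝ) ^ (1 / 2 - γ) * weightNorm b f n) =o[atTop]
      fun n => weightNorm b f n := by
    simpa using ((isLittleO_one_iff ℝ).2 ht).mul_isBigO
      (isBigO_refl (fun n => weightNorm b f n) atTop)
  refine IsBigO.trans_isLittleO (IsBigO.of_bound 1 ?_) ho
  filter_upwards [eventually_gt_atTop 0] with n hn
  have hn' : (0 : ℝ) < n := by exact_mod_cast hn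
  have hB := weightNorm_nonneg b f n
  rw [one_mul, Real.norm_eq_abs, Real.norm_eq_abs,
    abs_of_nonneg (by positivity : 0 ≤ C * (n : ℝ) ^ (1 / 2 - γ) * weightNorm b f n)]
  refine (abs_integral_weightedPeriodogramSum_sub_le hζ hX hf hfg (hbias n) b).trans
      ((sum_mul_abs_le_sqrt_mul_weightNorm b f n _ subset_rfl).trans ?_)
  refine mul_le_mul_of_nonneg_right (Real.sqrt_le_iff.2 ⟨by positivity, ?_⟩) hB
  rw [Finset.sum_const, Nat.card_Icc, nsmul_eq_mul, Nat.add_sub_cancel]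
  have h1 : (numFreq n : ℝ) ≤ n := by
    have : numFreq n ≤ n := by rw [numFreq]; omega
    exact_mod_cast this
  calc (numFreq n : ℝ) * (C * (n : ℝ) ^ (-γ)) ^ 2 ≤ n * (C * (n : ℝ) ^ (-γ)) ^ 2 := by gcongr
    _ = (C * (n : ℝ) ^ (1 / 2 - γ)) ^ 2 := by
        rw [sub_eq_add_neg, Real.rpow_add hn', ← Real.sqrt_eq_rpow, mul_pow, mul_pow, mul_pow,
          Real.sq_sqrt hn'.le]
        ring

theorem WeightsNegligible.eventually_weightMax_le {b : ℕ → ℕ → ℝ} (hb : WeightsNegligible b f)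
    {ε : ℝ} (hε : 0 < ε) : ∀ᶠ n in atTop, weightMax b f n ≤ ε * weightNorm b f n := by
  filter_upwards [hb.eventually (gt_mem_nhds hε)] with n hn
  -- When `B = 0` the quotient is `0` by convention and says nothing; then `b_{f,n} ≤ B` gives the
  -- claim.
  rcases (weightNorm_nonneg b f n).eq_or_lt with h | h
  · exact (weightMax_le_weightNorm b f n).trans (by rw [← h, mul_zero])
  · exact ((div_lt_iff₀ h).1 hn).le

theorem WeightsNegligible.isLittleO_integral_sub_weightedSpectralSum [IsProbabilityMeasure P]
    (hζ : IsStandardizedNoise P ζ)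
    (hX : IsLinearProcess P a ζ X) (hf : IsSpectralDensity P X f) (hfg : HasMemoryForm f d g)
    (h : CaseC1 d g ∨ CaseC2 d g ∨ CaseC3 f d) {b : ℕ → ℕ → ℝ} (hb : WeightsNegligible b f) :
    (fun n => (∫ ω, weightedPeriodogramSum b X n ω ∂P) - weightedSpectralSum b f n)
      =o[atTop] fun n => weightNorm b f n := by
  obtain ⟨C, γ, hC, hγ, hbias⟩ := exists_abs_integral_foldedFejer_mul_sub_le hf hfg h
  have hs := (summable_natCast_rpow_neg_sq hγ).mul_left (C ^ 2)
  refine isLittleO_iff.2 fun ε hε => ?_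
  -- Outside `s` every finite sum of squared errors is below `(ε/2)²`, so Cauchy–Schwarz handles
  -- those frequencies. On `s`, which does not depend on `n`, each term is at most a constant times
  -- `b_{f,n}`.
  obtain ⟨s, hs⟩ := summable_iff_vanishing_norm.1 hs ((ε / 2) ^ 2) (by positivity)
  set R := ∑ j ∈ s, C * (j : ℝ) ^ (-γ) with hR
  have hR0 : 0 ≤ R := Finset.sum_nonneg fun _ _ => by positivity
  -- `R + 1` replaces `R` so that the denominator is positive even if `R = 0`.
  filter_upwards [hb.eventually_weightMax_le (ε := ε / 2 / (R + 1)) (by positivity)] with n hn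
  have hB := weightNorm_nonneg b f n
  have hM : 0 ≤ weightMax b f n := NNReal.coe_nonneg _
  rw [Real.norm_eq_abs, Real.norm_eq_abs, abs_of_nonneg hB]
  refine (abs_integral_weightedPeriodogramSum_sub_le hζ hX hf hfg (hbias n) b).trans ?_
  rw [← Finset.sum_filter_add_sum_filter_not _ (· ∈ s)]
  have h1 : ∑ j ∈ Finset.Icc 1 (numFreq n) with j ∈ s,
      C * (j : ℝ) ^ (-γ) * |b n j * f (fourierFreq n j)| ≤ ε / 2 * weightNorm b f n := by
    calc _ ≤ ∑ j ∈ Finset.Icc 1 (numFreq n) with j ∈ s, C * (j : ℝ) ^ (-γ) * weightMax b f n := by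
          refine Finset.sum_le_sum fun j hj => ?_
          have := abs_le_weightMax b f (Finset.mem_filter.1 hj).1
          gcongr
      _ ≤ ∑ j ∈ s, C * (j : ℝ) ^ (-γ) * weightMax b f n :=
          Finset.sum_le_sum_of_subset_of_nonneg (fun j hj => (Finset.mem_filter.1 hj).2)
            fun _ _ _ => by positivity
      _ = R * weightMax b f n := by rw [hR, Finset.sum_mul]
      _ ≤ (R + 1) * (ε / 2 / (R + 1) * weightNorm b f n) := by gcongr; linarith
      _ = _ := by field_simp
  have h2 : ∑ j ∈ Finset.Icc 1 (numFreq n) with j ∉ s,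
      C * (j : ℝ) ^ (-γ) * |b n j * f (fourierFreq n j)| ≤ ε / 2 * weightNorm b f n := by
    refine (sum_mul_abs_le_sqrt_mul_weightNorm b f n _ (Finset.filter_subset _ _)).trans
      (mul_le_mul_of_nonneg_right (Real.sqrt_le_iff.2 ⟨by positivity, ?_⟩) hB)
    simp only [mul_pow]
    exact (le_abs_self _).trans (hs _ (Finset.disjoint_left.2 fun j hj =>
      (Finset.mem_filter.1 hj).2)).le
  linarith

end Bias

/-! ### The theorem -/

theorem theorem3p3 {Ω : Type*} [MeasurableSpace Ω] (P : Measure Ω) [IsProbabilityMeasure P]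
    (a : ℕ → ℝ) (ζ X : ℤ → Ω → ℝ) (f : ℝ → ℝ) (d : ℝ) (g : ℝ → ℝ)
    (hζ : IsStandardizedNoise P ζ) (hX : IsLinearProcess P a ζ X)
    (hf : IsSpectralDensity P X f) (hfg : HasMemoryForm f d g) :
    -- mean-square bound around the expectation; all second moments involved are finite
    (∃ C : ℝ, ∀ (b : ℕ → ℕ → ℝ) (n : ℕ),
      MemLp (weightedPeriodogramSum b X n) 2 P ∧
      ∫ ω, (weightedPeriodogramSum b X n ω - ∫ ω', weightedPeriodogramSum b X n ω' ∂P) ^ 2 ∂P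
        ≤ C * weightNorm b f n ^ 2) ∧
    -- mean-square error bound in each of the three cases
    (CaseC1 d g ∨ CaseC2 d g ∨ CaseC3 f d →
      ∃ C : ℝ, ∀ (b : ℕ → ℕ → ℝ) (n : ℕ),
        ∫ ω, (weightedPeriodogramSum b X n ω - weightedSpectralSum b f n) ^ 2 ∂P
          ≤ C * weightNorm b f n ^ 2) ∧
    -- bias in the first case, for arbitrary weights
    (CaseC1 d g → ∀ b : ℕ → ℕ → ℝ,
      (fun n => (∫ ω, weightedPeriodogramSum b X n ω ∂P) - weightedSpectralSum b f n)
        =o[atTop] fun n => weightNorm b f n) ∧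
    -- bias in the other two cases, for uniformly negligible weights
    (CaseC2 d g ∨ CaseC3 f d → ∀ b : ℕ → ℕ → ℝ, WeightsNegligible b f →
      (fun n => (∫ ω, weightedPeriodogramSum b X n ω ∂P) - weightedSpectralSum b f n)
        =o[atTop] fun n => weightNorm b f n) :=
  ⟨exists_integral_weightedPeriodogramSum_sub_sq_le hζ hX hf hfg,
    exists_integral_sub_weightedSpectralSum_sq_le hζ hX hf hfg,
    fun h b => h.isLittleO_integral_sub_weightedSpectralSum hζ hX hf hfg b,
    fun h _ hb => hb.isLittleO_integral_sub_weightedSpectralSum hζ hX hf hfg (Or.inr h)⟩
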